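/- Let $k$ be a field and let $Sm/k$ be the category of smooth separated schemes of finite type over $k$. Let $X\in Sm/k$ and let $n\ge 0$ be an integer. **Framed correspondences.** Let $m\ge 0$ and let $U$ be a $k$-scheme. An explicit framed correspondence of level $m$ from $U$ to $X_+\wedge T^{n+1}$ is a tuple $$c=(Z,W,\phi_1,\dots,\phi_m;\,g;\,\psi_1,\dots,\psi_n;\,f),$$ where $Z\subset \mathbb A^m\times U$ is a closed subset (with reduced structure) finite over $U$; $p:W\to\mathbb A^m\times U$ is an étale neighbourhood of $Z$ (an étale morphism together with a section $s:Z\to W$ of $p$ over $Z$ such that $s$ identifies $Z$ with $p^{-1}(Z)$); $\phi_i,\psi_j,f$ are regular functions on $W$; and $g:W\to X$ is a morphism of $k$-schemes, such that $p^{-1}(Z)$ is the common vanishing locus of $\phi_1,\dots,\phi_m,\psi_1,\dots,\psi_n,f$ in $W$. Two tuples are equivalent if they have the same $Z$ and their data agree on a common refinement of the two étale neighbourhoods. $\mathrm{Fr}_m(U,X_+\wedge T^{n+1})$ is the set of equivalence classes. The subset $\mathrm{Fr}^{qf}_m(U,X_+\wedge T^{n+1})$ consists of those classes which have a representative such that the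 vanishing locus of $\phi_1,\dots,\phi_m,\psi_1,\dots,\psi_n$ in $W$ is quasi-finite over $U$. Both are presheaves in $U$ by base change. Let $$\mathbb ZF_m(U,X_+\wedge T^{n+1})=\mathbb Z[\mathrm{Fr}_m(U,X_+\wedge T^{n+1})]/A,\qquad \mathbb ZF_m^{qf}(U,X_+\wedge T^{n+1})=\mathbb Z[\mathrm{Fr}_m^{qf}(U,X_+\wedge T^{n+1})]/A,$$ where in each case $A$ is the subgroup generated by the elements $$(Z_1\sqcup Z_2,W,\phi;g;\psi;f)-(Z_1,W\smallsetminus p^{-1}(Z_2),\phi;g;\psi;f)-(Z_2,W\smallsetminus p^{-1}(Z_1),\phi;g;\psi;f)$$ (with the data restricted to the open subschemes shown) whose three terms belong to the set in question. The suspension $\Sigma(Z,W,\phi;g;\psi;f)=(Z\times\{0\},W\times\mathbb A^1,(\phi,t);g;\psi;f)$, with $t$ the coordinate on the new factor $\mathbb A^1$ and the other data pulled back to $W\times\mathbb A^1$, induces maps $\mathbb ZF_m\to\mathbb ZF_{m+1}$ and $\mathbb ZF^{qf}_m\to\mathbb ZF^{qf}_{m+1}$, and $$\mathbb ZF(-,X_+\wedge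 T^{n+1})=\operatorname{colim}_m \mathbb ZF_m(-,X_+\wedge T^{n+1}),\qquad \mathbb ZF^{qf}(-,X_+\wedge T^{n+1})=\operatorname{colim}_m \mathbb ZF^{qf}_m(-,X_+\wedge T^{n+1}).$$ **The complexes.** Let $\Delta^\bullet$ be the cosimplicial $k$-scheme $\Delta^l=\operatorname{Spec}k[t_0,\dots,t_l]/(t_0+\dots+t_l-1)$. For a presheaf of abelian groups $F$ let $C_*F$ be the presheaf of chain complexes $U\mapsto F(U\times\Delta^\bullet)$, with the alternating sums of the face maps as differentials. Write $C_*\mathbb ZF(X_+\wedge T^{n+1})$ and $C_*\mathbb ZF^{qf}(X_+\wedge T^{n+1})$ for the complexes of presheaves on $Sm/k$ obtained from $\mathbb ZF(-,X_+\wedge T^{n+1})$ and $\mathbb ZF^{qf}(-,X_+\wedge T^{n+1})$. **Theorem.** The natural map $$C_*\mathbb ZF^{qf}(X_+\wedge T^{n+1})\hookrightarrow C_*\mathbb ZF(X_+\wedge T^{n+1})$$ is injective and is a Zariski-local quasi-isomorphism of complexes of presheaves on $Sm/k$, i.e. in each degree it induces an isomorphism of the Zariski sheaves associated with the homology presheaves.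 Moreover, for every affine $U\in Sm/k$ the map of chain complexes $$C_*\mathbb ZF^{qf}(U,X_+\wedge T^{n+1})\longrightarrow C_*\mathbb ZF(U,X_+\wedge T^{n+1})$$ is a quasi-isomorphism. -/

import Mathlib

open CategoryTheory Limits Opposite AlgebraicGeometry TopologicalSpace

universe w v u

noncomputable section

namespace FramedSphere

/-! ### Closed subsets with their reduced structure -/

/-- The inclusion of a closed subset `Z` of a scheme `A`, regarded as a closed subscheme with its
reduced structure. -/
abbrev redι {A : Scheme.{u}} (Z : Closeds A) :
    (Scheme.IdealSheafData.vanishingIdeal Z).subscheme ⟶ A :=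
  (Scheme.IdealSheafData.vanishingIdeal Z).subschemeι

theorem range_redι {A : Scheme.{u}} (Z : Closeds A) : Set.range (redι Z) = Z := by
  rw [Scheme.IdealSheafData.range_subschemeι, Scheme.IdealSheafData.coe_support_vanishingIdeal]

theorem exists_redι_lift {A B : Scheme.{u}} (f : B ⟶ A) (Z' : Closeds B) (Z : Closeds A)
    (h : (Z' : Set B) ⊆ f ⁻¹' Z) : ∃ l, l ≫ redι Z = redι Z' ≫ f := by
  have hk : (redι Z).ker ≤ (redι Z' ≫ f).ker := by
    rw [Scheme.Hom.ker_comp, Scheme.IdealSheafData.ker_subschemeι,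
      Scheme.IdealSheafData.ker_subschemeι, Scheme.IdealSheafData.map_vanishingIdeal]
    apply Scheme.IdealSheafData.vanishingIdeal_antimono
    rw [TopologicalSpace.Closeds.closure_le, Set.image_subset_iff]
    exact h
  exact ⟨IsClosedImmersion.lift _ _ hk, IsClosedImmersion.lift_fac _ _ hk⟩

/-- The reduced structure is the smallest one: it is contained in every closed subscheme with the
same underlying set. -/
theorem exists_redι_factor {A T : Scheme.{u}} (i : T ⟶ A) [IsClosedImmersion i] (Z : Closeds A)
    (h : Set.range i = Z) : ∃ l, IsClosedImmersion l ∧ l ≫ i = redι Z := by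
  have hk : i.ker ≤ (redι Z).ker := by
    rw [Scheme.IdealSheafData.ker_subschemeι, ← Scheme.IdealSheafData.le_support_iff_le_vanishingIdeal]
    intro x hx
    have := i.support_ker
    change x ∈ (i.ker.support : Set A)
    rw [this, h]
    exact subset_closure hx
  have hf := IsClosedImmersion.lift_fac i (redι Z) hk
  refine ⟨IsClosedImmersion.lift _ _ hk, ?_, hf⟩
  have : IsClosedImmersion (IsClosedImmersion.lift i (redι Z) hk ≫ i) := by
    rw [hf]; infer_instance
  exact IsClosedImmersion.of_comp_isClosedImmersion _ i

/-- The common zero locus of a set of global functions, as a closed subset. -/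
def zeros (W : Scheme.{u}) (s : Set Γ(W, ⊤)) : Closeds W := ⟨W.zeroLocus s, W.zeroLocus_isClosed s⟩

theorem coe_zeros (W : Scheme.{u}) (s : Set Γ(W, ⊤)) : (zeros W s : Set W) = W.zeroLocus s := rfl

/-- The preimage of a closed subset under a morphism of schemes. -/
def pre {A B : Scheme.{u}} (f : B ⟶ A) (Z : Closeds A) : Closeds B := Z.preimage f.continuous

theorem coe_pre {A B : Scheme.{u}} (f : B ⟶ A) (Z : Closeds A) :
    (pre f Z : Set B) = f ⁻¹' Z := rfl

theorem mem_pre {A B : Scheme.{u}} (f : B ⟶ A) (Z : Closeds A) (x : B) :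
    x ∈ pre f Z ↔ f x ∈ Z := Iff.rfl

theorem pre_comp {A B C : Scheme.{u}} (f : B ⟶ A) (g : C ⟶ B) (Z : Closeds A) :
    pre (g ≫ f) Z = pre g (pre f Z) := by
  ext x; simp [coe_pre]

theorem pre_id {A : Scheme.{u}} (Z : Closeds A) : pre (𝟙 A) Z = Z := by
  ext x; simp [coe_pre]

theorem pre_inf {A B : Scheme.{u}} (f : B ⟶ A) (Z Z' : Closeds A) :
    pre f (Z ⊓ Z') = pre f Z ⊓ pre f Z' := by
  ext x; simp [coe_pre]

theorem pre_sup {A B : Scheme.{u}} (f : B ⟶ A) (Z Z' : Closeds A) :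
    pre f (Z ⊔ Z') = pre f Z ⊔ pre f Z' := by
  ext x; simp [coe_pre]

theorem pre_zeros {A B : Scheme.{u}} (f : B ⟶ A) (s : Set Γ(A, ⊤)) :
    pre f (zeros A s) = zeros B (f.appTop '' s) := by
  ext x
  change x ∈ f ⁻¹' A.zeroLocus s ↔ x ∈ B.zeroLocus _
  rw [Scheme.preimage_zeroLocus]
  rfl

theorem zeros_union {A : Scheme.{u}} (s t : Set Γ(A, ⊤)) :
    zeros A (s ∪ t) = zeros A s ⊓ zeros A t := by
  ext x
  simp only [coe_zeros, TopologicalSpace.Closeds.coe_inf, Set.mem_inter_iff,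
    Scheme.mem_zeroLocus_iff, Set.mem_union]
  constructor
  · intro h; exact ⟨fun f hf => h f (Or.inl hf), fun f hf => h f (Or.inr hf)⟩
  · rintro ⟨h, h'⟩ f (hf | hf); exacts [h f hf, h' f hf]

/-! ### Étale neighbourhoods -/

/-- `p : W ⟶ A` is an étale neighbourhood of the closed subset `Z` of `A`: it is étale, and there
is a section `s : Z ⟶ W` of `p` over `Z` which identifies `Z` with `p⁻¹(Z)`. -/
def IsEtaleNhd {A W : Scheme.{u}} (p : W ⟶ A) (Z : Closeds A) : Prop :=
  Etale p ∧ ∃ s, IsPullback s (𝟙 _) p (redι Z)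

theorem IsEtaleNhd.pullback {A A' W : Scheme.{u}} {p : W ⟶ A} {Z : Closeds A}
    (h : IsEtaleNhd p Z) (a : A' ⟶ A) (Z' : Closeds A') (hZ : Z' ≤ pre a Z) :
    IsEtaleNhd (pullback.snd p a) Z' := by
  obtain ⟨h1, s, hs⟩ := h
  refine ⟨inferInstance, ?_⟩
  obtain ⟨l, hl⟩ := exists_redι_lift a Z' Z hZ
  have h2 : IsPullback (l ≫ s) (𝟙 _) p (redι Z' ≫ a) := by
    have h3 : IsPullback l (𝟙 _) (𝟙 _) l := IsPullback.of_vert_isIso ⟨by simp⟩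
    have := h3.paste_horiz hs
    rwa [hl] at this
  refine ⟨pullback.lift (l ≫ s) (redι Z') (by simpa using h2.w), ?_⟩
  refine IsPullback.of_right (t := IsPullback.of_hasPullback p a) ?_
    (by rw [pullback.lift_snd, Category.id_comp])
  rw [pullback.lift_fst]
  exact h2

theorem IsEtaleNhd.mono {A W : Scheme.{u}} {p : W ⟶ A} {Z : Closeds A}
    (h : IsEtaleNhd p Z) (Z' : Closeds A) (hZ : Z' ≤ Z) : IsEtaleNhd p Z' := by
  obtain ⟨h1, s, hs⟩ := h
  refine ⟨h1, ?_⟩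
  obtain ⟨l, hl⟩ := exists_redι_lift (𝟙 A) Z' Z hZ
  rw [Category.comp_id] at hl
  have h3 : IsPullback l (𝟙 _) (𝟙 _) l := IsPullback.of_vert_isIso ⟨by simp⟩
  have := h3.paste_horiz hs
  rw [hl] at this
  exact ⟨_, this⟩

theorem section_unique {A W Z : Scheme.{u}} {p : W ⟶ A} {i : Z ⟶ A} {s : Z ⟶ W}
    (h : IsPullback s (𝟙 _) p i) (t : Z ⟶ W) (ht : t ≫ p = i) : t = s := by
  have w : t ≫ p = 𝟙 _ ≫ i := by simpa using ht
  have h1 : h.lift t (𝟙 _) w = 𝟙 _ := by simpa using h.lift_snd t (𝟙 _) w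
  have h2 := h.lift_fst t (𝟙 _) w
  rw [h1, Category.id_comp] at h2
  exact h2.symm

/-- The fibre product of two refinements of an étale neighbourhood is again a refinement. -/
theorem IsEtaleNhd.fiber {A W W₁ W₂ : Scheme.{u}} {p : W ⟶ A} {Z : Closeds A} {r₁ : W₁ ⟶ W}
    {r₂ : W₂ ⟶ W} (h : IsEtaleNhd p Z) (h₁ : IsEtaleNhd (r₁ ≫ p) Z) (h₂ : IsEtaleNhd (r₂ ≫ p) Z) :
    IsEtaleNhd (Limits.pullback.fst r₁ r₂ ≫ r₁ ≫ p) Z := by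
  obtain ⟨e, s, hs⟩ := h
  obtain ⟨e₁, s₁, hs₁⟩ := h₁
  obtain ⟨e₂, s₂, hs₂⟩ := h₂
  have e₂' : Etale r₂ := Etale.of_comp r₂ p
  refine ⟨inferInstance, ?_⟩
  have q₁ : s₁ ≫ r₁ = s := section_unique hs _ (by simpa using hs₁.w)
  have q₂ : s₂ ≫ r₂ = s := section_unique hs _ (by simpa using hs₂.w)
  have i₁ : IsPullback s₁ (𝟙 _) r₁ s := by
    refine IsPullback.of_bot (v₂₁ := 𝟙 _) ?_ (by simpa using q₁) hs
    simpa using hs₁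
  have i₂ : IsPullback (Limits.pullback.lift s₁ s₂ (q₁.trans q₂.symm)) (𝟙 _)
      (Limits.pullback.snd r₁ r₂) s₂ := by
    refine IsPullback.of_right (t := IsPullback.of_hasPullback r₁ r₂) ?_
      (by rw [pullback.lift_snd, Category.id_comp])
    rw [pullback.lift_fst, q₂]
    exact i₁
  have := i₂.paste_vert hs₂
  rw [Category.comp_id, ← Category.assoc, ← pullback.condition, Category.assoc] at this
  exact ⟨_, this⟩

theorem IsEtaleNhd.restrict {A W : Scheme.{u}} {p : W ⟶ A} {Z : Closeds A}
    (h : IsEtaleNhd p Z) (V : W.Opens) (hV : p ⁻¹' Z ⊆ V) : IsEtaleNhd (V.ι ≫ p) Z := by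
  obtain ⟨h1, s, hs⟩ := h
  refine ⟨inferInstance, ?_⟩
  have hr : Set.range s ⊆ Set.range V.ι := by
    rintro _ ⟨z, rfl⟩
    rw [Scheme.Opens.range_ι]
    apply hV
    have : (s ≫ p) z = (redι Z) z := by rw [hs.w, Category.id_comp]
    change p (s z) ∈ (Z : Set A)
    rw [← Scheme.Hom.comp_apply, this, ← range_redι]
    exact ⟨z, rfl⟩
  refine ⟨IsOpenImmersion.lift V.ι s hr, ?_⟩
  have hf := IsOpenImmersion.lift_fac V.ι s hr
  have h2 : IsPullback (IsOpenImmersion.lift V.ι s hr) (𝟙 _) V.ι s := by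
    refine ⟨⟨by rw [hf, Category.id_comp]⟩, ⟨PullbackCone.IsLimit.mk _ (fun c => c.snd) ?_ ?_ ?_⟩⟩
    · intro c
      rw [← cancel_mono V.ι, Category.assoc, hf, c.condition]
    · intro c; simp
    · intro c m _ hm; simpa using hm
  simpa using h2.paste_vert hs

/-! ### Affine spaces -/

/-- The affine space `𝔸ᵐ × S` over a scheme `S`. -/
abbrev Aff (m : ℕ) (S : Scheme.{u}) : Scheme.{u} := 𝔸(ULift.{u} (Fin m); S)

/-- The projection `𝔸ᵐ × S ⟶ S`. -/
abbrev Aff.str (m : ℕ) (S : Scheme.{u}) : Aff m S ⟶ S := 𝔸(ULift.{u} (Fin m); S) ↘ S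

/-- The morphism `𝔸ᵐ × S ⟶ 𝔸ᵐ × T` induced by `f : S ⟶ T`. -/
abbrev Aff.map (m : ℕ) {S T : Scheme.{u}} (f : S ⟶ T) : Aff m S ⟶ Aff m T :=
  AffineSpace.map (ULift.{u} (Fin m)) f

/-- The projection `𝔸ᵐ⁺¹ × S ⟶ 𝔸ᵐ × S` forgetting the last coordinate. -/
def Aff.pr (m : ℕ) (S : Scheme.{u}) : Aff (m + 1) S ⟶ Aff m S :=
  AffineSpace.reindex (fun i : ULift.{u} (Fin m) => ULift.up i.down.castSucc) S

/-- The last coordinate function `t` on `𝔸ᵐ⁺¹ × S`. -/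
def Aff.last (m : ℕ) (S : Scheme.{u}) : Γ(Aff (m + 1) S, ⊤) :=
  AffineSpace.coord S (ULift.up (Fin.last m))

/-- The closed embedding `𝔸ᵐ × S ⟶ 𝔸ᵐ⁺¹ × S` with last coordinate zero. -/
def Aff.zero (m : ℕ) (S : Scheme.{u}) : Aff m S ⟶ Aff (m + 1) S :=
  AffineSpace.homOfVector (Aff.str m S) fun i =>
    Fin.snoc (α := fun _ => Γ(Aff m S, ⊤)) (fun j => AffineSpace.coord S (ULift.up j)) 0 i.down

theorem Aff.pr_str (m : ℕ) (S : Scheme.{u}) : Aff.pr m S ≫ Aff.str m S = Aff.str (m + 1) S :=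
  AffineSpace.reindex_over _ _

theorem Aff.zero_str (m : ℕ) (S : Scheme.{u}) : Aff.zero m S ≫ Aff.str (m + 1) S = Aff.str m S :=
  AffineSpace.homOfVector_over _ _

theorem comp_appTop_apply {S T R : Scheme.{u}} (f : S ⟶ T) (g : T ⟶ R) (a : Γ(R, ⊤)) :
    (f ≫ g).appTop a = f.appTop (g.appTop a) := by
  rw [Scheme.Hom.comp_appTop]; rfl

theorem Aff.pr_coord (m : ℕ) (S : Scheme.{u}) (j : Fin m) :
    (Aff.pr m S).appTop (AffineSpace.coord S (ULift.up j)) =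
      AffineSpace.coord S (ULift.up j.castSucc) :=
  AffineSpace.reindex_appTop_coord _ _ _

theorem Aff.zero_coord (m : ℕ) (S : Scheme.{u}) (j : Fin m) :
    (Aff.zero m S).appTop (AffineSpace.coord S (ULift.up j.castSucc)) =
      AffineSpace.coord S (ULift.up j) := by
  rw [Aff.zero, AffineSpace.homOfVector_appTop_coord, Fin.snoc_castSucc]

theorem Aff.zero_last (m : ℕ) (S : Scheme.{u}) : (Aff.zero m S).appTop (Aff.last m S) = 0 := by
  rw [Aff.zero, Aff.last, AffineSpace.homOfVector_appTop_coord, Fin.snoc_last]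

theorem Aff.zero_pr (m : ℕ) (S : Scheme.{u}) : Aff.zero m S ≫ Aff.pr m S = 𝟙 _ := by
  apply AffineSpace.hom_ext
  · rw [Category.assoc, Category.id_comp]
    exact (congrArg (Aff.zero m S ≫ ·) (Aff.pr_str m S)).trans (Aff.zero_str m S)
  · rintro ⟨i⟩
    rw [comp_appTop_apply, Aff.pr_coord, Aff.zero_coord]
    simp

theorem Aff.eq_zero_of_last {m : ℕ} {S T : Scheme.{u}} (x : T ⟶ Aff (m + 1) S)
    (h : x.appTop (Aff.last m S) = 0) : x ≫ Aff.pr m S ≫ Aff.zero m S = x := by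
  apply AffineSpace.hom_ext
  · rw [Category.assoc, Category.assoc]
    exact (congrArg (fun q => x ≫ Aff.pr m S ≫ q) (Aff.zero_str m S)).trans
      (congrArg (x ≫ ·) (Aff.pr_str m S))
  · rintro ⟨i⟩
    rw [comp_appTop_apply, comp_appTop_apply]
    induction i using Fin.lastCases with
    | last =>
      change x.appTop ((Aff.pr m S).appTop ((Aff.zero m S).appTop (Aff.last m S))) =
        x.appTop (Aff.last m S)
      rw [Aff.zero_last, h, map_zero, map_zero]
    | cast j => rw [Aff.zero_coord, Aff.pr_coord]

theorem Aff.map_pr (m : ℕ) {S T : Scheme.{u}} (f : S ⟶ T) :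
    Aff.map (m + 1) f ≫ Aff.pr m T = Aff.pr m S ≫ Aff.map m f :=
  AffineSpace.map_reindex _ _

theorem Aff.map_last (m : ℕ) {S T : Scheme.{u}} (f : S ⟶ T) :
    (Aff.map (m + 1) f).appTop (Aff.last m T) = Aff.last m S := by
  simp [Aff.last]

instance (m : ℕ) (S : Scheme.{u}) : IsClosedImmersion (Aff.zero m S) := by
  have : IsAffineHom (Aff.pr m S ≫ Aff.str m S) := by rw [Aff.pr_str]; infer_instance
  have : IsAffineHom (Aff.pr m S) := IsAffineHom.of_comp _ (Aff.str m S)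
  have : IsClosedImmersion (Aff.zero m S ≫ Aff.pr m S) := by rw [Aff.zero_pr]; infer_instance
  exact IsClosedImmersion.of_comp _ (Aff.pr m S)

theorem appTop_eq_zero_of_mem {W : Scheme.{u}} (t : Γ(W, ⊤)) (x : W) (h : x ∈ zeros W {t}) :
    (W.fromSpecResidueField x).appTop t = 0 := by
  rw [← basicOpen_eq_bot_iff]
  have h1 : ∀ y, y ∈ pre (W.fromSpecResidueField x) (zeros W {t}) := by
    intro y
    rw [mem_pre, Scheme.fromSpecResidueField_apply]
    exact h
  rw [pre_zeros, Set.image_singleton] at h1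
  ext y
  have := h1 y
  simp only [TopologicalSpace.Opens.coe_bot, Set.mem_empty_iff_false, iff_false]
  exact (Scheme.mem_zeroLocus_iff _ _ _).mp this _ rfl

/-- A point of `𝔸ᵐ⁺¹ × S` at which the last coordinate vanishes lies on the zero section. -/
theorem Aff.zero_pr_apply {m : ℕ} {S T : Scheme.{u}} (f : T ⟶ Aff (m + 1) S)
    (x : T) (h : f x ∈ zeros _ {Aff.last m S}) :
    T.fromSpecResidueField x ≫ f ≫ Aff.pr m S ≫ Aff.zero m S = T.fromSpecResidueField x ≫ f := by
  have h1 : x ∈ zeros T {f.appTop (Aff.last m S)} := by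
    rw [← mem_pre, pre_zeros, Set.image_singleton] at h
    exact h
  have h2 := appTop_eq_zero_of_mem _ _ h1
  have := Aff.eq_zero_of_last (T.fromSpecResidueField x ≫ f)
    (by rw [Scheme.Hom.comp_appTop]; exact h2)
  simpa using this

/-- The open complement of a closed subset. -/
def cpl {A : Scheme.{u}} (Z : Closeds A) : A.Opens := Z.compl

/-- Finiteness over the base of a closed subset (with reduced structure) may be tested on any closed
subscheme with the same underlying set. -/
theorem isFinite_redι {A T U : Scheme.{u}} (i : T ⟶ A) [IsClosedImmersion i] (Z : Closeds A)
    (h : Set.range i = Z) (π : A ⟶ U) (hf : IsFinite (i ≫ π)) : IsFinite (redι Z ≫ π) := by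
  obtain ⟨l, hl, e⟩ := exists_redι_factor i Z h
  rw [← e, Category.assoc]
  infer_instance

/-- A closed subset `Z` of a `U`-scheme `π : A ⟶ U`, with its reduced structure, is quasi-finite
over `U`: it has finite (discrete) fibres and is quasi-compact over `U`. -/
def IsQuasiFiniteOver {A U : Scheme.{u}} (π : A ⟶ U) (Z : Closeds A) : Prop :=
  LocallyQuasiFinite (redι Z ≫ π) ∧ QuasiCompact (redι Z ≫ π)

theorem isQuasiFiniteOver_of {A T U : Scheme.{u}} (i : T ⟶ A) [IsClosedImmersion i] (Z : Closeds A)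
    (h : Set.range i = Z) (π : A ⟶ U) (h1 : LocallyQuasiFinite (i ≫ π))
    (h2 : QuasiCompact (i ≫ π)) : IsQuasiFiniteOver π Z := by
  obtain ⟨l, hl, e⟩ := exists_redι_factor i Z h
  constructor <;> rw [← e, Category.assoc] <;> infer_instance

/-- An explicit framed correspondence of level `m` from `U` to `X₊ ∧ Tⁿ⁺¹`, where `X` and `U` are
schemes over `S`: a tuple `(Z, W, φ₁, …, φₘ; g; ψ₁, …, ψₙ; f)`, where `Z` is a closed subset of
`𝔸ᵐ × U` finite over `U`, `W` is an étale neighbourhood of `Z` in `𝔸ᵐ × U`, the `φᵢ`, `ψⱼ` and `f`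
are regular functions on `W`, and `g : W ⟶ X` is a morphism over `S`, such that `Z` is the common
vanishing locus of all these functions in `W`. The functions `ψ` are the components of the
map from `W` to the factor `𝔸ⁿ` of `X × 𝔸ⁿ`, and `f` is the component belonging to the
last factor `T`. -/
structure Explicit {S : Scheme.{u}} (X : Over S) (n m : ℕ) (U : Over S) where
  /-- the support -/
  Z : Closeds (Aff m U.left)
  finite : IsFinite (redι Z ≫ Aff.str m U.left)
  /-- the étale neighbourhood -/
  W : Scheme.{u}
  /-- the structure map of the étale neighbourhood -/
  p : W ⟶ Aff m U.left
  nhd : IsEtaleNhd p Z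
  /-- the functions `φ₁, …, φₘ` -/
  φ : Fin m → Γ(W, ⊤)
  /-- the map to `X` -/
  g : W ⟶ X.left
  g_over : g ≫ X.hom = p ≫ Aff.str m U.left ≫ U.hom
  /-- the functions `ψ₁, …, ψₙ` -/
  ψ : Fin n → Γ(W, ⊤)
  /-- the last function -/
  f : Γ(W, ⊤)
  support : pre p Z = zeros W (Set.range φ ∪ Set.range ψ ∪ {f})

namespace Explicit

variable {S : Scheme.{u}} {X : Over S} {n m : ℕ} {U V : Over S}

/-- Equivalence of explicit framed correspondences: the supports agree, and the data agree on a
common refinement `W''` of the two étale neighbourhoods `W` and `W'`. -/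
def Rel (c c' : Explicit X n m U) : Prop :=
  c.Z = c'.Z ∧ ∃ (W'' : Scheme.{u}) (q : W'' ⟶ c.W) (q' : W'' ⟶ c'.W),
    q ≫ c.p = q' ≫ c'.p ∧ IsEtaleNhd (q ≫ c.p) c.Z ∧
    (∀ i, q.appTop (c.φ i) = q'.appTop (c'.φ i)) ∧ q ≫ c.g = q' ≫ c'.g ∧
    (∀ i, q.appTop (c.ψ i) = q'.appTop (c'.ψ i)) ∧ q.appTop c.f = q'.appTop c'.f

theorem Rel.of_hom {c c' : Explicit X n m U} (hZ : c.Z = c'.Z) (h : c.W ⟶ c'.W)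
    (hp : h ≫ c'.p = c.p) (hφ : ∀ i, h.appTop (c'.φ i) = c.φ i) (hg : h ≫ c'.g = c.g)
    (hψ : ∀ i, h.appTop (c'.ψ i) = c.ψ i) (hf : h.appTop c'.f = c.f) : Rel c c' :=
  ⟨hZ, c.W, 𝟙 _, h, by simp [hp], by simpa using c.nhd, by simp [hφ], by simp [hg], by simp [hψ],
    by simp [hf]⟩

theorem Rel.refl (c : Explicit X n m U) : Rel c c :=
  Rel.of_hom rfl (𝟙 _) (by simp) (by simp) (by simp) (by simp) (by simp)

theorem Rel.symm {c c' : Explicit X n m U} (h : Rel c c') : Rel c' c := by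
  obtain ⟨hZ, W, q, q', hp, hn, h1, h2, h3, h4⟩ := h
  exact ⟨hZ.symm, W, q', q, hp.symm, by rwa [← hp, ← hZ], fun i => (h1 i).symm, h2.symm,
    fun i => (h3 i).symm, h4.symm⟩

theorem Rel.trans {c c' c'' : Explicit X n m U} (h : Rel c c') (h' : Rel c' c'') : Rel c c'' := by
  obtain ⟨hZ, W, q, q', hp, hn, h1, h2, h3, h4⟩ := h
  obtain ⟨hZ', W', r, r', hp', hn', h1', h2', h3', h4'⟩ := h'
  have hw := pullback.condition (f := q') (g := r)
  have ha : ∀ a, (pullback.fst q' r).appTop (q'.appTop a) =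
      (pullback.snd q' r).appTop (r.appTop a) := by
    intro a
    rw [← comp_appTop_apply, ← comp_appTop_apply, hw]
  refine ⟨hZ.trans hZ', pullback q' r, pullback.fst q' r ≫ q, pullback.snd q' r ≫ r', ?_, ?_, ?_,
    ?_, ?_, ?_⟩
  · rw [Category.assoc, Category.assoc, hp, ← hp', ← Category.assoc, hw, Category.assoc]
  · rw [Category.assoc, hp]
    rw [hp] at hn
    rw [← hZ] at hn'
    exact IsEtaleNhd.fiber (hZ ▸ c'.nhd) hn hn'
  · intro i
    rw [comp_appTop_apply, comp_appTop_apply, h1, ha, h1']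
  · rw [Category.assoc, Category.assoc, h2, ← h2', ← Category.assoc, hw, Category.assoc]
  · intro i
    rw [comp_appTop_apply, comp_appTop_apply, h3, ha, h3']
  · rw [comp_appTop_apply, comp_appTop_apply, h4, ha, h4']

instance setoid (X : Over S) (n m : ℕ) (U : Over S) : Setoid (Explicit X n m U) :=
  ⟨Rel, Rel.refl, Rel.symm, Rel.trans⟩

theorem image_range {ι : Type*} {A B : Scheme.{u}} (q : B ⟶ A) (a : ι → Γ(A, ⊤)) :
    q.appTop '' Set.range a = Set.range fun i => q.appTop (a i) := by
  rw [← Set.range_comp]; rfl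

theorem pre_zeros_union {ι κ : Type*} {A B : Scheme.{u}} (q : B ⟶ A) (a : ι → Γ(A, ⊤))
    (b : κ → Γ(A, ⊤)) (f : Γ(A, ⊤)) :
    pre q (zeros A (Set.range a ∪ Set.range b ∪ {f})) =
      zeros B ((Set.range fun i => q.appTop (a i)) ∪ (Set.range fun i => q.appTop (b i)) ∪
        {q.appTop f}) := by
  rw [pre_zeros, Set.image_union, Set.image_union, image_range, image_range, Set.image_singleton]

theorem finite_pull {A B : Scheme.{u}} (f : B ⟶ A) (m : ℕ) (Z : Closeds (Aff m A))
    (h : IsFinite (redι Z ≫ Aff.str m A)) :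
    IsFinite (redι (pre (Aff.map m f) Z) ≫ Aff.str m B) := by
  refine isFinite_redι (pullback.snd (redι Z) (Aff.map m f)) _ ?_ _ ?_
  · rw [Scheme.Pullback.range_snd, range_redι]; rfl
  · have h1 := (IsPullback.of_hasPullback (redι Z) (Aff.map m f)).paste_vert
      (AffineSpace.isPullback_map (n := ULift.{u} (Fin m)) f)
    exact MorphismProperty.of_isPullback (P := @IsFinite) h1 h

/-- The pullback of an explicit framed correspondence along a morphism `f : V ⟶ U`. -/
def pull (h : V ⟶ U) (c : Explicit X n m U) : Explicit X n m V where
  Z := pre (Aff.map m h.left) c.Z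
  finite := finite_pull h.left m c.Z c.finite
  W := pullback c.p (Aff.map m h.left)
  p := pullback.snd c.p (Aff.map m h.left)
  nhd := c.nhd.pullback _ _ le_rfl
  φ i := (pullback.fst c.p (Aff.map m h.left)).appTop (c.φ i)
  g := pullback.fst c.p (Aff.map m h.left) ≫ c.g
  g_over := by
    have h1 : Aff.map m h.left ≫ Aff.str m U.left = Aff.str m V.left ≫ h.left :=
      AffineSpace.map_over _
    rw [Category.assoc, c.g_over, ← Over.w h, ← Category.assoc (Aff.str m V.left), ← h1,
      ← Category.assoc, pullback.condition]
    simp only [Category.assoc]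
  ψ i := (pullback.fst c.p (Aff.map m h.left)).appTop (c.ψ i)
  f := (pullback.fst c.p (Aff.map m h.left)).appTop c.f
  support := by
    rw [← pre_comp, ← pullback.condition, pre_comp, c.support, pre_zeros_union]

/-- The closed subset `Z × {0}` of `𝔸ᵐ⁺¹ × U`. -/
def timesZero {m : ℕ} {U : Scheme.{u}} (Z : Closeds (Aff m U)) : Closeds (Aff (m + 1) U) :=
  pre (Aff.pr m U) Z ⊓ zeros _ {Aff.last m U}

/-- The support of the suspension: `Z × {0}` in `𝔸ᵐ⁺¹ × U`. -/
def suspZ (c : Explicit X n m U) : Closeds (Aff (m + 1) U.left) :=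
  timesZero c.Z

theorem range_snoc {α : Type*} {m : ℕ} (a : Fin m → α) (b : α) :
    Set.range (Fin.snoc (α := fun _ => α) a b : Fin (m + 1) → α) = Set.range a ∪ {b} := by
  ext x
  simp only [Set.mem_range, Set.mem_union, Set.mem_singleton_iff]
  constructor
  · rintro ⟨i, rfl⟩
    induction i using Fin.lastCases with
    | last => simp
    | cast j => left; exact ⟨j, by simp⟩
  · rintro (⟨j, rfl⟩ | rfl)
    · exact ⟨j.castSucc, by simp⟩
    · exact ⟨Fin.last m, by simp⟩

theorem zero_last_mem {m : ℕ} {U : Scheme.{u}} (x : Aff m U) :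
    Aff.zero m U x ∈ zeros _ {Aff.last m U} := by
  rw [← mem_pre, pre_zeros, Set.image_singleton, Aff.zero_last]
  exact (Scheme.mem_zeroLocus_iff _ _ _).mpr (by simp)

theorem finite_susp (c : Explicit X n m U) :
    IsFinite (redι c.suspZ ≫ Aff.str (m + 1) U.left) := by
  refine isFinite_redι (redι c.Z ≫ Aff.zero m U.left) _ ?_ _ ?_
  · apply Set.eq_of_subset_of_subset
    · rintro _ ⟨z, rfl⟩
      refine ⟨?_, ?_⟩
      · change (Aff.pr m U.left) _ ∈ (c.Z : Set _)
        rw [← Scheme.Hom.comp_apply, Category.assoc, Aff.zero_pr, Category.comp_id, ← range_redι]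
        exact ⟨z, rfl⟩
      · exact zero_last_mem _
    · intro x hx
      have h1 : Aff.pr m U.left x ∈ Set.range (redι c.Z) := by
        rw [range_redι]; exact hx.1
      obtain ⟨z, hz⟩ := h1
      refine ⟨z, ?_⟩
      have h2 := Aff.zero_pr_apply (𝟙 _) x (by simpa using hx.2)
      obtain ⟨y⟩ : Nonempty (Spec ((Aff (m + 1) U.left).residueField x)) := inferInstance
      have h3 := congrArg (fun t => t y) h2
      simp only [Scheme.Hom.comp_apply, Scheme.fromSpecResidueField_apply] at h3
      rw [Scheme.Hom.comp_apply, hz]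
      exact h3
  · rw [Category.assoc, Aff.zero_str]
    exact c.finite

/-- The functions `(φ₁, …, φₘ, t)` of the suspension. -/
def suspφ (c : Explicit X n m U) : Fin (m + 1) → Γ(pullback c.p (Aff.pr m U.left), ⊤) :=
  Fin.snoc (α := fun _ => Γ(pullback c.p (Aff.pr m U.left), ⊤))
    (fun i => (pullback.fst c.p (Aff.pr m U.left)).appTop (c.φ i))
    ((pullback.snd c.p (Aff.pr m U.left)).appTop (Aff.last m U.left))

theorem susp_φ_last (c : Explicit X n m U) : c.suspφ (Fin.last m) =
    (pullback.snd c.p (Aff.pr m U.left)).appTop (Aff.last m U.left) := by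
  rw [suspφ, Fin.snoc_last]

theorem susp_φ_cast (c : Explicit X n m U) (j : Fin m) : c.suspφ j.castSucc =
    (pullback.fst c.p (Aff.pr m U.left)).appTop (c.φ j) := by
  rw [suspφ, Fin.snoc_castSucc]

/-- The suspension
`Σ(Z, W, φ; g; ψ; f) = (Z × {0}, W × 𝔸¹, (φ, t); g; ψ; f)`, where `t` is the last coordinate; the
product `W × 𝔸¹` is realised as the fibre product of `W` and `𝔸ᵐ⁺¹ × U` over `𝔸ᵐ × U`. -/
def susp (c : Explicit X n m U) : Explicit X n (m + 1) U where
  Z := c.suspZ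
  finite := c.finite_susp
  W := pullback c.p (Aff.pr m U.left)
  p := pullback.snd c.p (Aff.pr m U.left)
  nhd := c.nhd.pullback _ _ inf_le_left
  φ := c.suspφ
  g := pullback.fst c.p (Aff.pr m U.left) ≫ c.g
  g_over := by
    rw [Category.assoc, c.g_over, ← Aff.pr_str, ← Category.assoc, pullback.condition]
    simp only [Category.assoc]
  ψ i := (pullback.fst c.p (Aff.pr m U.left)).appTop (c.ψ i)
  f := (pullback.fst c.p (Aff.pr m U.left)).appTop c.f
  support := by
    rw [suspZ, timesZero, pre_inf, ← pre_comp, ← pullback.condition, pre_comp, c.support, pre_zeros_union,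
      pre_zeros, ← zeros_union, suspφ, range_snoc, Set.image_singleton]
    congr 1
    ext x
    simp only [Set.mem_union]
    tauto

/-- The restriction of `(Z, W, φ; g; ψ; f)` with `Z = Z₁ ⊔ Z₂` to
`(Z₁, W ∖ Z₂, φ; g; ψ; f)`. -/
def restrict (c : Explicit X n m U) (Z₁ Z₂ : Closeds (Aff m U.left)) (hd : Disjoint Z₁ Z₂)
    (hs : Z₁ ⊔ Z₂ = c.Z) : Explicit X n m U where
  Z := Z₁
  finite := by
    obtain ⟨l, hl⟩ := exists_redι_lift (𝟙 _) Z₁ c.Z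
      (by rw [← hs]; exact (le_sup_left : Z₁ ≤ Z₁ ⊔ Z₂))
    rw [Category.comp_id] at hl
    have h1 : IsClosedImmersion (l ≫ redι c.Z) := by rw [hl]; infer_instance
    have h2 : IsClosedImmersion l := IsClosedImmersion.of_comp_isClosedImmersion l (redι c.Z)
    have h3 := c.finite
    rw [← hl, Category.assoc]
    infer_instance
  W := (cpl (pre c.p Z₂)).toScheme
  p := (cpl (pre c.p Z₂)).ι ≫ c.p
  nhd := by
    refine (c.nhd.mono Z₁ (by rw [← hs]; exact le_sup_left)).restrict _ ?_
    intro x hx hx'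
    exact (TopologicalSpace.Closeds.ext_iff.mp (disjoint_iff.mp hd)).le ⟨hx, hx'⟩
  φ i := (cpl (pre c.p Z₂)).ι.appTop (c.φ i)
  g := (cpl (pre c.p Z₂)).ι ≫ c.g
  g_over := by rw [Category.assoc, c.g_over]; simp only [Category.assoc]
  ψ i := (cpl (pre c.p Z₂)).ι.appTop (c.ψ i)
  f := (cpl (pre c.p Z₂)).ι.appTop c.f
  support := by
    rw [← pre_zeros_union, ← c.support, ← hs, pre_comp, pre_sup, pre_sup]
    have : pre (cpl (pre c.p Z₂)).ι (pre c.p Z₂) = ⊥ := by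
      ext x
      simp only [TopologicalSpace.Closeds.coe_bot, Set.mem_empty_iff_false, iff_false]
      intro hx
      exact x.2 hx
    rw [this, sup_bot_eq]

/-- The vanishing locus of `φ₁, …, φₘ, ψ₁, …, ψₙ` in `W`. -/
def qfLocus (c : Explicit X n m U) : Closeds c.W := zeros c.W (Set.range c.φ ∪ Set.range c.ψ)

/-- The vanishing locus of `φ₁, …, φₘ, ψ₁, …, ψₙ` is quasi-finite over `U`. -/
def IsQf (c : Explicit X n m U) : Prop :=
  IsQuasiFiniteOver (c.p ≫ Aff.str m U.left) c.qfLocus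

theorem IsQf.pull (h : V ⟶ U) {c : Explicit X n m U} (hc : c.IsQf) : (c.pull h).IsQf := by
  have h0 := (IsPullback.of_hasPullback c.p (Aff.map m h.left)).paste_vert
      (AffineSpace.isPullback_map (n := ULift.{u} (Fin m)) h.left)
  have h1 := (IsPullback.of_hasPullback (redι c.qfLocus)
    (pullback.fst c.p (Aff.map m h.left))).paste_vert h0
  refine isQuasiFiniteOver_of (pullback.snd (redι c.qfLocus)
    (pullback.fst c.p (Aff.map m h.left))) _ ?_ _
    (MorphismProperty.of_isPullback (P := @LocallyQuasiFinite) h1 hc.1)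
    (MorphismProperty.of_isPullback (P := @QuasiCompact) h1 hc.2)
  rw [Scheme.Pullback.range_snd, range_redι]
  have h2 : pre (pullback.fst c.p (Aff.map m h.left)) c.qfLocus = (c.pull h).qfLocus := by
    rw [qfLocus, pre_zeros, Set.image_union, image_range, image_range]; rfl
  rw [← h2]
  rfl

theorem IsQf.susp {c : Explicit X n m U} (hc : c.IsQf) : c.susp.IsQf := by
  have hw : 𝟙 c.W ≫ c.p = (c.p ≫ Aff.zero m U.left) ≫ Aff.pr m U.left := by
    rw [Category.assoc, Aff.zero_pr, Category.comp_id, Category.id_comp]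
  let σ : c.W ⟶ pullback c.p (Aff.pr m U.left) := pullback.lift (𝟙 _) (c.p ≫ Aff.zero m U.left) hw
  have hσ₁ : σ ≫ pullback.fst c.p (Aff.pr m U.left) = 𝟙 _ := pullback.lift_fst _ _ _
  have hσ₂ : σ ≫ pullback.snd c.p (Aff.pr m U.left) = c.p ≫ Aff.zero m U.left :=
    pullback.lift_snd _ _ _
  have hσ : IsClosedImmersion σ := by
    have : IsAffineHom (Aff.pr m U.left ≫ Aff.str m U.left) := by rw [Aff.pr_str]; infer_instance
    have : IsAffineHom (Aff.pr m U.left) := IsAffineHom.of_comp _ (Aff.str m U.left)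
    have : IsClosedImmersion (σ ≫ pullback.fst c.p (Aff.pr m U.left)) := by
      rw [hσ₁]; infer_instance
    exact IsClosedImmersion.of_comp _ (pullback.fst c.p (Aff.pr m U.left))
  have hq : c.susp.qfLocus = pre (pullback.fst c.p (Aff.pr m U.left)) c.qfLocus ⊓
      pre (pullback.snd c.p (Aff.pr m U.left)) (zeros _ {Aff.last m U.left}) := by
    have h0 : c.susp.qfLocus = zeros (pullback c.p (Aff.pr m U.left))
        (Set.range (Fin.snoc (α := fun _ => Γ(pullback c.p (Aff.pr m U.left), ⊤))
          (fun i => (pullback.fst c.p (Aff.pr m U.left)).appTop (c.φ i))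
          ((pullback.snd c.p (Aff.pr m U.left)).appTop (Aff.last m U.left))) ∪
        Set.range fun i => (pullback.fst c.p (Aff.pr m U.left)).appTop (c.ψ i)) := rfl
    rw [h0, range_snoc, qfLocus, pre_zeros, pre_zeros, Set.image_union, image_range, image_range,
      ← zeros_union, Set.image_singleton]
    congr 1
    ext x
    simp only [Set.mem_union]
    tauto
  have he : (redι c.qfLocus ≫ σ) ≫ c.susp.p ≫ Aff.str (m + 1) U.left =
      redι c.qfLocus ≫ c.p ≫ Aff.str m U.left := by
    change (redι c.qfLocus ≫ σ) ≫ pullback.snd c.p (Aff.pr m U.left) ≫ _ = _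
    rw [Category.assoc, ← Category.assoc σ, hσ₂, Category.assoc, Aff.zero_str]
  have h1 : LocallyQuasiFinite (redι c.qfLocus ≫ c.p ≫ Aff.str m U.left) := hc.1
  have h2 : QuasiCompact (redι c.qfLocus ≫ c.p ≫ Aff.str m U.left) := hc.2
  refine isQuasiFiniteOver_of (redι c.qfLocus ≫ σ) _ ?_ _ (he ▸ h1) (he ▸ h2)
  rw [hq]
  apply Set.eq_of_subset_of_subset
  · rintro _ ⟨z, rfl⟩
    refine ⟨?_, ?_⟩
    · change (pullback.fst c.p (Aff.pr m U.left)) _ ∈ (c.qfLocus : Set _)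
      rw [← Scheme.Hom.comp_apply, Category.assoc, hσ₁, Category.comp_id, ← range_redι]
      exact ⟨z, rfl⟩
    · change (pullback.snd c.p (Aff.pr m U.left)) _ ∈ zeros _ _
      rw [← Scheme.Hom.comp_apply, Category.assoc, hσ₂, ← Category.assoc, Scheme.Hom.comp_apply]
      exact zero_last_mem _
  · intro x hx
    have h1 : pullback.fst c.p (Aff.pr m U.left) x ∈ Set.range (redι c.qfLocus) := by
      rw [range_redι]; exact hx.1
    obtain ⟨z, hz⟩ := h1
    refine ⟨z, ?_⟩
    have h2 := Aff.zero_pr_apply (pullback.snd c.p (Aff.pr m U.left)) x hx.2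
    have h4 : Scheme.fromSpecResidueField _ x ≫ pullback.fst c.p (Aff.pr m U.left) ≫ σ =
        Scheme.fromSpecResidueField _ x := by
      apply pullback.hom_ext
      · rw [Category.assoc, Category.assoc, hσ₁, Category.comp_id]
      · rw [Category.assoc, Category.assoc, hσ₂, ← h2, ← pullback.condition_assoc]
    obtain ⟨y⟩ : Nonempty (Spec ((pullback c.p (Aff.pr m U.left)).residueField x)) := inferInstance
    have h3 := congrArg (fun t => t y) h4
    simp only [Scheme.Hom.comp_apply, Scheme.fromSpecResidueField_apply] at h3
    rw [Scheme.Hom.comp_apply, hz, h3]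

/-! ### Compatibilities -/

theorem Rel.pull (h : V ⟶ U) {c c' : Explicit X n m U} (hr : Rel c c') :
    Rel (c.pull h) (c'.pull h) := by
  obtain ⟨hZ, W, q, q', hp, hn, h1, h2, h3, h4⟩ := hr
  let a := Aff.map m h.left
  let r : Limits.pullback (q ≫ c.p) a ⟶ Limits.pullback c.p a :=
    pullback.lift (pullback.fst _ _ ≫ q) (pullback.snd _ _) (by
      rw [← pullback.condition, Category.assoc])
  let r' : Limits.pullback (q ≫ c.p) a ⟶ Limits.pullback c'.p a :=
    pullback.lift (pullback.fst _ _ ≫ q') (pullback.snd _ _) (by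
      rw [← pullback.condition, hp, Category.assoc])
  have e₁ : r ≫ pullback.fst c.p a = pullback.fst _ _ ≫ q := pullback.lift_fst _ _ _
  have e₂ : r ≫ pullback.snd c.p a = pullback.snd _ _ := pullback.lift_snd _ _ _
  have e₁' : r' ≫ pullback.fst c'.p a = pullback.fst _ _ ≫ q' := pullback.lift_fst _ _ _
  have e₂' : r' ≫ pullback.snd c'.p a = pullback.snd _ _ := pullback.lift_snd _ _ _
  have key : ∀ (x : Γ(c.W, ⊤)) (x' : Γ(c'.W, ⊤)), q.appTop x = q'.appTop x' →
      r.appTop ((pullback.fst c.p a).appTop x) = r'.appTop ((pullback.fst c'.p a).appTop x') := by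
    intro x x' hx
    rw [← comp_appTop_apply, ← comp_appTop_apply, e₁, e₁', comp_appTop_apply, hx,
      ← comp_appTop_apply]
  refine ⟨congrArg (pre a) hZ, _, r, r', ?_, ?_, fun i => key _ _ (h1 i), ?_,
    fun i => key _ _ (h3 i), key _ _ h4⟩
  · exact e₂.trans e₂'.symm
  · change IsEtaleNhd (r ≫ pullback.snd c.p a) (pre a c.Z)
    rw [e₂]
    exact hn.pullback _ _ le_rfl
  · change r ≫ pullback.fst c.p a ≫ c.g = r' ≫ pullback.fst c'.p a ≫ c'.g
    rw [← Category.assoc, e₁, ← Category.assoc, e₁', Category.assoc, h2, Category.assoc]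

theorem Rel.susp {c c' : Explicit X n m U} (hr : Rel c c') : Rel c.susp c'.susp := by
  obtain ⟨hZ, W, q, q', hp, hn, h1, h2, h3, h4⟩ := hr
  let a := Aff.pr m U.left
  let r : Limits.pullback (q ≫ c.p) a ⟶ Limits.pullback c.p a :=
    pullback.lift (pullback.fst _ _ ≫ q) (pullback.snd _ _) (by
      rw [← pullback.condition, Category.assoc])
  let r' : Limits.pullback (q ≫ c.p) a ⟶ Limits.pullback c'.p a :=
    pullback.lift (pullback.fst _ _ ≫ q') (pullback.snd _ _) (by
      rw [← pullback.condition, hp, Category.assoc])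
  have e₁ : r ≫ pullback.fst c.p a = pullback.fst _ _ ≫ q := pullback.lift_fst _ _ _
  have e₂ : r ≫ pullback.snd c.p a = pullback.snd _ _ := pullback.lift_snd _ _ _
  have e₁' : r' ≫ pullback.fst c'.p a = pullback.fst _ _ ≫ q' := pullback.lift_fst _ _ _
  have e₂' : r' ≫ pullback.snd c'.p a = pullback.snd _ _ := pullback.lift_snd _ _ _
  have key : ∀ (x : Γ(c.W, ⊤)) (x' : Γ(c'.W, ⊤)), q.appTop x = q'.appTop x' →
      r.appTop ((pullback.fst c.p a).appTop x) = r'.appTop ((pullback.fst c'.p a).appTop x') := by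
    intro x x' hx
    rw [← comp_appTop_apply, ← comp_appTop_apply, e₁, e₁', comp_appTop_apply, hx,
      ← comp_appTop_apply]
  have hZ' : c.suspZ = c'.suspZ := by rw [suspZ, suspZ, hZ]
  refine ⟨hZ', _, r, r', ?_, ?_, fun i => ?_, ?_, fun i => key _ _ (h3 i), key _ _ h4⟩
  · exact e₂.trans e₂'.symm
  · change IsEtaleNhd (r ≫ pullback.snd c.p a) c.suspZ
    rw [e₂]
    exact hn.pullback _ _ inf_le_left
  · induction i using Fin.lastCases with
    | last =>
      refine (congrArg r.appTop c.susp_φ_last).trans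
        (Eq.trans ?_ (congrArg r'.appTop c'.susp_φ_last).symm)
      change r.appTop ((pullback.snd c.p a).appTop _) = r'.appTop ((pullback.snd c'.p a).appTop _)
      rw [← comp_appTop_apply, ← comp_appTop_apply]
      rw [e₂, e₂']
    | cast j =>
      exact (congrArg r.appTop (c.susp_φ_cast j)).trans
        ((key _ _ (h1 j)).trans (congrArg r'.appTop (c'.susp_φ_cast j)).symm)
  · change r ≫ pullback.fst c.p a ≫ c.g = r' ≫ pullback.fst c'.p a ≫ c'.g
    rw [← Category.assoc, e₁, ← Category.assoc, e₁', Category.assoc, h2, Category.assoc]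

theorem pull_id (c : Explicit X n m U) : Rel (c.pull (𝟙 U)) c := by
  have h0 : Aff.map m (𝟙 U : U ⟶ U).left = 𝟙 _ := AffineSpace.map_id _
  refine Rel.of_hom ?_ (pullback.fst c.p _) ?_ (fun _ => rfl) rfl (fun _ => rfl) rfl
  · change pre (Aff.map m (𝟙 U : U ⟶ U).left) c.Z = c.Z
    rw [h0, pre_id]
  · change _ = pullback.snd c.p (Aff.map m (𝟙 U : U ⟶ U).left)
    exact (pullback.condition (f := c.p) (g := Aff.map m (𝟙 U : U ⟶ U).left)).trans
      ((congrArg (pullback.snd c.p _ ≫ ·) h0).trans (Category.comp_id _))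

theorem pull_comp {V' : Over S} (h : V ⟶ U) (h' : V' ⟶ V) (c : Explicit X n m U) :
    Rel (c.pull (h' ≫ h)) ((c.pull h).pull h') := by
  have h0 : Aff.map m (h' ≫ h).left = Aff.map m h'.left ≫ Aff.map m h.left :=
    AffineSpace.map_comp _ _
  let a := Aff.map m h.left
  let a' := Aff.map m h'.left
  let b := Aff.map m (h' ≫ h).left
  have hw : pullback.fst c.p b ≫ c.p = (pullback.snd c.p b ≫ a') ≫ a := by
    rw [pullback.condition, Category.assoc]
    exact congrArg (pullback.snd c.p b ≫ ·) h0
  let r₀ : Limits.pullback c.p b ⟶ Limits.pullback c.p a := pullback.lift _ _ hw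
  have e₁ : r₀ ≫ pullback.fst c.p a = pullback.fst c.p b := pullback.lift_fst _ _ _
  have e₂ : r₀ ≫ pullback.snd c.p a = pullback.snd c.p b ≫ a' := pullback.lift_snd _ _ _
  let r : Limits.pullback c.p b ⟶ Limits.pullback (pullback.snd c.p a) a' := pullback.lift _ _ e₂
  have e₃ : r ≫ pullback.fst (pullback.snd c.p a) a' = r₀ := pullback.lift_fst _ _ _
  have e₄ : r ≫ pullback.snd (pullback.snd c.p a) a' = pullback.snd c.p b := pullback.lift_snd _ _ _
  have key : ∀ x : Γ(c.W, ⊤), r.appTop ((pullback.fst (pullback.snd c.p a) a').appTop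
      ((pullback.fst c.p a).appTop x)) = (pullback.fst c.p b).appTop x := by
    intro x
    rw [← comp_appTop_apply, ← comp_appTop_apply, e₃, e₁]
  refine Rel.of_hom ?_ r e₄ (fun _ => key _) ?_ (fun _ => key _) (key _)
  · change pre b c.Z = pre a' (pre a c.Z)
    rw [← pre_comp, ← h0]
  · change r ≫ pullback.fst (pullback.snd c.p a) a' ≫ pullback.fst c.p a ≫ c.g =
      pullback.fst c.p b ≫ c.g
    rw [← Category.assoc, e₃, ← Category.assoc, e₁]

theorem pull_susp (h : V ⟶ U) (c : Explicit X n m U) : Rel (c.susp.pull h) (c.pull h).susp := by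
  let a := Aff.map m h.left
  let a' := Aff.map (m + 1) h.left
  let b := Aff.pr m U.left
  let b' := Aff.pr m V.left
  have h0 : a' ≫ b = b' ≫ a := Aff.map_pr m h.left
  let P := Limits.pullback (pullback.snd c.p b) a'
  have hw : (pullback.fst (pullback.snd c.p b) a' ≫ pullback.fst c.p b) ≫ c.p =
      (pullback.snd (pullback.snd c.p b) a' ≫ b') ≫ a := by
    rw [Category.assoc, pullback.condition, ← Category.assoc, pullback.condition, Category.assoc,
      h0, Category.assoc]
  let r₀ : P ⟶ Limits.pullback c.p a := pullback.lift _ _ hw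
  have e₁ : r₀ ≫ pullback.fst c.p a = pullback.fst (pullback.snd c.p b) a' ≫ pullback.fst c.p b :=
    pullback.lift_fst _ _ _
  have e₂ : r₀ ≫ pullback.snd c.p a = pullback.snd (pullback.snd c.p b) a' ≫ b' :=
    pullback.lift_snd _ _ _
  let r : P ⟶ Limits.pullback (pullback.snd c.p a) b' := pullback.lift _ _ e₂
  have e₃ : r ≫ pullback.fst (pullback.snd c.p a) b' = r₀ := pullback.lift_fst _ _ _
  have e₄ : r ≫ pullback.snd (pullback.snd c.p a) b' = pullback.snd (pullback.snd c.p b) a' :=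
    pullback.lift_snd _ _ _
  have key : ∀ x : Γ(c.W, ⊤), r.appTop ((pullback.fst (pullback.snd c.p a) b').appTop
      ((pullback.fst c.p a).appTop x)) =
        (pullback.fst (pullback.snd c.p b) a').appTop ((pullback.fst c.p b).appTop x) := by
    intro x
    rw [← comp_appTop_apply, ← comp_appTop_apply, e₃, e₁, comp_appTop_apply]
  refine Rel.of_hom ?_ r e₄ (fun i => ?_) ?_ (fun _ => key _) (key _)
  · change pre a' (pre b c.Z ⊓ zeros _ _) = pre b' (pre a c.Z) ⊓ zeros _ _
    rw [pre_inf, ← pre_comp, ← pre_comp, h0, pre_zeros, Set.image_singleton, Aff.map_last]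
  · change r.appTop (Fin.snoc (α := fun _ => Γ(Limits.pullback (pullback.snd c.p a) b', ⊤))
      (fun i => (pullback.fst (pullback.snd c.p a) b').appTop ((pullback.fst c.p a).appTop (c.φ i)))
      ((pullback.snd (pullback.snd c.p a) b').appTop (Aff.last m V.left)) i) =
      (pullback.fst (pullback.snd c.p b) a').appTop
        (Fin.snoc (α := fun _ => Γ(Limits.pullback c.p b, ⊤))
          (fun i => (pullback.fst c.p b).appTop (c.φ i))
          ((pullback.snd c.p b).appTop (Aff.last m U.left)) i)
    induction i using Fin.lastCases with
    | last =>
      rw [Fin.snoc_last, Fin.snoc_last, ← comp_appTop_apply, ← comp_appTop_apply, e₄,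
        pullback.condition, comp_appTop_apply, Aff.map_last]
    | cast j =>
      rw [Fin.snoc_castSucc, Fin.snoc_castSucc]
      exact key _
  · change r ≫ pullback.fst (pullback.snd c.p a) b' ≫ pullback.fst c.p a ≫ c.g =
      pullback.fst (pullback.snd c.p b) a' ≫ pullback.fst c.p b ≫ c.g
    rw [← Category.assoc, e₃, ← Category.assoc, e₁, Category.assoc]

/-- Restricting the étale neighbourhood commutes with pulling it back. -/
theorem exists_restrict_hom {A A' W : Scheme.{u}} (p : W ⟶ A) (a : A' ⟶ A) (Z : Closeds A)
    (Z' : Closeds A') (hZ : Z' ≤ pre a Z) :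
    ∃ r : Limits.pullback ((cpl (pre p Z)).ι ≫ p) a ⟶
        (cpl (pre (pullback.snd p a) Z')).toScheme,
      r ≫ (cpl (pre (pullback.snd p a) Z')).ι ≫ pullback.snd p a = pullback.snd _ _ ∧
      r ≫ (cpl (pre (pullback.snd p a) Z')).ι ≫ pullback.fst p a =
        pullback.fst _ _ ≫ (cpl (pre p Z)).ι := by
  let V := cpl (pre p Z)
  let V' := cpl (pre (pullback.snd p a) Z')
  let r₀ : Limits.pullback (V.ι ≫ p) a ⟶ Limits.pullback p a :=
    pullback.lift (pullback.fst _ _ ≫ V.ι) (pullback.snd _ _) (by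
      rw [← pullback.condition, Category.assoc])
  have e₁ : r₀ ≫ pullback.fst p a = pullback.fst _ _ ≫ V.ι := pullback.lift_fst _ _ _
  have e₂ : r₀ ≫ pullback.snd p a = pullback.snd _ _ := pullback.lift_snd _ _ _
  have hr : Set.range r₀ ⊆ Set.range V'.ι := by
    rintro _ ⟨x, rfl⟩
    rw [Scheme.Opens.range_ι]
    intro hx
    have hx' : (r₀ ≫ pullback.snd p a) x ∈ pre a Z := hZ hx
    rw [← mem_pre, ← pre_comp, Category.assoc, ← pullback.condition, ← Category.assoc, e₁,
      mem_pre] at hx'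
    exact (pullback.fst (V.ι ≫ p) a x).2 hx'
  refine ⟨IsOpenImmersion.lift V'.ι r₀ hr, ?_, ?_⟩
  · rw [← Category.assoc, IsOpenImmersion.lift_fac, e₂]
  · rw [← Category.assoc, IsOpenImmersion.lift_fac, e₁]

theorem pre_disjoint {A B : Scheme.{u}} (f : B ⟶ A) {Z₁ Z₂ : Closeds A} (h : Disjoint Z₁ Z₂) :
    Disjoint (pre f Z₁) (pre f Z₂) := by
  rw [disjoint_iff] at h ⊢
  rw [← pre_inf, h]
  ext x; simp [coe_pre]

theorem pull_restrict (h : V ⟶ U) (c : Explicit X n m U) (Z₁ Z₂ : Closeds (Aff m U.left))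
    (hd : Disjoint Z₁ Z₂) (hs : Z₁ ⊔ Z₂ = c.Z) :
    Rel ((c.restrict Z₁ Z₂ hd hs).pull h)
      ((c.pull h).restrict (pre (Aff.map m h.left) Z₁) (pre (Aff.map m h.left) Z₂)
        (pre_disjoint _ hd) (by rw [← pre_sup, hs]; rfl)) := by
  obtain ⟨r, h1, h2⟩ := exists_restrict_hom c.p (Aff.map m h.left) Z₂ _ le_rfl
  have key : ∀ x : Γ(c.W, ⊤), r.appTop ((cpl (pre (pullback.snd c.p (Aff.map m h.left))
      (pre (Aff.map m h.left) Z₂))).ι.appTop ((pullback.fst c.p (Aff.map m h.left)).appTop x)) =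
      (pullback.fst ((cpl (pre c.p Z₂)).ι ≫ c.p) (Aff.map m h.left)).appTop
        ((cpl (pre c.p Z₂)).ι.appTop x) := by
    intro x
    rw [← comp_appTop_apply, ← comp_appTop_apply, ← comp_appTop_apply]
    exact congrArg (fun t => Scheme.Hom.appTop t x) h2
  refine Rel.of_hom rfl r h1 (fun _ => key _) ?_ (fun _ => key _) (key _)
  have := congrArg (· ≫ c.g) h2
  simp only [Category.assoc] at this
  exact this

theorem susp_restrict (c : Explicit X n m U) (Z₁ Z₂ : Closeds (Aff m U.left))
    (hd : Disjoint Z₁ Z₂) (hs : Z₁ ⊔ Z₂ = c.Z) :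
    Rel (c.restrict Z₁ Z₂ hd hs).susp
      (c.susp.restrict (timesZero Z₁) (timesZero Z₂)
        ((pre_disjoint _ hd).mono inf_le_left inf_le_left)
        (by
          change _ = timesZero c.Z
          rw [← hs, timesZero, timesZero, timesZero, pre_sup, inf_sup_right])) := by
  obtain ⟨r, h1, h2⟩ := exists_restrict_hom c.p (Aff.pr m U.left) Z₂ (timesZero Z₂) inf_le_left
  let ι' := (cpl (pre (pullback.snd c.p (Aff.pr m U.left)) (timesZero Z₂))).ι
  have key : ∀ x : Γ(c.W, ⊤), r.appTop (ι'.appTop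
      ((pullback.fst c.p (Aff.pr m U.left)).appTop x)) =
      (pullback.fst ((cpl (pre c.p Z₂)).ι ≫ c.p) (Aff.pr m U.left)).appTop
        ((cpl (pre c.p Z₂)).ι.appTop x) := by
    intro x
    rw [← comp_appTop_apply, ← comp_appTop_apply, ← comp_appTop_apply]
    exact congrArg (fun t => Scheme.Hom.appTop t x) h2
  refine Rel.of_hom rfl r h1 (fun i => ?_) ?_ (fun _ => key _) (key _)
  · change r.appTop (ι'.appTop (c.suspφ i)) = (c.restrict Z₁ Z₂ hd hs).suspφ i
    induction i using Fin.lastCases with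
    | last =>
      rw [susp_φ_last, susp_φ_last, ← comp_appTop_apply, ← comp_appTop_apply]
      exact congrArg (fun t => Scheme.Hom.appTop t (Aff.last m U.left)) h1
    | cast j =>
      rw [susp_φ_cast, susp_φ_cast]
      exact key _
  · have := congrArg (· ≫ c.g) h2
    simp only [Category.assoc] at this
    exact this

end Explicit

/-! ### Framed correspondences -/

section Fr

variable {S : Scheme.{u}} (X : Over S) (n m : ℕ) {U V : Over S}

/-- The set `Frₘ(U, X₊ ∧ Tⁿ⁺¹)` of framed correspondences of level `m`: equivalence classes of
explicit framed correspondences. -/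
def Fr (U : Over S) : Type (u + 1) := Quotient (Explicit.setoid X n m U)

variable {X n m}

/-- The pullback of framed correspondences along a morphism. -/
def Fr.pull (h : V ⟶ U) : Fr X n m U → Fr X n m V :=
  Quotient.map (Explicit.pull h) fun _ _ hr => Explicit.Rel.pull h hr

/-- The suspension of framed correspondences. -/
def Fr.susp : Fr X n m U → Fr X n (m + 1) U :=
  Quotient.map Explicit.susp fun _ _ hr => Explicit.Rel.susp hr

theorem Fr.pull_id (c : Fr X n m U) : Fr.pull (𝟙 U) c = c := by
  induction c using Quotient.inductionOn with
  | h e => exact Quotient.sound (Explicit.pull_id e)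

theorem Fr.pull_comp {V' : Over S} (h : V ⟶ U) (h' : V' ⟶ V) (c : Fr X n m U) :
    Fr.pull (h' ≫ h) c = Fr.pull h' (Fr.pull h c) := by
  induction c using Quotient.inductionOn with
  | h e => exact Quotient.sound (Explicit.pull_comp h h' e)

theorem Fr.pull_susp (h : V ⟶ U) (c : Fr X n m U) :
    Fr.pull h (Fr.susp c) = Fr.susp (Fr.pull h c) := by
  induction c using Quotient.inductionOn with
  | h e => exact Quotient.sound (Explicit.pull_susp h e)

/-- The subset `Fr^qfₘ(U, X₊ ∧ Tⁿ⁺¹)`: the classes having a representative for which the vanishing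
locus of `φ₁, …, φₘ, ψ₁, …, ψₙ` in `W` is quasi-finite over `U`. -/
def Fr.IsQf (c : Fr X n m U) : Prop :=
  ∃ e : Explicit X n m U, (Quotient.mk _ e : Fr X n m U) = c ∧ e.IsQf

theorem Fr.IsQf.pull (h : V ⟶ U) {c : Fr X n m U} (hc : c.IsQf) : (Fr.pull h c).IsQf := by
  obtain ⟨e, rfl, he⟩ := hc
  exact ⟨e.pull h, rfl, he.pull h⟩

theorem Fr.IsQf.susp {c : Fr X n m U} (hc : c.IsQf) : (Fr.susp c).IsQf := by
  obtain ⟨e, rfl, he⟩ := hc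
  exact ⟨e.susp, rfl, he.susp⟩

/-- The additivity relation: `c`, `c₁`, `c₂` are the classes of `(Z₁ ⊔ Z₂, W, φ; g; ψ; f)`,
of `(Z₁, W ∖ Z₂, φ; g; ψ; f)` and of `(Z₂, W ∖ Z₁, φ; g; ψ; f)`. -/
def Fr.IsSum (c c₁ c₂ : Fr X n m U) : Prop :=
  ∃ (e : Explicit X n m U) (Z₁ Z₂ : Closeds (Aff m U.left)) (hd : Disjoint Z₁ Z₂)
    (hs : Z₁ ⊔ Z₂ = e.Z), c = Quotient.mk _ e ∧ c₁ = Quotient.mk _ (e.restrict Z₁ Z₂ hd hs) ∧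
      c₂ = Quotient.mk _ (e.restrict Z₂ Z₁ hd.symm ((sup_comm _ _).trans hs))

theorem Fr.IsSum.pull (h : V ⟶ U) {c c₁ c₂ : Fr X n m U} (hc : Fr.IsSum c c₁ c₂) :
    Fr.IsSum (Fr.pull h c) (Fr.pull h c₁) (Fr.pull h c₂) := by
  obtain ⟨e, Z₁, Z₂, hd, hs, rfl, rfl, rfl⟩ := hc
  exact ⟨e.pull h, _, _, _, _, rfl, Quotient.sound (Explicit.pull_restrict h e Z₁ Z₂ hd hs),
    Quotient.sound (Explicit.pull_restrict h e Z₂ Z₁ _ _)⟩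

theorem Fr.IsSum.susp {c c₁ c₂ : Fr X n m U} (hc : Fr.IsSum c c₁ c₂) :
    Fr.IsSum (Fr.susp c) (Fr.susp c₁) (Fr.susp c₂) := by
  obtain ⟨e, Z₁, Z₂, hd, hs, rfl, rfl, rfl⟩ := hc
  exact ⟨e.susp, _, _, _, _, rfl, Quotient.sound (Explicit.susp_restrict e Z₁ Z₂ hd hs),
    Quotient.sound (Explicit.susp_restrict e Z₂ Z₁ _ _)⟩

variable (X n m)

/-- The set `Fr^qfₘ(U, X₊ ∧ Tⁿ⁺¹)` as a type. -/
def FrQf (U : Over S) : Type (u + 1) := {c : Fr X n m U // c.IsQf}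

end Fr

/-! ### Linear framed correspondences -/

/-- The quotient of the free abelian group on a set `T` by the relations `[a] = [b] + [c]` for all
`a, b, c` with `R a b c`. -/
def AddQuot (T : Type w) (R : T → T → T → Prop) : Type w :=
  FreeAbelianGroup T ⧸ AddSubgroup.closure
    {x : FreeAbelianGroup T | ∃ a b c, R a b c ∧
      x = FreeAbelianGroup.of a - FreeAbelianGroup.of b - FreeAbelianGroup.of c}

namespace AddQuot

instance (T : Type w) (R : T → T → T → Prop) : AddCommGroup (AddQuot T R) :=
  inferInstanceAs (AddCommGroup (FreeAbelianGroup T ⧸ _))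

variable {T T' T'' : Type w} {R : T → T → T → Prop} {R' : T' → T' → T' → Prop}
  {R'' : T'' → T'' → T'' → Prop}

/-- The class of a generator. -/
def of (R : T → T → T → Prop) (a : T) : AddQuot T R :=
  QuotientAddGroup.mk (FreeAbelianGroup.of a)

/-- The homomorphism induced by a map of generators compatible with the relations. -/
def map (f : T → T') (hf : ∀ a b c, R a b c → R' (f a) (f b) (f c)) :
    AddQuot T R →+ AddQuot T' R' :=
  QuotientAddGroup.map _ _ (FreeAbelianGroup.map f) (by
    rw [AddSubgroup.closure_le]
    rintro _ ⟨a, b, c, h, rfl⟩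
    refine AddSubgroup.subset_closure ⟨f a, f b, f c, hf _ _ _ h, ?_⟩
    simp)

@[simp]
theorem map_of (f : T → T') (hf : ∀ a b c, R a b c → R' (f a) (f b) (f c)) (a : T) :
    map f hf (of R a) = of R' (f a) := by
  change QuotientAddGroup.map _ _ _ _ (QuotientAddGroup.mk _) = _
  rw [QuotientAddGroup.map_mk, FreeAbelianGroup.map_of_apply]
  rfl

theorem hom_ext {G : Type v} [AddCommGroup G] {f g : AddQuot T R →+ G}
    (h : ∀ a, f (of R a) = g (of R a)) : f = g := by
  apply QuotientAddGroup.addMonoidHom_ext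
  apply FreeAbelianGroup.lift_ext
  exact h

theorem map_eq_id (f : T → T) {hf : ∀ a b c, R a b c → R (f a) (f b) (f c)} (h : ∀ a, f a = a) :
    map f hf = AddMonoidHom.id (AddQuot T R) :=
  hom_ext fun a => by rw [map_of, h]; rfl

theorem map_eq_comp (f : T → T') {hf : ∀ a b c, R a b c → R' (f a) (f b) (f c)}
    (g : T' → T'') {hg : ∀ a b c, R' a b c → R'' (g a) (g b) (g c)}
    (e : T → T'') {he : ∀ a b c, R a b c → R'' (e a) (e b) (e c)} (h : ∀ a, e a = g (f a)) :
    map e he = (map g hg).comp (map f hf) :=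
  hom_ext fun a => by rw [AddMonoidHom.comp_apply, map_of, map_of, map_of, h]

theorem map_comm {T₁ : Type w} {R₁ : T₁ → T₁ → T₁ → Prop}
    (f : T → T') {hf : ∀ a b c, R a b c → R' (f a) (f b) (f c)}
    (g : T' → T'') {hg : ∀ a b c, R' a b c → R'' (g a) (g b) (g c)}
    (f' : T → T₁) {hf' : ∀ a b c, R a b c → R₁ (f' a) (f' b) (f' c)}
    (g' : T₁ → T'') {hg' : ∀ a b c, R₁ a b c → R'' (g' a) (g' b) (g' c)}
    (h : ∀ a, g (f a) = g' (f' a)) :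
    (map g hg).comp (map f hf) = (map g' hg').comp (map f' hf') :=
  (map_eq_comp (he := fun _ _ _ h => hg _ _ _ (hf _ _ _ h)) f g (g ∘ f) fun _ => rfl).symm.trans
    (map_eq_comp f' g' _ h)

end AddQuot

section ZF

variable {S : Scheme.{u}} (X : Over S) (n m : ℕ)

/-- The presheaf `ℤFₘ(-, X₊ ∧ Tⁿ⁺¹)` of linear framed correspondences of level `m`. -/
def ZFm : (Over S)ᵒᵖ ⥤ AddCommGrpCat.{u + 1} where
  obj U := AddCommGrpCat.of (AddQuot (Fr X n m U.unop) Fr.IsSum)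
  map h := AddCommGrpCat.ofHom (AddQuot.map (Fr.pull h.unop) fun _ _ _ hc => hc.pull h.unop)
  map_id U := by
    exact AddCommGrpCat.hom_ext (AddQuot.map_eq_id (hf := fun _ _ _ hc => hc.pull _) _ fun a => Fr.pull_id a)
  map_comp f g := by
    exact AddCommGrpCat.hom_ext (AddQuot.map_eq_comp (hf := fun _ _ _ hc => hc.pull _) (hg := fun _ _ _ hc => hc.pull _)
      (he := fun _ _ _ hc => hc.pull _) _ _ _ fun a => Fr.pull_comp _ _ a)

/-- The presheaf `ℤF^qfₘ(-, X₊ ∧ Tⁿ⁺¹)`: the free abelian group on `Fr^qfₘ` modulo the additivity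
relations. -/
def ZFqfm : (Over S)ᵒᵖ ⥤ AddCommGrpCat.{u + 1} where
  obj U := AddCommGrpCat.of (AddQuot (FrQf X n m U.unop) fun c c₁ c₂ => Fr.IsSum c.1 c₁.1 c₂.1)
  map h := AddCommGrpCat.ofHom (AddQuot.map (fun c => ⟨Fr.pull h.unop c.1, c.2.pull h.unop⟩)
    fun _ _ _ hc => hc.pull h.unop)
  map_id U := by
    exact AddCommGrpCat.hom_ext (AddQuot.map_eq_id (hf := fun _ _ _ hc => hc.pull _) _ fun a => Subtype.ext (Fr.pull_id a.1))
  map_comp f g := by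
    exact AddCommGrpCat.hom_ext (AddQuot.map_eq_comp (hf := fun _ _ _ hc => hc.pull _) (hg := fun _ _ _ hc => hc.pull _)
      (he := fun _ _ _ hc => hc.pull _) _ _ _      fun a => Subtype.ext (Fr.pull_comp _ _ a.1))

/-- The suspension `Σ : ℤFₘ ⟶ ℤFₘ₊₁`. -/
def ZFm.susp : ZFm X n m ⟶ ZFm X n (m + 1) where
  app U := AddCommGrpCat.ofHom (AddQuot.map Fr.susp fun _ _ _ hc => hc.susp)
  naturality U V h := by
    exact AddCommGrpCat.hom_ext (AddQuot.map_comm (hf := fun _ _ _ hc => hc.pull _) (hg := fun _ _ _ hc => hc.susp)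
      (hf' := fun _ _ _ hc => hc.susp) (hg' := fun _ _ _ hc => hc.pull _) _ _ _ _ fun a => (Fr.pull_susp h.unop a).symm)

/-- The suspension `Σ : ℤF^qfₘ ⟶ ℤF^qfₘ₊₁`. -/
def ZFqfm.susp : ZFqfm X n m ⟶ ZFqfm X n (m + 1) where
  app U := AddCommGrpCat.ofHom (AddQuot.map (fun c => ⟨Fr.susp c.1, c.2.susp⟩)
    fun _ _ _ hc => hc.susp)
  naturality U V h := by
    exact AddCommGrpCat.hom_ext (AddQuot.map_comm (hf := fun _ _ _ hc => hc.pull _) (hg := fun _ _ _ hc => hc.susp)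
      (hf' := fun _ _ _ hc => hc.susp) (hg' := fun _ _ _ hc => hc.pull _) _ _ _ _ fun a => Subtype.ext (Fr.pull_susp h.unop a.1).symm)

/-- The natural map `ℤF^qfₘ ⟶ ℤFₘ`. -/
def ZFm.incl : ZFqfm X n m ⟶ ZFm X n m where
  app U := AddCommGrpCat.ofHom (AddQuot.map Subtype.val fun _ _ _ hc => hc)
  naturality U V h := by
    refine AddCommGrpCat.hom_ext (AddQuot.map_comm (hf := fun _ _ _ hc => hc.pull h.unop)
      (hg := fun _ _ _ hc => hc) (hf' := fun _ _ _ hc => hc) (hg' := fun _ _ _ hc => hc.pull h.unop)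
      (fun c : FrQf X n m U.unop => (⟨Fr.pull h.unop c.1, c.2.pull h.unop⟩ : FrQf X n m V.unop))
      Subtype.val Subtype.val (Fr.pull h.unop) fun a => rfl)

theorem ZFm.susp_incl : ZFqfm.susp X n m ≫ ZFm.incl X n (m + 1) =
    ZFm.incl X n m ≫ ZFm.susp X n m := by
  ext U : 2
  refine AddCommGrpCat.hom_ext (AddQuot.map_comm (hf := fun _ _ _ hc => hc.susp)
    (hg := fun _ _ _ hc => hc) (hf' := fun _ _ _ hc => hc) (hg' := fun _ _ _ hc => hc.susp)
    (fun c : FrQf X n m U.unop => (⟨Fr.susp c.1, c.2.susp⟩ : FrQf X n (m + 1) U.unop))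
    Subtype.val Subtype.val Fr.susp fun a => rfl)

/-- The presheaf `ℤF(-, X₊ ∧ Tⁿ⁺¹) = colim (ℤF₀ ⟶ ℤF₁ ⟶ ⋯)`, the colimit along the suspensions. -/
def ZF : (Over S)ᵒᵖ ⥤ AddCommGrpCat.{u + 1} :=
  colimit (Functor.ofSequence fun m => ZFm.susp X n m)

/-- The presheaf `ℤF^qf(-, X₊ ∧ Tⁿ⁺¹) = colim (ℤF^qf₀ ⟶ ℤF^qf₁ ⟶ ⋯)`. -/
def ZFqf : (Over S)ᵒᵖ ⥤ AddCommGrpCat.{u + 1} :=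
  colimit (Functor.ofSequence fun m => ZFqfm.susp X n m)

/-- The natural map (inclusion) `ℤF^qf(-, X₊ ∧ Tⁿ⁺¹) ⟶ ℤF(-, X₊ ∧ Tⁿ⁺¹)`. -/
def ZF.incl : ZFqf X n ⟶ ZF X n :=
  colimMap (NatTrans.ofSequence (F := Functor.ofSequence fun m => ZFqfm.susp X n m)
    (G := Functor.ofSequence fun m => ZFm.susp X n m) (fun m => ZFm.incl X n m) (by
      intro m
      rw [Functor.ofSequence_map_homOfLE_succ, Functor.ofSequence_map_homOfLE_succ]
      exact ZFm.susp_incl X n m))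

end ZF

/-! ### The algebraic simplices and the Suslin complex -/

section Suslin

variable (k : Type u) [Field k]

/-- The coordinate ring `k[t₀, …, tₗ] / (t₀ + ⋯ + tₗ - 1)` of the algebraic simplex `Δˡ`. -/
abbrev SimplexRing (l : ℕ) : Type u :=
  MvPolynomial (Fin (l + 1)) k ⧸
    Ideal.span {(∑ i, MvPolynomial.X i - 1 : MvPolynomial (Fin (l + 1)) k)}

/-- The class of `tᵢ`. -/
def SimplexRing.t (l : ℕ) (i : Fin (l + 1)) : SimplexRing k l :=
  Ideal.Quotient.mk _ (MvPolynomial.X i)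

theorem SimplexRing.sum_t (l : ℕ) : ∑ i, SimplexRing.t k l i = 1 := by
  simp only [SimplexRing.t]
  rw [← map_sum, ← map_one (Ideal.Quotient.mk _), Ideal.Quotient.eq]
  exact Ideal.subset_span rfl

/-- The `k`-algebra homomorphism `tⱼ ↦ ∑_{θ(i) = j} tᵢ` induced by a map `θ`. -/
def SimplexRing.map {a b : ℕ} (θ : Fin (a + 1) → Fin (b + 1)) :
    SimplexRing k b →ₐ[k] SimplexRing k a :=
  Ideal.Quotient.liftₐ _ (MvPolynomial.aeval fun j => ∑ i with θ i = j, SimplexRing.t k a i) (by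
    intro x hx
    rw [← RingHom.mem_ker]
    refine (Ideal.span_le (I := RingHom.ker (MvPolynomial.aeval (R := k)
      fun j => ∑ i with θ i = j, SimplexRing.t k a i)).mpr ?_) hx
    rintro _ rfl
    rw [SetLike.mem_coe, RingHom.mem_ker, map_sub, map_sum, map_one]
    simp only [MvPolynomial.aeval_X]
    rw [Finset.sum_fiberwise, SimplexRing.sum_t, sub_self])

theorem SimplexRing.map_t {a b : ℕ} (θ : Fin (a + 1) → Fin (b + 1)) (j : Fin (b + 1)) :
    SimplexRing.map k θ (SimplexRing.t k b j) = ∑ i with θ i = j, SimplexRing.t k a i := by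
  change MvPolynomial.aeval _ _ = _
  rw [MvPolynomial.aeval_X]

theorem SimplexRing.hom_ext {b : ℕ} {A : Type v} [CommRing A] [Algebra k A]
    {f g : SimplexRing k b →ₐ[k] A}
    (h : ∀ j, f (SimplexRing.t k b j) = g (SimplexRing.t k b j)) : f = g := by
  apply Ideal.Quotient.algHom_ext
  apply MvPolynomial.algHom_ext
  exact h

theorem SimplexRing.map_id {a : ℕ} : SimplexRing.map k (id : Fin (a + 1) → Fin (a + 1)) =
    AlgHom.id k _ :=
  SimplexRing.hom_ext k fun j => by
    rw [SimplexRing.map_t]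
    simp [Finset.filter_eq']

theorem SimplexRing.map_comp {a b c : ℕ} (θ : Fin (a + 1) → Fin (b + 1))
    (η : Fin (b + 1) → Fin (c + 1)) :
    SimplexRing.map k (η ∘ θ) = (SimplexRing.map k θ).comp (SimplexRing.map k η) :=
  SimplexRing.hom_ext k fun j => by
    rw [AlgHom.comp_apply, SimplexRing.map_t, SimplexRing.map_t, map_sum]
    simp only [SimplexRing.map_t, Finset.sum_filter]
    have h (x : Fin (b + 1)) : (if η x = j then ∑ i, if θ i = x then t k a i else 0 else 0) =
        ∑ i, if θ i = x then if η x = j then t k a i else 0 else 0 := by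
      split_ifs <;> simp
    rw [Finset.sum_congr rfl fun x _ => h x, Finset.sum_comm]
    simp

/-- The spectrum of the field `k`. -/
abbrev pt : Scheme.{u} := Spec (.of k)

/-- The algebraic simplex `Δˡ = Spec k[t₀, …, tₗ] / (t₀ + ⋯ + tₗ - 1)` as a `k`-scheme. -/
def simplex (l : ℕ) : Over (pt k) :=
  Over.mk (Spec.map (CommRingCat.ofHom (algebraMap k (SimplexRing k l))))

/-- The morphism `Δᵃ ⟶ Δᵇ` induced by `θ`, given by `tⱼ ↦ ∑_{θ(i) = j} tᵢ`. -/
def simplexMap {a b : ℕ} (θ : Fin (a + 1) → Fin (b + 1)) : simplex k a ⟶ simplex k b :=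
  Over.homMk (Spec.map (CommRingCat.ofHom (SimplexRing.map k θ).toRingHom)) (by
    change Spec.map _ ≫ Spec.map _ = Spec.map _
    rw [← Spec.map_comp, ← CommRingCat.ofHom_comp]
    congr 2
    exact (SimplexRing.map k θ).comp_algebraMap)

theorem simplexMap_id (a : ℕ) : simplexMap k (id : Fin (a + 1) → Fin (a + 1)) = 𝟙 _ := by
  ext1
  change Spec.map (CommRingCat.ofHom (SimplexRing.map k id).toRingHom) = 𝟙 (Spec _)
  rw [SimplexRing.map_id, ← Spec.map_id]
  rfl

theorem simplexMap_comp {a b c : ℕ} (θ : Fin (a + 1) → Fin (b + 1))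
    (η : Fin (b + 1) → Fin (c + 1)) :
    simplexMap k (η ∘ θ) = simplexMap k θ ≫ simplexMap k η := by
  ext1
  change Spec.map (CommRingCat.ofHom (SimplexRing.map k (η ∘ θ)).toRingHom) =
    Spec.map _ ≫ Spec.map _
  rw [SimplexRing.map_comp, ← Spec.map_comp]
  rfl

/-- The cosimplicial `k`-scheme `Δ^•`. -/
def cosimplex : SimplexCategory ⥤ Over (pt k) where
  obj a := simplex k a.len
  map θ := simplexMap k θ.toOrderHom
  map_id a := simplexMap_id k a.len
  map_comp θ η := simplexMap_comp k θ.toOrderHom η.toOrderHom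

open MonoidalCategory in
/-- The simplicial abelian group `F(U × Δ^•)`, naturally in the `k`-scheme `U` and in the presheaf
`F`. -/
def simplicialPresheaf : ((Over (pt k))ᵒᵖ ⥤ AddCommGrpCat.{v}) ⥤
    ((Over (pt k))ᵒᵖ ⥤ SimplicialObject AddCommGrpCat.{v}) where
  obj F :=
    { obj U := (cosimplex k ⋙ tensorLeft U.unop).op ⋙ F
      map h := Functor.whiskerRight
        (NatTrans.op (Functor.whiskerLeft (cosimplex k) ((curriedTensor _).map h.unop))) F
      map_id U := by
        ext
        simp
      map_comp f g := by
        ext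
        simp }
  map α := { app U := Functor.whiskerLeft (cosimplex k ⋙ tensorLeft U.unop).op α }

/-- The Suslin complex `C_*F`: the presheaf of complexes `U ↦ F(U × Δ^•)`, with the alternating sums
of the face maps as differentials; naturally in the presheaf `F`. -/
def suslin : ((Over (pt k))ᵒᵖ ⥤ AddCommGrpCat.{v}) ⥤
    ((Over (pt k))ᵒᵖ ⥤ ChainComplex AddCommGrpCat.{v} ℕ) :=
  simplicialPresheaf k ⋙
    (Functor.whiskeringRight _ _ _).obj (AlgebraicTopology.alternatingFaceMapComplex _)

end Suslin

/-! ### The Zariski site of smooth schemes -/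

/-- Morphisms which are smooth, separated and of finite type. -/
def smoothVarieties : MorphismProperty Scheme.{u} :=
  @Smooth ⊓ @IsSeparated ⊓ @LocallyOfFiniteType ⊓ @QuasiCompact

variable (k : Type u) [Field k]

/-- The category `Sm/k` of smooth separated schemes of finite type over the field `k`. -/
abbrev Sm : Type (u + 1) := smoothVarieties.{u}.Over ⊤ (pt k)

/-- The Zariski topology on `Sm/k`. -/
def zariski : GrothendieckTopology (Sm k) :=
  (pt k).smallGrothendieckTopology (Q := smoothVarieties) @IsOpenImmersion

variable {k}

/-- A morphism of presheaves of complexes of abelian groups on `Sm/k` is a Zariski-local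
quasi-isomorphism if, in each degree, it induces an isomorphism of the Zariski sheaves associated
with the homology presheaves, that is: the map of homology presheaves is both injective and
surjective locally in the Zariski topology. -/
def IsZariskiLocalQuasiIso {F G : (Sm k)ᵒᵖ ⥤ ChainComplex AddCommGrpCat.{v} ℕ} (α : F ⟶ G) :
    Prop :=
  ∀ i : ℕ,
    Presheaf.IsLocallyInjective (zariski k)
      (Functor.whiskerRight α (HomologicalComplex.homologyFunctor AddCommGrpCat.{v} _ i)) ∧
    Presheaf.IsLocallySurjective (zariski k)
      (Functor.whiskerRight α (HomologicalComplex.homologyFunctor AddCommGrpCat.{v} _ i))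

variable (X : Sm k) (n : ℕ)

/-- The presheaf of complexes `C_*ℤF(X₊ ∧ Tⁿ⁺¹)` on `Sm/k`. -/
def CZF : (Sm k)ᵒᵖ ⥤ ChainComplex AddCommGrpCat.{u + 1} ℕ :=
  (MorphismProperty.Over.forget _ _ _).op ⋙ (suslin k).obj (ZF X.toComma n)

/-- The presheaf of complexes `C_*ℤF^qf(X₊ ∧ Tⁿ⁺¹)` on `Sm/k`. -/
def CZFqf : (Sm k)ᵒᵖ ⥤ ChainComplex AddCommGrpCat.{u + 1} ℕ :=
  (MorphismProperty.Over.forget _ _ _).op ⋙ (suslin k).obj (ZFqf X.toComma n)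

/-- The natural map `C_*ℤF^qf(X₊ ∧ Tⁿ⁺¹) ⟶ C_*ℤF(X₊ ∧ Tⁿ⁺¹)`. -/
def CZF.incl : CZFqf X n ⟶ CZF X n :=
  Functor.whiskerLeft (MorphismProperty.Over.forget _ _ _).op
    ((suslin k).map (ZF.incl X.toComma n))

end FramedSphere

end

/-! The tool is a twist of the framing by the last function. For a function `s` on the base and a
large integer `N`, replace each `φⱼ` by `φⱼ + s f ^ N ^ (j + 1)`, with `j` counted from `0`. Since
`f` vanishes on the support, the support does not change. The twist respects equivalence, base
change and additivity, and it is the identity for `s = 0`.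

For `s = 1` and `N` large the twist is quasi-finite (`Explicit.exists_qfOver_twist`). Locally `W` is
étale over `𝔸ᵐ` over a noetherian ring `R`, so the `m + 1` functions `f, φ₁, …, φₘ` are
algebraically dependent over `R ⧸ q` for every prime `q`, and noetherian induction bounds the
degrees of these relations uniformly in `q` (`exists_relation_of_quasiFinite`). On the twisted locus
`φⱼ = -s f ^ N ^ (j + 1)`. If `s ∉ q` and `N` exceeds the degree, substituting this into the
relation gives a nonzero polynomial in `f`, because base `N` expansions are unique. Write it as `T ^
r H(T)` with `H(0) ≠ 0`: wherever `H(f)` does not vanish, `f` vanishes on the locus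
(`exists_separating_element`). Near the support the fibre of the twisted locus therefore lies in the
support, which is finite over the base. Over the zeros of `s` the twisted and the original locus
have the same fibres; hence for any `s` a quasi-finite class remains quasi-finite when `N` is large.

On `U × Δˡ⁺¹` the choice `s = tᵢ₊₁ + ⋯ + tₗ₊₁` gives the components of a simplicial homotopy from
the identity to the twist by `1` (`prismHomotopy`). Let `H` be the associated chain homotopy and `T`
the twist, so that `x = H(dx) + d(Hx) + T x`. If `dx` is quasi-finite, then `H(dx)` and `T x` are
quasi-finite for `N` large, depending on `x`: up to a boundary, `x` lies in the subcomplex. Together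
with injectivity this gives a quasi-isomorphism (`quasiIso_of_compressesRelativeCycles`). Suspending
and then twisting would also change the new coordinate, so the twists do not commute with
suspension; the argument is run at each level `m`, and only its conclusion passes to the colimit.

Injectivity comes from a retraction at each level. Quasi-finiteness of a class can be tested at the
points of the support in any representative (`Explicit.isQf_mk_iff`). The support is a noetherian
space and so has a largest open and closed part over which the class is quasi-finite; restriction to
this part is additive and fixes the quasi-finite classes (`inclHom_injective`).

All this takes place on sections over an arbitrary `U`, and the Zariski-local statement follows at
once. -/

noncomputable section

namespace FramedSphere

/-! ### Points isolated in the fibres of a subset -/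

/-- The point `w` is isolated in the fibre of `L` over `π w`. -/
def IsolatedIn {W U : Scheme.{u}} (π : W ⟶ U) (L : Set W) (w : W) : Prop :=
  ∃ O : Set W, IsOpen O ∧ w ∈ O ∧ ∀ x ∈ O, x ∈ L → π x = π w → x = w

/-- Only the points in the fibre of `w` matter. This is what allows loci that agree merely on one
fibre to be compared, as happens over the zeros of `s`. -/
theorem IsolatedIn.mono {W U : Scheme.{u}} {π : W ⟶ U} {L L' : Set W} {w : W}
    (h : IsolatedIn π L w) (hL : ∀ x ∈ L', π x = π w → x ∈ L) : IsolatedIn π L' w := by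
  obtain ⟨O, hO, hw, h⟩ := h
  exact ⟨O, hO, hw, fun x hx hxL e => h x hx (hL x hxL e) e⟩

theorem isolatedIn_univ {W U : Scheme.{u}} (π : W ⟶ U) [LocallyQuasiFinite π] (w : W) :
    IsolatedIn π Set.univ w := by
  have h := π.isDiscrete_preimage_singleton (π w)
  rw [isDiscrete_iff_discreteTopology, discreteTopology_subtype_iff'] at h
  obtain ⟨O, hO, h⟩ := h w rfl
  refine ⟨O, hO, (h.ge rfl).1, fun x hx _ e => h.le ⟨hx, e⟩⟩

theorem locallyQuasiFinite_of_etale {W U : Scheme.{u}} (q : W ⟶ U) [Etale q] :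
    LocallyQuasiFinite q where
  quasiFinite_appLE {V} hV {V'} hV' e := by
    have h : (q.appLE V V' e).hom.Etale := Etale.etale_appLE (f := q) hV hV' e
    algebraize [(q.appLE V V' e).hom]
    exact (inferInstance : Algebra.QuasiFinite Γ(U, V) Γ(W, V'))

/-- Being isolated in the fibre is preserved and reflected by étale morphisms. -/
theorem isolatedIn_etale {W W' U : Scheme.{u}} (q : W' ⟶ W) [Etale q] (π : W ⟶ U) (L : Set W)
    (w : W') : IsolatedIn (q ≫ π) (q ⁻¹' L) w ↔ IsolatedIn π L (q w) := by
  constructor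
  · rintro ⟨O, hO, hw, h⟩
    refine ⟨q '' O, q.isOpenMap _ hO, ⟨w, hw, rfl⟩, ?_⟩
    rintro _ ⟨x, hx, rfl⟩ hxL e
    rw [h x hx hxL (by simpa using e)]
  · rintro ⟨O, hO, hw, h⟩
    have := locallyQuasiFinite_of_etale q
    obtain ⟨O', hO', hw', h'⟩ := isolatedIn_univ q w
    -- `O` forces a point of the locus to map to `q w`; `O'` then separates `w` from the rest of its
    -- fibre under `q`.
    refine ⟨O' ∩ q ⁻¹' O, hO'.inter (hO.preimage q.continuous), ⟨hw', hw⟩, ?_⟩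
    rintro x ⟨hx', hx⟩ hxL e
    exact h' x hx' trivial (h _ hx hxL (by simpa using e))

/-- Quasi-finiteness at `x` means that `x` is open in the scheme-theoretic fibre, and the space of
that fibre is the set-theoretic fibre with its induced topology. -/
theorem quasiFiniteAt_iff_isolatedIn {A U : Scheme.{u}} (f : A ⟶ U) [LocallyOfFiniteType f]
    (x : A) : f.QuasiFiniteAt x ↔ IsolatedIn f Set.univ x := by
  rw [Scheme.Hom.quasiFiniteAt_iff_isOpen_singleton_asFiber, ← (f.fiberHomeo (f x)).isOpen_image]
  simp only [Set.image_singleton, Scheme.Hom.asFiber, Homeomorph.apply_symm_apply]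
  rw [isOpen_induced_iff]
  constructor
  · rintro ⟨O, hO, h⟩
    have hx : (⟨x, rfl⟩ : f ⁻¹' {f x}) ∈ Subtype.val ⁻¹' O := by rw [h]; rfl
    refine ⟨O, hO, hx, fun y hy _ e => ?_⟩
    have : (⟨y, e⟩ : f ⁻¹' {f x}) ∈ Subtype.val ⁻¹' O := hy
    rw [h] at this
    exact congrArg Subtype.val this
  · rintro ⟨O, hO, hx, h⟩
    refine ⟨O, hO, ?_⟩
    ext ⟨y, hy⟩
    rw [Set.mem_singleton_iff, Subtype.ext_iff]
    exact ⟨fun hy' => h y hy' trivial hy, fun e => by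
      change y = x at e; subst e; exact hx⟩

/-- Isolation is topological and `redι L` is an embedding with image `L`, so the reduced subscheme
can be forgotten and the condition read off inside `W`. -/
theorem quasiFiniteAt_redι {W U : Scheme.{u}} (π : W ⟶ U) [LocallyOfFiniteType π] (L : Closeds W)
    (y : (Scheme.IdealSheafData.vanishingIdeal L).subscheme) :
    (redι L ≫ π).QuasiFiniteAt y ↔ IsolatedIn π L (redι L y) := by
  rw [quasiFiniteAt_iff_isolatedIn]
  have hL : ∀ y, redι L y ∈ (L : Set W) := fun y => by
    rw [← range_redι]; exact ⟨y, rfl⟩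
  constructor
  · rintro ⟨O, hO, hy, h⟩
    obtain ⟨O', hO', rfl⟩ := (redι L).isEmbedding.isInducing.isOpen_iff.mp hO
    refine ⟨O', hO', hy, fun x hx hxL e => ?_⟩
    rw [← range_redι] at hxL
    obtain ⟨z, rfl⟩ := hxL
    rw [h z hx trivial (by simpa using e)]
  · rintro ⟨O, hO, hy, h⟩
    refine ⟨redι L ⁻¹' O, hO.preimage (redι L).continuous, hy, fun x hx _ e => ?_⟩
    exact (redι L).isEmbedding.injective (h _ hx (hL x) (by simpa using e))

theorem IsQuasiFiniteOver.isolatedIn {W U : Scheme.{u}} {π : W ⟶ U} [LocallyOfFiniteType π]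
    {L : Closeds W} (h : IsQuasiFiniteOver π L) {w : W} (hw : w ∈ L) : IsolatedIn π L w := by
  have h1 := h.1
  have hw' : w ∈ (L : Set W) := hw
  rw [← range_redι] at hw'
  obtain ⟨y, rfl⟩ := hw'
  exact (quasiFiniteAt_redι π L y).mp (Scheme.Hom.quasiFiniteAt _ y)

/-- The points of a closed subset which are isolated in their fibre form an open subset. -/
theorem exists_opens_isolatedIn {W U : Scheme.{u}} (π : W ⟶ U) [LocallyOfFiniteType π]
    (L : Closeds W) : ∃ V : W.Opens, ∀ w, w ∈ V ↔ (w ∈ L → IsolatedIn π L w) := by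
  -- The quasi-finite locus of `L` over `U` is open in `L`. An open extension of it to `W`, joined
  -- with the complement of `L`, is the required set.
  obtain ⟨O, hO, h⟩ := (redι L).isEmbedding.isInducing.isOpen_iff.mp
    ((redι L ≫ π).isOpen_quasiFiniteAt)
  refine ⟨⟨O, hO⟩ ⊔ cpl L, fun w => ?_⟩
  change w ∈ O ∪ (L : Set W)ᶜ ↔ _
  by_cases hw : w ∈ (L : Set W)
  · have hw' := hw
    rw [← range_redι] at hw'
    obtain ⟨y, rfl⟩ := hw'
    have h1 : y ∈ redι L ⁻¹' O ↔ _ := Set.ext_iff.mp h y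
    have h2 : redι L y ∈ O ↔ _ := h1.trans (quasiFiniteAt_redι π L y)
    rw [Set.mem_union, h2]
    have : redι L y ∈ L := hw
    simp [this]
  · simp only [Set.mem_union, Set.mem_compl_iff, hw, not_false_eq_true, or_true, true_iff]
    intro h; exact absurd h hw

/-! ### Points of étale neighbourhoods -/

/-- Because the square is cartesian, every point over `Z` comes from the section. The topological
facts about `p⁻¹(Z)` below all rest on this. -/
theorem IsEtaleNhd.exists_section {A W : Scheme.{u}} {p : W ⟶ A} {Z : Closeds A}
    (h : IsEtaleNhd p Z) : ∃ s : (Scheme.IdealSheafData.vanishingIdeal Z).subscheme ⟶ W,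
      s ≫ p = redι Z ∧ ∀ w, p w ∈ Z → ∃ z, s z = w := by
  obtain ⟨-, s, hs⟩ := h
  refine ⟨s, by simpa using hs.w, fun w hw => ?_⟩
  have hw' : p w ∈ (Z : Set A) := hw
  rw [← range_redι] at hw'
  obtain ⟨z, hz⟩ := hw'
  obtain ⟨y, hy, -⟩ := Scheme.Pullback.exists_preimage_pullback w z hz.symm
  refine ⟨hs.isoPullback.inv y, ?_⟩
  rw [← Scheme.Hom.comp_apply, hs.isoPullback_inv_fst, hy]

theorem IsEtaleNhd.injOn {A W : Scheme.{u}} {p : W ⟶ A} {Z : Closeds A}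
    (h : IsEtaleNhd p Z) {w w' : W} (hw : p w ∈ Z) (e : p w' = p w) : w' = w := by
  obtain ⟨s, hs, h⟩ := h.exists_section
  obtain ⟨z, rfl⟩ := h w hw
  obtain ⟨z', rfl⟩ := h w' (by rwa [e])
  rw [← Scheme.Hom.comp_apply, ← Scheme.Hom.comp_apply, hs] at e
  rw [(redι Z).isEmbedding.injective e]

theorem IsEtaleNhd.exists_point {A W : Scheme.{u}} {p : W ⟶ A} {Z : Closeds A}
    (h : IsEtaleNhd p Z) {z : A} (hz : z ∈ Z) : ∃ w, p w = z := by
  obtain ⟨s, hs, -⟩ := h.exists_section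
  have hz' : z ∈ (Z : Set A) := hz
  rw [← range_redι] at hz'
  obtain ⟨y, rfl⟩ := hz'
  exact ⟨s y, by rw [← Scheme.Hom.comp_apply, hs]⟩

/-- `p⁻¹(Z)` is the image of `Z` under the section, and `Z` is finite over a quasi-compact base. The
compactness later turns local bounds on `N` into one bound. -/
theorem IsEtaleNhd.isCompact {A W U : Scheme.{u}} {p : W ⟶ A} {Z : Closeds A}
    (h : IsEtaleNhd p Z) (π : A ⟶ U) [CompactSpace U] (hf : IsFinite (redι Z ≫ π)) :
    IsCompact (p ⁻¹' (Z : Set A)) := by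
  obtain ⟨s, hs, h⟩ := h.exists_section
  have : CompactSpace (Scheme.IdealSheafData.vanishingIdeal Z).subscheme :=
    QuasiCompact.compactSpace_of_compactSpace (redι Z ≫ π)
  have e : p ⁻¹' (Z : Set A) = Set.range s := by
    ext w
    refine ⟨h w, ?_⟩
    rintro ⟨z, rfl⟩
    change p (s z) ∈ (Z : Set A)
    rw [← Scheme.Hom.comp_apply, hs, ← range_redι]
    exact ⟨z, rfl⟩
  rw [e]
  exact isCompact_range s.continuous

theorem IsEtaleNhd.isolatedIn {A W U : Scheme.{u}} {p : W ⟶ A} {Z : Closeds A}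
    (h : IsEtaleNhd p Z) (π : A ⟶ U) (hf : IsFinite (redι Z ≫ π)) {w : W} (hw : p w ∈ Z) :
    IsolatedIn (p ≫ π) (p ⁻¹' (Z : Set A)) w := by
  have hw' : p w ∈ (Z : Set A) := hw
  rw [← range_redι] at hw'
  obtain ⟨y, hy⟩ := hw'
  obtain ⟨O, hO, hy', h'⟩ := isolatedIn_univ (redι Z ≫ π) y
  obtain ⟨O', hO', rfl⟩ := (redι Z).isEmbedding.isInducing.isOpen_iff.mp hO
  refine ⟨p ⁻¹' O', hO'.preimage p.continuous, ?_, fun x hx hxZ e => ?_⟩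
  · change p w ∈ O'; rw [← hy]; exact hy'
  · apply h.injOn hw
    have hx' : p x ∈ (Z : Set A) := hxZ
    rw [← range_redι] at hx'
    obtain ⟨z, hz⟩ := hx'
    rw [← hz, ← hy, h' z ?_ trivial ?_]
    · change redι Z z ∈ O'; rw [hz]; exact hx
    · simpa [hz, hy] using e

end FramedSphere

end

/-! ### Relations between elements of quasi-finite algebras -/

section

open MvPolynomial

/-- Additivity of transcendence degree: an algebraic extension of the polynomial ring in `ι` has
transcendence degree `#ι` over `R`. -/
theorem AlgebraicIndependent.cardinalMk_le_of_isAlgebraic {R F ι κ : Type u} [CommRing R] [IsDomain R]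
    [CommRing F] [IsDomain F] [Algebra R F] [Algebra (MvPolynomial ι R) F]
    [IsScalarTower R (MvPolynomial ι R) F] [FaithfulSMul (MvPolynomial ι R) F]
    [Algebra.IsAlgebraic (MvPolynomial ι R) F] {y : κ → F} (hy : AlgebraicIndependent R y) :
    Cardinal.mk κ ≤ Cardinal.mk ι := by
  have h := trdeg_add_eq R (MvPolynomial ι R) (A := F)
  rw [MvPolynomial.trdeg_of_isDomain, (trdeg_eq_zero : Algebra.trdeg (MvPolynomial ι R) F = 0), add_zero,
    Cardinal.lift_id] at h
  rw [h]
  exact hy.cardinalMk_le_trdeg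

/-- `E` need not be a domain. The zero ideal of the polynomial ring in `κ`, embedded by the
independent family, is the contraction of a prime `q` of `E`. Modulo `q` the family stays
independent and `E ⧸ q` is algebraic over `K`, which reduces to the case of a domain. -/
theorem AlgebraicIndependent.cardinalMk_le_of_finite {R K E ι κ : Type u} [CommRing R] [IsDomain R]
    [Field K] [Algebra (MvPolynomial ι R) K] [IsFractionRing (MvPolynomial ι R) K]
    [CommRing E] [Algebra R E] [Algebra (MvPolynomial ι R) E] [Algebra K E]
    [IsScalarTower R (MvPolynomial ι R) E] [IsScalarTower (MvPolynomial ι R) K E]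
    [Module.Finite K E] {y : κ → E} (hy : AlgebraicIndependent R y) :
    Cardinal.mk κ ≤ Cardinal.mk ι := by
  let P := MvPolynomial ι R
  obtain ⟨q, hq, hq'⟩ := Ideal.exists_comap_eq_of_mem_minimalPrimes_of_injective
    (f := (aeval y : MvPolynomial κ R →ₐ[R] E).toRingHom) hy ⊥
    (by rw [IsDomain.minimalPrimes_eq_singleton_bot]; rfl)
  have hF : AlgebraicIndependent R (Ideal.Quotient.mkₐ R q ∘ y) := by
    rw [algebraicIndependent_iff_injective_aeval]
    have e : (aeval (Ideal.Quotient.mkₐ R q ∘ y) : MvPolynomial κ R →ₐ[R] E ⧸ q) =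
        (Ideal.Quotient.mkₐ R q).comp (aeval y) := by
      ext i; simp
    rw [e, injective_iff_map_eq_zero]
    intro a ha
    have : aeval y a ∈ q := Ideal.Quotient.eq_zero_iff_mem.mp ha
    change a ∈ q.comap (aeval y : MvPolynomial κ R →ₐ[R] E).toRingHom at this
    rwa [hq', Ideal.mem_bot] at this
  have h2 : IsScalarTower (MvPolynomial ι R) K (E ⧸ q) := inferInstance
  have h1 : Algebra.IsAlgebraic K (E ⧸ q) := inferInstance
  have : Algebra.IsAlgebraic (MvPolynomial ι R) (E ⧸ q) :=
    (IsFractionRing.comap_isAlgebraic_iff (A := MvPolynomial ι R) (K := K) (C := E ⧸ q)).mpr h1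
  have : FaithfulSMul (MvPolynomial ι R) (E ⧸ q) := by
    rw [faithfulSMul_iff_algebraMap_injective,
      IsScalarTower.algebraMap_eq (MvPolynomial ι R) K (E ⧸ q)]
    exact (algebraMap K (E ⧸ q)).injective.comp (IsFractionRing.injective _ K)
  exact hF.cardinalMk_le_of_isAlgebraic (ι := ι)

/-- A flat and quasi-finite algebra over a polynomial ring in the variables `ι` over a domain `R`
contains no algebraically independent family larger than `ι`. -/
theorem AlgebraicIndependent.cardinalMk_le_of_quasiFinite {R B ι κ : Type u} [CommRing R]
    [IsDomain R] [CommRing B]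
    [Algebra R B] [Algebra (MvPolynomial ι R) B] [IsScalarTower R (MvPolynomial ι R) B]
    [Algebra.QuasiFinite (MvPolynomial ι R) B] [Module.Flat (MvPolynomial ι R) B]
    {y : κ → B} (hy : AlgebraicIndependent R y) :
    Cardinal.mk κ ≤ Cardinal.mk ι := by
  let P := MvPolynomial ι R
  let K := FractionRing (MvPolynomial ι R)
  have h1 : Algebra.QuasiFinite K (TensorProduct (MvPolynomial ι R) K B) :=
    Algebra.QuasiFinite.baseChange
  have h2 : Module.Finite K (TensorProduct (MvPolynomial ι R) K B) := Module.Finite.of_quasiFinite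
  -- Flatness embeds `B` in its base change to the fraction field `K`, which is finite over `K` by
  -- quasi-finiteness.
  have hinj : Function.Injective (Algebra.TensorProduct.includeRight :
      B →ₐ[MvPolynomial ι R] TensorProduct (MvPolynomial ι R) K B) :=
    Algebra.TensorProduct.includeRight_injective (IsFractionRing.injective _ K)
  have h3 : IsScalarTower R (MvPolynomial ι R) (TensorProduct (MvPolynomial ι R) K B) :=
    inferInstance
  have h4 := hy.map' (f := (Algebra.TensorProduct.includeRight :
      B →ₐ[MvPolynomial ι R] TensorProduct (MvPolynomial ι R) K B).restrictScalars R) hinj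
  exact h4.cardinalMk_le_of_finite (K := K) (ι := ι)

/-- Reduce modulo `I`: the base change of `B` to polynomials over the domain `R ⧸ I` is again flat
and quasi-finite, so the images of `y` there are dependent over `R ⧸ I`. Lift the coefficients of a
relation to `R`. The base change maps to `B ⧸ I B` compatibly with `B`, so the value of the lift
lies in `I B`. -/
theorem exists_relation_mod_prime {R B ι κ : Type u} [CommRing R]
    [CommRing B] [Algebra R B] [Algebra (MvPolynomial ι R) B]
    [IsScalarTower R (MvPolynomial ι R) B] [Algebra.QuasiFinite (MvPolynomial ι R) B]
    [Module.Flat (MvPolynomial ι R) B] (hc : Cardinal.mk ι < Cardinal.mk κ) (y : κ → B)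
    (I : Ideal R) [I.IsPrime] :
    ∃ P : MvPolynomial κ R, (∃ m, P.coeff m ∉ I) ∧ aeval y P ∈ I.map (algebraMap R B) := by
  let P₀ := MvPolynomial ι R
  let P₁ := MvPolynomial ι (R ⧸ I)
  let J := I.map (algebraMap R B)
  let _ : Algebra P₀ P₁ := (MvPolynomial.map (Ideal.Quotient.mk I)).toAlgebra
  have h1 : Algebra.QuasiFinite P₁ (TensorProduct P₀ P₁ B) := Algebra.QuasiFinite.baseChange
  have h2 : Module.Flat P₁ (TensorProduct P₀ P₁ B) := inferInstance
  let r : R ⧸ I →+* B ⧸ J := Ideal.quotientMap J (algebraMap R B) Ideal.le_comap_map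
  have hr : r.comp (Ideal.Quotient.mk I) = (Ideal.Quotient.mk J).comp (algebraMap R B) :=
    Ideal.quotientMap_comp_mk _
  let l₀ : P₁ →+* B ⧸ J := eval₂Hom r fun i => Ideal.Quotient.mk J (algebraMap P₀ B (X i))
  have hl₀ : l₀.comp (algebraMap P₀ P₁) = (Ideal.Quotient.mk J).comp (algebraMap P₀ B) := by
    apply MvPolynomial.ringHom_ext
    · intro a
      have := RingHom.congr_fun hr a
      simp only [RingHom.comp_apply] at this ⊢
      rw [RingHom.algebraMap_toAlgebra, MvPolynomial.map_C, coe_eval₂Hom, eval₂_C, this,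
        ← MvPolynomial.algebraMap_eq, ← IsScalarTower.algebraMap_apply]
    · intro i
      rw [RingHom.comp_apply, RingHom.comp_apply, RingHom.algebraMap_toAlgebra,
        MvPolynomial.map_X, coe_eval₂Hom, eval₂_X]
  let l : P₁ →ₐ[P₀] B ⧸ J := ⟨l₀, fun a => RingHom.congr_fun hl₀ a⟩
  let Φ : TensorProduct P₀ P₁ B →ₐ[P₀] B ⧸ J :=
    Algebra.TensorProduct.productMap l (Ideal.Quotient.mkₐ P₀ J)
  let j : B →ₐ[P₀] TensorProduct P₀ P₁ B := Algebra.TensorProduct.includeRight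
  have hΦ : ∀ b, Φ (j b) = Ideal.Quotient.mk J b := fun b => by simp [Φ, j]
  have hdep : ¬ AlgebraicIndependent (R ⧸ I) (j ∘ y) := fun h =>
    (h.cardinalMk_le_of_quasiFinite (ι := ι)).not_gt hc
  rw [algebraicIndependent_iff] at hdep
  push Not at hdep
  obtain ⟨Q, hQ, hQ0⟩ := hdep
  obtain ⟨P, rfl⟩ := MvPolynomial.map_surjective _ (Ideal.Quotient.mk_surjective (I := I)) Q
  refine ⟨P, ?_, ?_⟩
  · by_contra! hP
    apply hQ0
    ext m
    rw [coeff_map, coeff_zero, Ideal.Quotient.eq_zero_iff_mem]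
    exact hP m
  · rw [← Ideal.Quotient.eq_zero_iff_mem, ← hΦ]
    have : j (aeval y P) = aeval (j ∘ y) (MvPolynomial.map (Ideal.Quotient.mk I) P) := by
      rw [aeval_def, aeval_def, eval₂_map]
      change j.toRingHom (eval₂ (algebraMap R B) y P) = _
      rw [eval₂_comp_left]
      refine congrArg (fun t => eval₂ t (j ∘ y) P) ?_
      ext a
      rw [RingHom.comp_apply, RingHom.comp_apply,
        IsScalarTower.algebraMap_apply R (MvPolynomial ι R) B]
      change j (algebraMap P₀ B (algebraMap R P₀ a)) = _
      rw [j.commutes, IsScalarTower.algebraMap_apply P₀ P₁ (TensorProduct P₀ P₁ B),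
        IsScalarTower.algebraMap_apply (R ⧸ I) P₁ (TensorProduct P₀ P₁ B)]
      congr 1
      rw [RingHom.algebraMap_toAlgebra, MvPolynomial.algebraMap_eq, MvPolynomial.map_C,
        MvPolynomial.algebraMap_eq]
    rw [this, hQ, map_zero]

/-- Uniformly in the primes `q` of a noetherian ring `R`, a family of elements of an algebra which
is flat and quasi-finite over a polynomial ring in fewer variables satisfies
over `R ⧸ q` an algebraic relation of bounded degree. -/
theorem exists_relation_of_quasiFinite {R B ι κ : Type u} [CommRing R] [IsNoetherianRing R]
    [CommRing B] [Algebra R B] [Algebra (MvPolynomial ι R) B]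
    [IsScalarTower R (MvPolynomial ι R) B] [Algebra.QuasiFinite (MvPolynomial ι R) B]
    [Module.Flat (MvPolynomial ι R) B] (hc : Cardinal.mk ι < Cardinal.mk κ) (y : κ → B) :
    ∃ N : ℕ, ∀ q : Ideal R, q.IsPrime → ∃ P : MvPolynomial κ R, P.totalDegree < N ∧
      (∃ m, P.coeff m ∉ q) ∧ aeval y P ∈ q.map (algebraMap R B) := by
  -- Noetherian induction on `I`, for the primes containing `I`.
  suffices H : ∀ I : Ideal R, ∃ N : ℕ, ∀ q : Ideal R, q.IsPrime → I ≤ q →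
      ∃ P : MvPolynomial κ R, P.totalDegree < N ∧
      (∃ m, P.coeff m ∉ q) ∧ aeval y P ∈ q.map (algebraMap R B) by
    obtain ⟨N, hN⟩ := H ⊥
    exact ⟨N, fun q hq => hN q hq bot_le⟩
  intro I
  induction I using IsNoetherian.induction with
  | hgt I ih =>
    change Ideal R at I
    by_cases hI : I.IsPrime
    · -- the generic relation
      obtain ⟨P, ⟨m, hm⟩, hP⟩ := exists_relation_mod_prime hc y I
      -- `P` serves every prime above `I` that omits the coefficient at `m`; the remaining primes
      -- contain a strictly larger ideal.
      obtain ⟨N, hN⟩ := ih (I ⊔ Ideal.span {P.coeff m})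
        (left_lt_sup.mpr fun h => hm (h (Ideal.mem_span_singleton_self _)))
      refine ⟨max N (P.totalDegree + 1), fun q hq hIq => ?_⟩
      by_cases hmq : P.coeff m ∈ q
      · obtain ⟨Q, h1, h2⟩ := hN q hq (sup_le hIq (by simpa [Ideal.span_le] using hmq))
        exact ⟨Q, lt_max_of_lt_left h1, h2⟩
      · exact ⟨P, lt_max_of_lt_right (Nat.lt_succ_self _), ⟨m, hmq⟩, Ideal.map_mono hIq hP⟩
    · by_cases htop : I = ⊤
      · exact ⟨0, fun q hq h => absurd (top_le_iff.mp (htop ▸ h)) hq.ne_top⟩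
      · obtain ⟨a, ha, b, hb, hab⟩ := (Ideal.not_isPrime_iff.mp hI).resolve_left htop
        obtain ⟨N, hN⟩ := ih (I ⊔ Ideal.span {a})
          (left_lt_sup.mpr fun h => ha (h (Ideal.mem_span_singleton_self _)))
        obtain ⟨N', hN'⟩ := ih (I ⊔ Ideal.span {b})
          (left_lt_sup.mpr fun h => hb (h (Ideal.mem_span_singleton_self _)))
        refine ⟨max N N', fun q hq hIq => ?_⟩
        rcases hq.mem_or_mem (hIq hab) with h | h
        · obtain ⟨Q, h1, h2⟩ := hN q hq (sup_le hIq (by simpa [Ideal.span_le] using h))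
          exact ⟨Q, lt_max_of_lt_left h1, h2⟩
        · obtain ⟨Q, h1, h2⟩ := hN' q hq (sup_le hIq (by simpa [Ideal.span_le] using h))
          exact ⟨Q, lt_max_of_lt_right h1, h2⟩

/-- Base `N` expansions with digits smaller than `N` are unique. -/
theorem sum_mul_pow_injective {N d : ℕ} {a b : Fin d → ℕ} (ha : ∀ i, a i < N) (hb : ∀ i, b i < N)
    (h : ∑ i, a i * N ^ (i : ℕ) = ∑ i, b i * N ^ (i : ℕ)) : a = b := by
  have h' : (fun i => ⟨a i, ha i⟩ : Fin d → Fin N) = fun i => ⟨b i, hb i⟩ :=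
    finFunctionFinEquiv.injective (Fin.ext (by simpa using h))
  funext i
  exact Fin.val_eq_of_eq (congrFun h' i)

/-- The substitution `yᵢ ↦ aᵢ T ^ (N ^ i)` is injective on polynomials of degree less than `N`. -/
theorem aeval_monomials_ne_zero {D : Type*} [CommRing D] [IsDomain D] {N d : ℕ}
    {P : MvPolynomial (Fin d) D} (hP : P ≠ 0) (hN : P.totalDegree < N) {a : Fin d → D}
    (ha : ∀ i, a i ≠ 0) :
    aeval (fun i => Polynomial.C (a i) * Polynomial.X ^ N ^ (i : ℕ)) P ≠ 0 := by
  obtain ⟨m, hm⟩ := MvPolynomial.ne_zero_iff.mp hP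
  have hdeg : ∀ m ∈ P.support, ∀ i, m i < N := fun m hm i =>
    ((Finsupp.le_degree i m).trans (MvPolynomial.le_totalDegree hm)).trans_lt hN
  intro h
  -- All exponents of monomials of `P` are smaller than `N`, so they are base `N` digits, and only
  -- the monomial `m` contributes to this coefficient.
  apply_fun (fun Q => Q.coeff (∑ i, m i * N ^ (i : ℕ))) at h
  rw [aeval_def, eval₂_eq', Polynomial.finsetSum_coeff, Polynomial.coeff_zero,
    Finset.sum_eq_single m] at h
  · have e : ∏ i, (Polynomial.C (a i) * Polynomial.X ^ N ^ (i : ℕ)) ^ m i =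
        Polynomial.C (∏ i, a i ^ m i) * Polynomial.X ^ (∑ i, m i * N ^ (i : ℕ)) := by
      simp_rw [mul_pow, Finset.prod_mul_distrib, map_prod, map_pow, ← pow_mul, Finset.prod_pow_eq_pow_sum,
        mul_comm]
    rw [e, Polynomial.algebraMap_eq, ← mul_assoc, ← Polynomial.C_mul,
      Polynomial.coeff_C_mul_X_pow, if_pos rfl] at h
    exact mul_ne_zero hm (Finset.prod_ne_zero_iff.mpr fun i _ => pow_ne_zero _ (ha i)) h
  · intro m' hm' hne
    have e : ∏ i, (Polynomial.C (a i) * Polynomial.X ^ N ^ (i : ℕ)) ^ m' i =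
        Polynomial.C (∏ i, a i ^ m' i) * Polynomial.X ^ (∑ i, m' i * N ^ (i : ℕ)) := by
      simp_rw [mul_pow, Finset.prod_mul_distrib, map_prod, map_pow, ← pow_mul, Finset.prod_pow_eq_pow_sum,
        mul_comm]
    rw [e, Polynomial.algebraMap_eq, ← mul_assoc, ← Polynomial.C_mul,
      Polynomial.coeff_C_mul_X_pow, if_neg]
    intro heq
    exact hne (DFunLike.coe_injective (sum_mul_pow_injective (hdeg m' hm')
      (hdeg m (MvPolynomial.mem_support_iff.mpr hm)) heq.symm))
  · intro h; simp at h; exact absurd h hm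

/-- If `f` and the elements `φⱼ` of `B` satisfy a nontrivial relation of degree less than `N` over
`R ⧸ q`, then on the locus where all `φⱼ + s f ^ N ^ (j + 1)` vanish, `s` not vanishing, there is
a neighbourhood of the zero locus of `f` on which `f` vanishes. -/
theorem exists_separating_element {R B : Type*} [CommRing R] [CommRing B] [Algebra R B] {N d : ℕ}
    (f : B) (φ : Fin d → B) (s : R) (q : Ideal R) [q.IsPrime] (hs : s ∉ q)
    {P : MvPolynomial (Fin (d + 1)) R} (hN : P.totalDegree < N) (hP : ∃ m, P.coeff m ∉ q)
    (h : aeval (Fin.cons f φ : Fin (d + 1) → B) P ∈ q.map (algebraMap R B)) :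
    ∃ b : B, (∀ w : Ideal B, w.IsPrime → w.comap (algebraMap R B) = q → f ∈ w → b ∉ w) ∧
      ∀ w : Ideal B, w.IsPrime → w.comap (algebraMap R B) = q →
        (∀ j : Fin d, φ j + algebraMap R B s * f ^ N ^ ((j : ℕ) + 1) ∈ w) → b ∉ w → f ∈ w := by
  let D := R ⧸ q
  let π := Ideal.Quotient.mk q
  have hs' : π s ≠ 0 := fun h => hs (Ideal.Quotient.eq_zero_iff_mem.mp h)
  -- On the twisted locus `f = 1 · f ^ N ^ 0` and `φⱼ = -s f ^ N ^ (j + 1)`: the variables of `P`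
  -- are specialised to `aᵢ T ^ N ^ i` at `T = f`.
  let a : Fin (d + 1) → D := Fin.cons 1 fun _ => - π s
  have ha : ∀ i, a i ≠ 0 := by
    intro i
    induction i using Fin.cases with
    | zero => simp [a]
    | succ j => simpa [a] using hs'
  have hP' : map π P ≠ 0 := by
    obtain ⟨m, hm⟩ := hP
    intro h0
    apply hm
    rw [← Ideal.Quotient.eq_zero_iff_mem]
    change π (P.coeff m) = 0
    rw [← coeff_map, h0, coeff_zero]
  have hQ := aeval_monomials_ne_zero (N := N) hP'
    ((Finset.sup_mono (MvPolynomial.support_map_subset _ _)).trans_lt hN) ha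
  set Q : Polynomial D :=
    aeval (fun i => Polynomial.C (a i) * Polynomial.X ^ N ^ (i : ℕ)) (map π P) with hQdef
  -- Split off the largest power of `T`, so that `H(0) ≠ 0`. The separating element is `G(f)`, where
  -- `G` lifts `H` to `R`. It takes the nonzero value `H(0)` wherever `f` vanishes.
  obtain ⟨H, hH, hH'⟩ := Polynomial.exists_eq_pow_rootMultiplicity_mul_and_not_dvd Q hQ 0
  rw [map_zero, sub_zero] at hH hH'
  obtain ⟨G, rfl⟩ := Polynomial.map_surjective π Ideal.Quotient.mk_surjective H
  have key : ∀ w : Ideal B, w.comap (algebraMap R B) = q → ∃ ρ : D →+* B ⧸ w,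
      Function.Injective ρ ∧ ρ.comp π = (Ideal.Quotient.mk w).comp (algebraMap R B) := by
    intro w hw
    refine ⟨Ideal.quotientMap w (algebraMap R B) hw.ge, Ideal.quotientMap_injective' hw.le,
      Ideal.quotientMap_comp_mk _⟩
  have hG : ∀ (w : Ideal B) (ρ : D →+* B ⧸ w),
      ρ.comp π = (Ideal.Quotient.mk w).comp (algebraMap R B) →
      Ideal.Quotient.mk w (Polynomial.aeval f G) =
        (G.map π).eval₂ ρ (Ideal.Quotient.mk w f) := by
    intro w ρ hρ
    rw [Polynomial.eval₂_map, hρ, Polynomial.aeval_def, Polynomial.hom_eval₂]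
  refine ⟨Polynomial.aeval f G, ?_, ?_⟩
  · intro w hw hwq hf hb
    obtain ⟨ρ, hρi, hρ⟩ := key w hwq
    rw [← Ideal.Quotient.eq_zero_iff_mem] at hf hb
    rw [hG w ρ hρ, hf, Polynomial.eval₂_at_zero] at hb
    exact hH' (Polynomial.X_dvd_iff.mpr (hρi (by rw [hb, map_zero])))
  · intro w hw hwq hφ hb
    obtain ⟨ρ, hρi, hρ⟩ := key w hwq
    rw [← Ideal.Quotient.eq_zero_iff_mem] at hb ⊢
    rw [hG w ρ hρ] at hb
    have h1 : Ideal.Quotient.mk w (aeval (Fin.cons f φ : Fin (d + 1) → B) P) = 0 :=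
      Ideal.Quotient.eq_zero_iff_mem.mpr (Ideal.map_le_iff_le_comap.mpr hwq.ge h)
    -- At a point `w` of the twisted locus the relation `P` becomes `Q(f) = 0` in the domain `B ⧸
    -- w`.
    have h2 : Q.eval₂ ρ (Ideal.Quotient.mk w f) = 0 := by
      rw [← h1, hQdef, aeval_def, aeval_def, eval₂_map, ← Polynomial.coe_eval₂RingHom,
        eval₂_comp_left, eval₂_comp_left]
      congr 1
      · ext r
        rw [RingHom.comp_apply, RingHom.comp_apply, Polynomial.algebraMap_eq,
          Polynomial.coe_eval₂RingHom, Polynomial.eval₂_C]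
        exact RingHom.congr_fun hρ r
      · funext i
        have hρs : ρ (π s) = Ideal.Quotient.mk w (algebraMap R B s) := RingHom.congr_fun hρ s
        induction i using Fin.cases with
        | zero => simp [a]
        | succ j =>
          have := Ideal.Quotient.eq_zero_iff_mem.mpr (hφ j)
          simp only [map_add, map_mul, map_pow] at this
          simp [a, hρs]
          linear_combination -this
    rw [hH, Polynomial.eval₂_mul, Polynomial.eval₂_pow, Polynomial.eval₂_X] at h2
    exact eq_zero_of_pow_eq_zero ((mul_eq_zero.mp h2).resolve_right hb)

end

noncomputable section

namespace FramedSphere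

/-! ### Vanishing of functions at points -/

/-- The ideal of global functions vanishing at a point. -/
def vanishing {W : Scheme.{u}} (x : W) : Ideal Γ(W, ⊤) :=
  (IsLocalRing.maximalIdeal (W.presheaf.stalk x)).comap (W.presheaf.germ ⊤ x trivial).hom

theorem mem_vanishing {W : Scheme.{u}} (x : W) (a : Γ(W, ⊤)) :
    a ∈ vanishing x ↔ x ∉ W.basicOpen a := by
  rw [Scheme.mem_basicOpen W a x trivial]
  rfl

instance {W : Scheme.{u}} (x : W) : (vanishing x).IsPrime :=
  inferInstanceAs (Ideal.comap _ _).IsPrime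

theorem mem_zeros_iff {W : Scheme.{u}} (s : Set Γ(W, ⊤)) (x : W) :
    x ∈ zeros W s ↔ ∀ a ∈ s, a ∈ vanishing x := by
  simp_rw [mem_vanishing]
  exact Scheme.mem_zeroLocus_iff _ _ _

theorem appTop_mem_vanishing {W U : Scheme.{u}} (f : W ⟶ U) (x : W) (a : Γ(U, ⊤)) :
    f.appTop a ∈ vanishing x ↔ a ∈ vanishing (f x) := by
  have h := Scheme.preimage_basicOpen f a
  rw [mem_vanishing, mem_vanishing, ← Scheme.Hom.mem_preimage, h]
  rfl

theorem mem_vanishing_spec {B : CommRingCat.{u}} (y : Spec B) (b : B) :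
    (Scheme.ΓSpecIso B).inv b ∈ vanishing y ↔ b ∈ y.asIdeal := by
  rw [mem_vanishing, basicOpen_eq_of_affine]
  change ¬ b ∉ y.asIdeal ↔ _
  rw [not_not]

namespace Explicit

variable {S : Scheme.{u}} {X : Over S} {n m : ℕ} {U V : Over S}

/-- The projection of the étale neighbourhood to the base. -/
abbrev proj (e : Explicit X n m U) : e.W ⟶ U.left := e.p ≫ Aff.str m U.left

instance (e : Explicit X n m U) : Etale e.p := e.nhd.1

/-! ### Refinements -/

/-- The data of `e'` are obtained from those of `e` by restriction to a smaller support and a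
refined étale neighbourhood. -/
def Below (e' e : Explicit X n m U) : Prop :=
  e'.Z ≤ e.Z ∧ ∃ j : e'.W ⟶ e.W, j ≫ e.p = e'.p ∧ (∀ i, j.appTop (e.φ i) = e'.φ i) ∧
    j ≫ e.g = e'.g ∧ (∀ i, j.appTop (e.ψ i) = e'.ψ i) ∧ j.appTop e.f = e'.f

theorem Below.refl (e : Explicit X n m U) : Below e e :=
  ⟨le_rfl, 𝟙 _, by simp, by simp, by simp, by simp, by simp⟩

theorem Below.trans {e₁ e₂ e₃ : Explicit X n m U} (h : Below e₁ e₂) (h' : Below e₂ e₃) :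
    Below e₁ e₃ := by
  obtain ⟨hZ, j, h1, h2, h3, h4, h5⟩ := h
  obtain ⟨hZ', j', h1', h2', h3', h4', h5'⟩ := h'
  refine ⟨hZ.trans hZ', j ≫ j', by rw [Category.assoc, h1', h1], fun i => ?_,
    by rw [Category.assoc, h3', h3], fun i => ?_, ?_⟩
  · rw [comp_appTop_apply, h2', h2]
  · rw [comp_appTop_apply, h4', h4]
  · rw [comp_appTop_apply, h5', h5]

/-- The fibre product over `e.W` of the two neighbourhoods is a common refinement. This produces
nearly all the equivalences needed below without further constructions. -/
theorem Below.rel {e₁ e₂ e : Explicit X n m U} (h₁ : Below e₁ e) (h₂ : Below e₂ e)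
    (hZ : e₁.Z = e₂.Z) : Rel e₁ e₂ := by
  obtain ⟨hZ₁, j₁, h1, h2, h3, h4, h5⟩ := h₁
  obtain ⟨-, j₂, h1', h2', h3', h4', h5'⟩ := h₂
  have hw := pullback.condition (f := j₁) (g := j₂)
  have ha : ∀ a, (pullback.fst j₁ j₂).appTop (j₁.appTop a) =
      (pullback.snd j₁ j₂).appTop (j₂.appTop a) := by
    intro a
    rw [← comp_appTop_apply, ← comp_appTop_apply, hw]
  refine ⟨hZ, pullback j₁ j₂, pullback.fst j₁ j₂, pullback.snd j₁ j₂, ?_, ?_, fun i => ?_, ?_,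
    fun i => ?_, ?_⟩
  · rw [← h1, ← h1', ← Category.assoc, hw, Category.assoc]
  · rw [← h1]
    exact (e.nhd.mono _ hZ₁).fiber (h1.symm ▸ e₁.nhd) (h1'.symm ▸ hZ ▸ e₂.nhd)
  · rw [← h2, ← h2', ha]
  · rw [← h3, ← h3', ← Category.assoc, hw, Category.assoc]
  · rw [← h4, ← h4', ha]
  · rw [← h5, ← h5', ha]

/-- Refining the étale neighbourhood. -/
def refine (e : Explicit X n m U) {W' : Scheme.{u}} (q : W' ⟶ e.W)
    (h : IsEtaleNhd (q ≫ e.p) e.Z) : Explicit X n m U where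
  Z := e.Z
  finite := e.finite
  W := W'
  p := q ≫ e.p
  nhd := h
  φ i := q.appTop (e.φ i)
  g := q ≫ e.g
  g_over := by rw [Category.assoc, e.g_over]; simp only [Category.assoc]
  ψ i := q.appTop (e.ψ i)
  f := q.appTop e.f
  support := by rw [pre_comp, e.support, pre_zeros_union]

theorem refine_below (e : Explicit X n m U) {W' : Scheme.{u}} (q : W' ⟶ e.W)
    (h : IsEtaleNhd (q ≫ e.p) e.Z) : Below (e.refine q h) e :=
  ⟨le_rfl, q, rfl, fun _ => rfl, rfl, fun _ => rfl, rfl⟩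

/-- Every equivalence is a span of refinements, so invariance under `Rel` may be checked along
`Below`. -/
theorem Rel.exists_below {e e' : Explicit X n m U} (h : Rel e e') :
    ∃ e'' : Explicit X n m U, e''.Z = e.Z ∧ Below e'' e ∧ Below e'' e' := by
  obtain ⟨hZ, W, q, q', hp, hn, h1, h2, h3, h4⟩ := h
  exact ⟨e.refine q hn, rfl, e.refine_below q hn, hZ.le, q', hp.symm, fun i => (h1 i).symm,
    h2.symm, fun i => (h3 i).symm, h4.symm⟩

theorem restrict_below (e : Explicit X n m U) (Z₁ Z₂ : Closeds (Aff m U.left))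
    (hd : Disjoint Z₁ Z₂) (hs : Z₁ ⊔ Z₂ = e.Z) : Below (e.restrict Z₁ Z₂ hd hs) e :=
  ⟨by rw [← hs]; exact (le_sup_left : Z₁ ≤ Z₁ ⊔ Z₂), (cpl (pre e.p Z₂)).ι, rfl, fun _ => rfl, rfl,
    fun _ => rfl, rfl⟩

/-- The étale neighbourhood of a restriction to part of the support contains the neighbourhood of
any finer restriction. -/
theorem Below.restrict {e' e : Explicit X n m U} (h : Below e' e) (Z₁ Z₂ : Closeds (Aff m U.left))
    (hd : Disjoint Z₁ Z₂) (hs : Z₁ ⊔ Z₂ = e'.Z) (Z₂' : Closeds (Aff m U.left))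
    (hd' : Disjoint Z₁ Z₂') (hs' : Z₁ ⊔ Z₂' = e.Z) :
    Rel (e'.restrict Z₁ Z₂ hd hs) (e.restrict Z₁ Z₂' hd' hs') :=
  ((restrict_below _ _ _ _ _).trans h).rel (restrict_below _ _ _ _ _) rfl

theorem Rel.restrict {e' e : Explicit X n m U} (h : Rel e' e) (Z₁ Z₂ : Closeds (Aff m U.left))
    (hd : Disjoint Z₁ Z₂) (hs : Z₁ ⊔ Z₂ = e'.Z) :
    Rel (e'.restrict Z₁ Z₂ hd hs) (e.restrict Z₁ Z₂ hd (hs.trans h.1)) := by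
  obtain ⟨e'', hZ, h1, h2⟩ := h.exists_below
  exact (h1.restrict Z₁ Z₂ hd (hs.trans hZ.symm) Z₂ hd hs).symm.trans
    (h2.restrict Z₁ Z₂ hd (hs.trans hZ.symm) Z₂ hd _)

/-! ### The quasi-finiteness condition at the points of the support -/

/-- At the points lying over `Z₁`, the vanishing locus of `φ₁, …, φₘ, ψ₁, …, ψₙ` is quasi-finite
over the base. -/
def QfOver (e : Explicit X n m U) (Z₁ : Closeds (Aff m U.left)) : Prop :=
  ∀ w, e.p w ∈ Z₁ → IsolatedIn e.proj e.qfLocus w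

theorem QfOver.mono {e : Explicit X n m U} {Z₁ Z₂ : Closeds (Aff m U.left)} (h : e.QfOver Z₂)
    (hZ : Z₁ ≤ Z₂) : e.QfOver Z₁ := fun w hw => h w (hZ hw)

theorem QfOver.sup {e : Explicit X n m U} {Z₁ Z₂ : Closeds (Aff m U.left)} (h₁ : e.QfOver Z₁)
    (h₂ : e.QfOver Z₂) : e.QfOver (Z₁ ⊔ Z₂) := fun w hw => hw.elim (h₁ w) (h₂ w)

/-- The comparison map `j` is étale, so isolation in the fibre may be tested before or after it, and
over the support each neighbourhood has exactly one point above each point. Hence `QfOver` depends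
only on the class, and it is insensitive to shrinking the support. -/
theorem Below.qfOver_iff {e' e : Explicit X n m U} (h : Below e' e) {Z₁ : Closeds (Aff m U.left)}
    (hZ : Z₁ ≤ e'.Z) : e'.QfOver Z₁ ↔ e.QfOver Z₁ := by
  obtain ⟨hZ', j, h1, h2, h3, h4, h5⟩ := h
  have : Etale (j ≫ e.p) := by rw [h1]; infer_instance
  have : Etale j := Etale.of_comp j e.p
  have hL : (e'.qfLocus : Set e'.W) = j ⁻¹' (e.qfLocus : Set e.W) := by
    rw [← coe_pre, qfLocus, qfLocus, pre_zeros, Set.image_union, image_range, image_range]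
    simp only [h2, h4]
  have hpt : ∀ w, IsolatedIn e'.proj e'.qfLocus w ↔ IsolatedIn e.proj e.qfLocus (j w) := by
    intro w
    rw [hL, ← isolatedIn_etale j e.proj, proj, proj, ← Category.assoc, h1]
  have hp : ∀ w, e'.p w = e.p (j w) := fun w => by rw [← h1, Scheme.Hom.comp_apply]
  constructor
  · intro H w hw
    obtain ⟨w', hw'⟩ := e'.nhd.exists_point (hZ hw)
    have : w = j w' := e.nhd.injOn (w := j w') (by rw [← hp, hw']; exact hZ' (hZ hw))
      (by rw [← hp, hw'])
    rw [this, ← hpt]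
    exact H w' (by rw [hw']; exact hw)
  · intro H w hw
    rw [hpt]
    exact H _ (by rw [← hp]; exact hw)

theorem Rel.qfOver_iff {e' e : Explicit X n m U} (h : Rel e' e) {Z₁ : Closeds (Aff m U.left)}
    (hZ : Z₁ ≤ e'.Z) : e'.QfOver Z₁ ↔ e.QfOver Z₁ := by
  obtain ⟨e'', hZ', h1, h2⟩ := h.exists_below
  rw [← hZ'] at hZ
  rw [← h1.qfOver_iff hZ, h2.qfOver_iff hZ]

theorem IsQf.qfOver {e : Explicit X n m U} (h : e.IsQf) : e.QfOver e.Z := fun w hw =>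
  h.isolatedIn (by
    have hw' : w ∈ pre e.p e.Z := hw
    rw [e.support, mem_zeros_iff] at hw'
    rw [qfLocus, mem_zeros_iff]
    exact fun a ha => hw' a (Or.inl ha))

/-- A class of framed correspondences is quasi-finite if and only if it is so at the points of the
support. -/
theorem isQf_mk_iff [CompactSpace U.left] [QuasiSeparatedSpace U.left] (e : Explicit X n m U) :
    Fr.IsQf (Quotient.mk _ e : Fr X n m U) ↔ e.QfOver e.Z := by
  constructor
  · rintro ⟨e', he, h⟩
    have hr : Rel e' e := Quotient.exact he
    rw [← hr.qfOver_iff hr.1.ge, ← hr.1]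
    exact h.qfOver
  · intro h
    obtain ⟨V, hV⟩ := exists_opens_isolatedIn e.proj e.qfLocus
    -- On `V` the locus is only locally quasi-finite. Quasi-compactness over `U` requires a
    -- quasi-compact open set between the compact set `p⁻¹(Z)` and `V`.
    obtain ⟨K, hK, hKo, h1, h2⟩ := PrespectralSpace.exists_isCompact_and_isOpen_between
      (e.nhd.isCompact (Aff.str m U.left) e.finite) V.2 (fun w hw => (hV w).mpr fun _ => h w hw)
    let V' : e.W.Opens := ⟨K, hKo⟩
    have hn : IsEtaleNhd (V'.ι ≫ e.p) e.Z := e.nhd.restrict V' h1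
    refine ⟨e.refine V'.ι hn, Quotient.sound (((e.refine_below _ hn).rel (.refl e) rfl)), ?_⟩
    have : CompactSpace V'.toScheme := isCompact_iff_compactSpace.mp hK
    let e' := e.refine V'.ι hn
    have hqc : CompactSpace (Scheme.IdealSheafData.vanishingIdeal e'.qfLocus).subscheme :=
      haveI : CompactSpace e'.W := this
      QuasiCompact.compactSpace_of_compactSpace (redι e'.qfLocus)
    have hlft : LocallyOfFiniteType (redι e'.qfLocus ≫ e'.proj) := inferInstance
    refine ⟨?_, quasiCompact_of_compactSpace _⟩
    change LocallyQuasiFinite (redι e'.qfLocus ≫ e'.proj)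
    rw [← Scheme.Hom.quasiFiniteLocus_eq_top_iff, eq_top_iff]
    intro y _
    rw [Scheme.Hom.mem_quasiFiniteLocus, quasiFiniteAt_redι]
    have hL : (e'.qfLocus : Set e'.W) = V'.ι ⁻¹' (e.qfLocus : Set e.W) := by
      rw [← coe_pre, qfLocus, qfLocus, pre_zeros, Set.image_union, image_range, image_range]
      rfl
    have hy : redι e'.qfLocus y ∈ (e'.qfLocus : Set e'.W) := by
      rw [← range_redι]; exact ⟨y, rfl⟩
    have h3 := (isolatedIn_etale V'.ι e.proj e.qfLocus (redι e'.qfLocus y)).mpr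
      ((hV _).mp (h2 (redι e'.qfLocus y).2) (by rw [hL] at hy; exact hy))
    rw [hL]
    have e1 : e'.proj = V'.ι ≫ e.proj := Category.assoc _ _ _
    rw [e1]
    exact h3

end Explicit

namespace Explicit

variable {S : Scheme.{u}} {X : Over S} {n m : ℕ} {U V : Over S}

/-! ### Twisting the framing by powers of the last function -/

/-- The functions `φⱼ + s f ^ N ^ (j + 1)`. -/
def twistφ (e : Explicit X n m U) (N : ℕ) (s : Γ(U.left, ⊤)) (j : Fin m) : Γ(e.W, ⊤) :=
  e.φ j + e.proj.appTop s * e.f ^ N ^ ((j : ℕ) + 1)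

/-- Where `f` vanishes so do its powers, whose exponents are positive because `N ≠ 0`; the twist
then changes nothing. -/
theorem twist_support (e : Explicit X n m U) {N : ℕ} (hN : N ≠ 0) (s : Γ(U.left, ⊤)) :
    zeros e.W (Set.range (e.twistφ N s) ∪ Set.range e.ψ ∪ {e.f}) =
      zeros e.W (Set.range e.φ ∪ Set.range e.ψ ∪ {e.f}) := by
  ext x
  change x ∈ zeros _ _ ↔ x ∈ zeros _ _
  rw [mem_zeros_iff, mem_zeros_iff]
  simp only [Set.union_singleton, Set.mem_insert_iff, Set.mem_union, Set.mem_range,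
    or_imp, forall_and, forall_exists_index, forall_apply_eq_imp_iff]
  refine and_congr_right fun hf => and_congr_left fun _ => forall_congr' fun j => ?_
  exact (vanishing x).add_mem_iff_left (Ideal.mul_mem_left _ _
    (Ideal.pow_mem_of_mem _ (hf _ rfl) _ (Nat.pow_pos (Nat.pos_of_ne_zero hN))))

/-- The explicit framed correspondence `(Z, W, φⱼ + s f ^ N ^ (j + 1); g; ψ; f)`; here `N` stands
for `N + 1`, in order that the exponents be positive. -/
def twist (N : ℕ) (s : Γ(U.left, ⊤)) (e : Explicit X n m U) : Explicit X n m U where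
  Z := e.Z
  finite := e.finite
  W := e.W
  p := e.p
  nhd := e.nhd
  φ := e.twistφ (N + 1) s
  g := e.g
  g_over := e.g_over
  ψ := e.ψ
  f := e.f
  support := by rw [twist_support e N.succ_ne_zero, e.support]

theorem Below.twist {e' e : Explicit X n m U} (h : Below e' e) (N : ℕ) (s : Γ(U.left, ⊤)) :
    Below (e'.twist N s) (e.twist N s) := by
  obtain ⟨hZ, j, h1, h2, h3, h4, h5⟩ := h
  refine ⟨hZ, j, h1, fun i => ?_, h3, h4, h5⟩
  change j.appTop (e.twistφ (N + 1) s i) = e'.twistφ (N + 1) s i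
  rw [twistφ, twistφ, map_add, map_mul, map_pow, h2, h5, ← comp_appTop_apply, proj, proj,
    ← Category.assoc, h1]

theorem Rel.twist {e' e : Explicit X n m U} (h : Rel e' e) (N : ℕ) (s : Γ(U.left, ⊤)) :
    Rel (e'.twist N s) (e.twist N s) := by
  obtain ⟨e'', hZ, h1, h2⟩ := h.exists_below
  exact (Rel.symm ((h1.twist N s).rel (.refl _) hZ)).trans
    ((h2.twist N s).rel (.refl _) (hZ.trans h.1))

/-- Replacing the functions `φ`. -/
abbrev withφ (e : Explicit X n m U) (φ' : Fin m → Γ(e.W, ⊤))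
    (h : pre e.p e.Z = zeros e.W (Set.range φ' ∪ Set.range e.ψ ∪ {e.f})) : Explicit X n m U :=
  { e with φ := φ', support := h }

theorem withφ_congr (e : Explicit X n m U) {φ φ' : Fin m → Γ(e.W, ⊤)} (h) (h') (hφ : φ = φ') :
    e.withφ φ h = e.withφ φ' h' := by
  subst hφ; rfl

theorem twist_zero (N : ℕ) (e : Explicit X n m U) : e.twist N 0 = e :=
  e.withφ_congr _ e.support (funext fun i => by rw [twistφ, map_zero, zero_mul, add_zero])

theorem twist_pull (h : V ⟶ U) (N : ℕ) (s : Γ(U.left, ⊤)) (e : Explicit X n m U) :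
    (e.twist N s).pull h = (e.pull h).twist N (h.left.appTop s) := by
  have hs : (pullback.fst e.p (Aff.map m h.left)).appTop (e.proj.appTop s) =
      (e.pull h).proj.appTop (h.left.appTop s) := by
    rw [← comp_appTop_apply, ← comp_appTop_apply]
    refine congrArg (fun t => Scheme.Hom.appTop t s) ?_
    have h1 : Aff.map m h.left ≫ Aff.str m U.left = Aff.str m V.left ≫ h.left :=
      AffineSpace.map_over _
    change pullback.fst _ _ ≫ e.p ≫ _ = (pullback.snd _ _ ≫ _) ≫ _
    rw [Category.assoc, ← h1, ← Category.assoc, pullback.condition, Category.assoc]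
  refine (e.pull h).withφ_congr ((e.twist N s).pull h).support _ (funext fun i => ?_)
  change (pullback.fst e.p (Aff.map m h.left)).appTop (e.twistφ (N + 1) s i) = _
  rw [twistφ, twistφ, map_add, map_mul, map_pow, hs]
  rfl

theorem twist_restrict (N : ℕ) (s : Γ(U.left, ⊤)) (e : Explicit X n m U)
    (Z₁ Z₂ : Closeds (Aff m U.left)) (hd : Disjoint Z₁ Z₂) (hs : Z₁ ⊔ Z₂ = e.Z) :
    Rel ((e.restrict Z₁ Z₂ hd hs).twist N s) ((e.twist N s).restrict Z₁ Z₂ hd hs) :=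
  ((e.restrict_below Z₁ Z₂ hd hs).twist N s).rel (restrict_below _ _ _ _ _) rfl

end Explicit

/-! ### Affine charts -/

theorem exists_affine_point {W : Scheme.{u}} (w : W) :
    ∃ (B : CommRingCat.{u}) (j : Spec B ⟶ W) (_ : IsOpenImmersion j) (y : Spec B), j y = w := by
  obtain ⟨B, j, hj, ⟨y, hy⟩, -⟩ :=
    Scheme.exists_affine_mem_range_and_range_subset (U := (⊤ : W.Opens)) (x := w) trivial
  exact ⟨B, j, hj, y, hy⟩

/-- Base and neighbourhood are shrunk together, so that `B` becomes an étale algebra over a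
polynomial ring over the coordinate ring `R` of an affine open subset of the base. -/
theorem exists_affine_chart {U W : Scheme.{u}} (m : ℕ) (p : W ⟶ Aff m U) [Etale p] (w : W) :
    ∃ (R B : CommRingCat.{u}) (i : Spec R ⟶ U) (_ : IsOpenImmersion i) (j : Spec B ⟶ W)
      (_ : IsOpenImmersion j) (q : Spec B ⟶ Aff m (Spec R)) (_ : Etale q) (y : Spec B),
      q ≫ Aff.map m i = j ≫ p ∧ j y = w := by
  obtain ⟨R, i, hi, t, ht⟩ := exists_affine_point ((p ≫ Aff.str m U) w)
  obtain ⟨v, hv, -⟩ := Scheme.Pullback.exists_preimage_pullback w t ht.symm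
  obtain ⟨B, j, hj, y, hy⟩ := exists_affine_point v
  have hsq := AffineSpace.isPullback_map (n := ULift.{u} (Fin m)) i
  let q := hsq.lift ((j ≫ pullback.fst _ _) ≫ p) (j ≫ pullback.snd (p ≫ Aff.str m U) i) (by
    simp only [Category.assoc, ← pullback.condition])
  have hq : q ≫ Aff.map m i = (j ≫ pullback.fst _ _) ≫ p := hsq.lift_fst _ _ _
  have : IsOpenImmersion (Aff.map m i) :=
    MorphismProperty.of_isPullback (P := @IsOpenImmersion) hsq.flip hi
  have : Etale (q ≫ Aff.map m i) := by rw [hq]; infer_instance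
  exact ⟨R, B, i, hi, j ≫ pullback.fst _ _, inferInstance, q, Etale.of_comp q (Aff.map m i), y, hq,
    by rw [Scheme.Hom.comp_apply, hy, hv]⟩

/-- Evaluation of global functions on an affine chart. -/
def chartEval {W : Scheme.{u}} {B : CommRingCat.{u}} (j : Spec B ⟶ W) : Γ(W, ⊤) →+* B :=
  (j.appTop ≫ (Scheme.ΓSpecIso B).hom).hom

theorem chartEval_mem {W : Scheme.{u}} {B : CommRingCat.{u}} (j : Spec B ⟶ W) (y : Spec B)
    (a : Γ(W, ⊤)) : chartEval j a ∈ y.asIdeal ↔ a ∈ vanishing (j y) := by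
  rw [← appTop_mem_vanishing, ← mem_vanishing_spec]
  change ((Scheme.ΓSpecIso B).hom ≫ (Scheme.ΓSpecIso B).inv) (j.appTop a) ∈ _ ↔ _
  rw [Iso.hom_inv_id]
  rfl

theorem chartEval_comp {W U : Scheme.{u}} {R B : CommRingCat.{u}} (j : Spec B ⟶ W) (i : Spec R ⟶ U)
    (π : W ⟶ U) (ρ : R ⟶ B) (h : Spec.map ρ ≫ i = j ≫ π) (a : Γ(U, ⊤)) :
    chartEval j (π.appTop a) = ρ (chartEval i a) := by
  change (Scheme.ΓSpecIso B).hom (j.appTop (π.appTop a)) = ρ ((Scheme.ΓSpecIso R).hom (i.appTop a))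
  rw [← comp_appTop_apply, ← h, comp_appTop_apply]
  exact congrArg (fun t => t.hom (i.appTop a)) (Scheme.ΓSpecIso_naturality ρ)

/-- On an affine scheme étale over an affine space over `Spec R`, with `R` noetherian, any family of
more functions than coordinates satisfies a relation of bounded degree over each prime of `R`. -/
theorem exists_relation_of_etale {R B : CommRingCat.{u}} [IsNoetherianRing R] {m : ℕ}
    (q : Spec B ⟶ Aff m (Spec R)) [Etale q] (ρ : R ⟶ B) (hρ : Spec.map ρ = q ≫ Aff.str m (Spec R))
    (y : Fin (m + 1) → B) :
    ∃ N : ℕ, ∀ I : Ideal R, I.IsPrime → ∃ P : MvPolynomial (Fin (m + 1)) R, P.totalDegree < N ∧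
      (∃ d, P.coeff d ∉ I) ∧ P.eval₂ ρ.hom y ∈ I.map ρ.hom := by
  obtain ⟨ψ, hψ⟩ := Spec.map_surjective (q ≫ (AffineSpace.SpecIso (ULift.{u} (Fin m)) R).hom)
  have hE : Etale (Spec.map ψ) := by rw [hψ]; infer_instance
  have hE' : ψ.hom.Etale := (HasRingHomProperty.Spec_iff (P := @Etale)).mp hE
  have hc : ψ.hom.comp MvPolynomial.C = ρ.hom := by
    have : CommRingCat.ofHom MvPolynomial.C ≫ ψ = ρ := by
      apply Spec.map_injective
      rw [Spec.map_comp, hψ, hρ, Category.assoc]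
      rw [← AffineSpace.SpecIso_inv_over (n := ULift.{u} (Fin m)), Iso.hom_inv_id_assoc]
    rw [← this]; rfl
  let _ := ψ.hom.toAlgebra
  let _ := ρ.hom.toAlgebra
  have : IsScalarTower R (MvPolynomial (ULift.{u} (Fin m)) R) B := .of_algebraMap_eq' hc.symm
  have : Algebra.Etale (MvPolynomial (ULift.{u} (Fin m)) R) B := hE'
  -- Étale algebras are flat and quasi-finite, and there is one more function than there are
  -- coordinates.
  obtain ⟨N, hN⟩ := exists_relation_of_quasiFinite (R := R) (B := B) (ι := ULift.{u} (Fin m))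
    (κ := ULift.{u} (Fin (m + 1))) (by simp) (fun k => y k.down)
  refine ⟨N, fun I hI => ?_⟩
  obtain ⟨P, h1, ⟨d, hd⟩, h3⟩ := hN I hI
  refine ⟨MvPolynomial.rename Equiv.ulift P, (MvPolynomial.totalDegree_rename_le _ _).trans_lt h1,
    ⟨d.mapDomain Equiv.ulift, ?_⟩, ?_⟩
  · rwa [MvPolynomial.coeff_rename_mapDomain _ Equiv.ulift.injective]
  · rw [MvPolynomial.eval₂_rename]
    exact h3

/-! ### Quasi-finiteness of the twist for large exponents -/

namespace Explicit

variable {S : Scheme.{u}} {X : Over S} {n m : ℕ} {U V : Over S}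

/-- The vanishing locus of `φⱼ + s f ^ N ^ (j + 1)` and of the functions `ψ`. -/
abbrev twistLocus (e : Explicit X n m U) (N : ℕ) (s : Γ(U.left, ⊤)) : Closeds e.W :=
  zeros e.W (Set.range (e.twistφ (N + 1) s) ∪ Set.range e.ψ)

/-- The open set is a whole affine chart and `N₀` is the degree bound of that chart, uniform in the
primes of the base; this is why one `N₀` serves all `x` in it. -/
theorem exists_twist_near [IsLocallyNoetherian U.left] (e : Explicit X n m U) (s : Γ(U.left, ⊤))
    (w : e.W) : ∃ O : Set e.W, IsOpen O ∧ w ∈ O ∧ ∃ N₀ : ℕ, ∀ N ≥ N₀, ∀ x ∈ O, e.p x ∈ e.Z →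
      s ∉ vanishing (e.proj x) → IsolatedIn e.proj (e.twistLocus N s) x := by
  obtain ⟨R, B, i, hi, j, hj, q, hq, y, hsq, rfl⟩ := exists_affine_chart m e.p w
  have : IsLocallyNoetherian (Spec R) := isLocallyNoetherian_of_isOpenImmersion i
  have : IsNoetherianRing R := isLocallyNoetherian_Spec.mp inferInstance
  obtain ⟨ρ, hρ⟩ := Spec.map_surjective (q ≫ Aff.str m (Spec R))
  have hρi : Spec.map ρ ≫ i = j ≫ e.proj := by
    have h1 : Aff.map m i ≫ Aff.str m U.left = Aff.str m (Spec R) ≫ i := AffineSpace.map_over _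
    rw [hρ, Category.assoc, ← h1, ← Category.assoc, hsq, Category.assoc]
  obtain ⟨N₀, hN₀⟩ := exists_relation_of_etale q ρ hρ
    (Fin.cons (chartEval j e.f) fun k => chartEval j (e.φ k))
  refine ⟨Set.range j, j.isOpenEmbedding.isOpen_range, ⟨y, rfl⟩, N₀, ?_⟩
  rintro N hN _ ⟨x, rfl⟩ hx hs
  obtain ⟨P, hP1, hP2, hP3⟩ := hN₀ (x.asIdeal.comap ρ.hom) (PrimeSpectrum.isPrime (Spec.map ρ x))
  have : (x.asIdeal.comap ρ.hom).IsPrime := PrimeSpectrum.isPrime (Spec.map ρ x)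
  let _ := ρ.hom.toAlgebra
  have hs' : chartEval i s ∉ x.asIdeal.comap ρ.hom := by
    rw [← appTop_mem_vanishing, ← chartEval_mem, chartEval_comp j i e.proj ρ hρi] at hs
    exact hs
  -- The twist uses `N + 1` as its base, and the degree of `P` is below `N₀ ≤ N < N + 1`.
  obtain ⟨b, hb1, hb2⟩ := exists_separating_element (R := R) (B := B) (chartEval j e.f)
    (fun k => chartEval j (e.φ k)) (chartEval i s) _ hs' (hP1.trans_le (hN.trans N.le_succ)) hP2 hP3
  have hxZ : j x ∈ zeros e.W (Set.range e.φ ∪ Set.range e.ψ ∪ {e.f}) := by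
    rw [← e.support]; exact hx
  obtain ⟨O, hO, hxO, hO'⟩ := e.nhd.isolatedIn (Aff.str m U.left) e.finite hx
  -- `O` isolates `x` in the fibre of `p⁻¹(Z)`. The element `b` does not vanish at `x`, since `f`
  -- does, and where `b ≠ 0` the twisted locus in this fibre satisfies `f = 0`, hence lies in
  -- `p⁻¹(Z)`.
  refine ⟨O ∩ j '' {z | b ∉ z.asIdeal}, hO.inter (j.isOpenEmbedding.isOpenMap _
    (PrimeSpectrum.isOpen_basicOpen (a := (b : B)))), ⟨hxO, x, ?_, rfl⟩, ?_⟩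
  · refine hb1 _ (PrimeSpectrum.isPrime x) rfl ((chartEval_mem _ _ _).mpr ?_)
    exact (mem_zeros_iff _ _).mp hxZ _ (Or.inr rfl)
  · rintro _ ⟨hz, z, hzb, rfl⟩ hzL hzπ
    apply hO' _ hz _ hzπ
    have hcomap : z.asIdeal.comap ρ.hom = x.asIdeal.comap ρ.hom := by
      have : Spec.map ρ z = Spec.map ρ x := by
        apply i.isOpenEmbedding.injective
        rw [← Scheme.Hom.comp_apply, ← Scheme.Hom.comp_apply, hρi]
        exact hzπ
      exact congrArg PrimeSpectrum.asIdeal this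
    have hzL' := (mem_zeros_iff _ _).mp hzL
    have hf : e.f ∈ vanishing (j z) := by
      rw [← chartEval_mem]
      refine hb2 _ (PrimeSpectrum.isPrime z) hcomap (fun k => ?_) hzb
      have := hzL' _ (Or.inl ⟨k, rfl⟩)
      rw [← chartEval_mem, twistφ, map_add, map_mul, map_pow, chartEval_comp j i e.proj ρ hρi] at this
      exact this
    change j z ∈ pre e.p e.Z
    rw [e.support, ← e.twist_support N.succ_ne_zero s, mem_zeros_iff]
    rintro a (ha | rfl)
    · exact hzL' a ha
    · exact hf

/-- For large `N`, the twist of an explicit framed correspondence over a noetherian base is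
quasi-finite, provided that the original one is so at the zeros of `s`. -/
theorem exists_qfOver_twist [CompactSpace U.left] [IsLocallyNoetherian U.left]
    (e : Explicit X n m U) (s : Γ(U.left, ⊤))
    (h : ∀ w, e.p w ∈ e.Z → s ∈ vanishing (e.proj w) → IsolatedIn e.proj e.qfLocus w) :
    ∃ N₀ : ℕ, ∀ N ≥ N₀, (e.twist N s).QfOver e.Z := by
  suffices H : ∃ N₀ : ℕ, ∀ N ≥ N₀, ∀ x ∈ e.p ⁻¹' (e.Z : Set (Aff m U.left)), e.p x ∈ e.Z →
      s ∉ vanishing (e.proj x) → IsolatedIn e.proj (e.twistLocus N s) x by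
    obtain ⟨N₀, hN₀⟩ := H
    refine ⟨N₀, fun N hN w hw => ?_⟩
    by_cases hs : s ∈ vanishing (e.proj w)
    · refine (h w hw hs).mono fun x hx hxw => ?_
      have hs' : e.proj.appTop s ∈ vanishing x := by
        rw [appTop_mem_vanishing]
        exact (congrArg (s ∈ vanishing ·) hxw).mpr hs
      have hx' := (mem_zeros_iff _ _).mp hx
      refine (mem_zeros_iff _ _).mpr ?_
      rintro a (⟨k, rfl⟩ | ha)
      · have := hx' _ (Or.inl ⟨k, rfl⟩)
        exact ((vanishing x).add_mem_iff_left (Ideal.mul_mem_right _ _ hs')).mp this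
      · exact hx' _ (Or.inr ha)
    · exact hN₀ N hN w hw hw hs
  -- The existence of a bound passes to subsets and to finite unions, so compactness of `p⁻¹(Z)`
  -- makes the local bounds global.
  refine (e.nhd.isCompact (Aff.str m U.left) e.finite).induction_on
    (p := fun A => ∃ N₀ : ℕ, ∀ N ≥ N₀, ∀ x ∈ A, e.p x ∈ e.Z →
      s ∉ vanishing (e.proj x) → IsolatedIn e.proj (e.twistLocus N s) x) ⟨0, by simp⟩ ?_ ?_ ?_
  · rintro A A' hA ⟨N₀, h⟩
    exact ⟨N₀, fun N hN x hx => h N hN x (hA hx)⟩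
  · rintro A A' ⟨N₀, h⟩ ⟨N₀', h'⟩
    refine ⟨max N₀ N₀', fun N hN x hx => ?_⟩
    rcases hx with hx | hx
    · exact h N (le_of_max_le_left hN) x hx
    · exact h' N (le_of_max_le_right hN) x hx
  · intro x hx
    obtain ⟨O, hO, hxO, h⟩ := e.exists_twist_near s x
    exact ⟨O, mem_nhdsWithin_of_mem_nhds (hO.mem_nhds hxO), h⟩

end Explicit

section Fr

variable {S : Scheme.{u}} {X : Over S} {n m : ℕ} {U V : Over S}

/-! ### Twisting framed correspondences -/

/-- The twist of framed correspondences. -/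
def Fr.twist (N : ℕ) (s : Γ(U.left, ⊤)) : Fr X n m U → Fr X n m U :=
  Quotient.map (Explicit.twist N s) fun _ _ h => Explicit.Rel.twist h N s

theorem Fr.twist_zero (N : ℕ) (c : Fr X n m U) : Fr.twist N 0 c = c := by
  induction c using Quotient.inductionOn with
  | h e => exact congrArg (Quotient.mk _) (e.twist_zero N)

theorem Fr.pull_twist (h : V ⟶ U) (N : ℕ) (s : Γ(U.left, ⊤)) (c : Fr X n m U) :
    Fr.pull h (Fr.twist N s c) = Fr.twist N (h.left.appTop s) (Fr.pull h c) := by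
  induction c using Quotient.inductionOn with
  | h e => exact congrArg (Quotient.mk _) (e.twist_pull h N s)

theorem Fr.IsSum.twist {c c₁ c₂ : Fr X n m U} (hc : Fr.IsSum c c₁ c₂) (N : ℕ) (s : Γ(U.left, ⊤)) :
    Fr.IsSum (Fr.twist N s c) (Fr.twist N s c₁) (Fr.twist N s c₂) := by
  obtain ⟨e, Z₁, Z₂, hd, hs, rfl, rfl, rfl⟩ := hc
  exact ⟨e.twist N s, _, _, hd, hs, rfl, Quotient.sound (Explicit.twist_restrict N s e Z₁ Z₂ hd hs),
    Quotient.sound (Explicit.twist_restrict N s e Z₂ Z₁ _ _)⟩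

/-! ### The quasi-finite part of a framed correspondence -/

/-- `Z₁ ⊔ Z₂` is the decomposition of the support into the largest open and closed part over
which `e` is quasi-finite and its complement. -/
structure Explicit.IsQfDecomp (e : Explicit X n m U) (Z₁ Z₂ : Closeds (Aff m U.left)) : Prop where
  disjoint : Disjoint Z₁ Z₂
  sup : Z₁ ⊔ Z₂ = e.Z
  qfOver : e.QfOver Z₁
  le : ∀ Z₁' Z₂', Disjoint Z₁' Z₂' → Z₁' ⊔ Z₂' = e.Z → e.QfOver Z₁' → Z₁' ≤ Z₁

theorem eq_of_sup_eq_sup {α : Type*} [DistribLattice α] [OrderBot α] {a b c : α}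
    (hb : Disjoint a b) (hc : Disjoint a c) (h : a ⊔ b = a ⊔ c) : b = c :=
  le_antisymm (Disjoint.left_le_of_le_sup_left (le_sup_right.trans h.le) hb.symm)
    (Disjoint.left_le_of_le_sup_left (le_sup_right.trans h.ge) hc.symm)

theorem Explicit.IsQfDecomp.eq {e e' : Explicit X n m U} {Z₁ Z₂ Z₁' Z₂' : Closeds (Aff m U.left)}
    (h : e.IsQfDecomp Z₁ Z₂) (h' : e'.IsQfDecomp Z₁' Z₂') (hr : Explicit.Rel e e') :
    Z₁ = Z₁' ∧ Z₂ = Z₂' := by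
  have h1 : Z₁ = Z₁' := le_antisymm
    (h'.le _ _ h.disjoint (h.sup.trans hr.1)
      ((hr.qfOver_iff (le_sup_left.trans h.sup.le)).mp h.qfOver))
    (h.le _ _ h'.disjoint (h'.sup.trans hr.1.symm)
      ((hr.qfOver_iff ((le_sup_left.trans h'.sup.le).trans hr.1.ge)).mpr h'.qfOver))
  subst h1
  exact ⟨rfl, eq_of_sup_eq_sup h.disjoint h'.disjoint (h.sup.trans (hr.1.trans h'.sup.symm))⟩

theorem Explicit.IsQfDecomp.restrict {e : Explicit X n m U} {Z₁ Z₂ Y₁ Y₂ : Closeds (Aff m U.left)}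
    (h : e.IsQfDecomp Z₁ Z₂) (hd : Disjoint Y₁ Y₂) (hs : Y₁ ⊔ Y₂ = e.Z) :
    (e.restrict Y₁ Y₂ hd hs).IsQfDecomp (Z₁ ⊓ Y₁) (Z₂ ⊓ Y₁) where
  disjoint := h.disjoint.mono inf_le_left inf_le_left
  sup := by
    rw [← inf_sup_right, h.sup, ← hs]
    exact inf_eq_right.mpr le_sup_left
  qfOver := ((e.restrict_below Y₁ Y₂ hd hs).qfOver_iff inf_le_right).mpr
    (h.qfOver.mono inf_le_left)
  le Z₁' Z₂' hd' hs' hq := by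
    change Z₁' ⊔ Z₂' = Y₁ at hs'
    have hle : Z₁' ≤ Y₁ := le_sup_left.trans hs'.le
    -- An open and closed part of `Y₁` is one of the whole support, its complement being enlarged by
    -- `Y₂`; the maximality of `Z₁` applies.
    refine le_inf (h.le Z₁' (Z₂' ⊔ Y₂) (disjoint_sup_right.mpr ⟨hd', hd.mono_left hle⟩) ?_
      (((e.restrict_below Y₁ Y₂ hd hs).qfOver_iff hle).mp hq)) hle
    rw [← sup_assoc, hs', hs]

/-- `d` is the restriction of `c` to the largest open and closed part of its support over which it
is quasi-finite. -/
def Fr.IsQfPart (c d : Fr X n m U) : Prop :=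
  ∃ (e : Explicit X n m U) (Z₁ Z₂ : Closeds (Aff m U.left)) (h : e.IsQfDecomp Z₁ Z₂),
    c = Quotient.mk _ e ∧ d = Quotient.mk _ (e.restrict Z₁ Z₂ h.disjoint h.sup)

theorem Fr.IsQfPart.unique {c d d' : Fr X n m U} (h : c.IsQfPart d) (h' : c.IsQfPart d') :
    d = d' := by
  obtain ⟨e, Z₁, Z₂, h, rfl, rfl⟩ := h
  obtain ⟨e', Z₁', Z₂', h', he, rfl⟩ := h'
  have hr : Explicit.Rel e e' := Quotient.exact he
  obtain ⟨rfl, rfl⟩ := h.eq h' hr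
  exact Quotient.sound (hr.restrict _ _ _ _)

instance (m : ℕ) (S : Scheme.{u}) [CompactSpace S] [IsLocallyNoetherian S] :
    NoetherianSpace (Aff m S) := by
  have : IsLocallyNoetherian (Aff m S) := LocallyOfFiniteType.isLocallyNoetherian (Aff.str m S)
  have : CompactSpace (Aff m S) := QuasiCompact.compactSpace_of_compactSpace (Aff.str m S)
  have : AlgebraicGeometry.IsNoetherian (Aff m S) := {}
  infer_instance

variable [CompactSpace U.left] [IsLocallyNoetherian U.left]

theorem Fr.exists_isQf_twist_one (c : Fr X n m U) :
    ∃ N₀ : ℕ, ∀ N ≥ N₀, (Fr.twist N 1 c).IsQf := by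
  induction c using Quotient.inductionOn with
  | h e =>
    obtain ⟨N₀, h⟩ := e.exists_qfOver_twist 1 fun w _ h =>
      absurd h ((Ideal.ne_top_iff_one _).mp (Ideal.IsPrime.ne_top inferInstance))
    exact ⟨N₀, fun N hN => ((e.twist N 1).isQf_mk_iff).mpr (h N hN)⟩

theorem Fr.IsQf.exists_isQf_twist {c : Fr X n m U} (hc : c.IsQf) (s : Γ(U.left, ⊤)) :
    ∃ N₀ : ℕ, ∀ N ≥ N₀, (Fr.twist N s c).IsQf := by
  induction c using Quotient.inductionOn with
  | h e =>
    obtain ⟨N₀, h⟩ := e.exists_qfOver_twist s fun w hw _ => e.isQf_mk_iff.mp hc w hw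
    exact ⟨N₀, fun N hN => ((e.twist N s).isQf_mk_iff).mpr (h N hN)⟩

/-- Closed subsets satisfy the descending chain condition, so a smallest complement `Z₂` exists. The
union of two quasi-finite open and closed parts is again such a part, with complement the
intersection of the complements; minimality thus makes `Z₁` the largest. -/
theorem Explicit.exists_isQfDecomp (e : Explicit X n m U) : ∃ Z₁ Z₂, e.IsQfDecomp Z₁ Z₂ := by
  have hwf : WellFounded fun s t : Closeds (Aff m U.left) => s < t :=
    wellFounded_lt
  obtain ⟨Z₂, ⟨Z₁, hd, hs, hq⟩, hmin⟩ := hwf.has_min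
    {Z₂ | ∃ Z₁, Disjoint Z₁ Z₂ ∧ Z₁ ⊔ Z₂ = e.Z ∧ e.QfOver Z₁}
    ⟨e.Z, ⊥, disjoint_bot_left, bot_sup_eq _, fun w hw => absurd hw (Set.notMem_empty _)⟩
  refine ⟨Z₁, Z₂, hd, hs, hq, fun Z₁' Z₂' hd' hs' hq' => ?_⟩
  have h1 : Z₂ ≤ Z₂' := by
    by_contra h
    refine hmin (Z₂ ⊓ Z₂') ⟨Z₁ ⊔ Z₁', ?_, ?_, hq.sup hq'⟩ (inf_lt_left.mpr h)
    · exact disjoint_sup_left.mpr ⟨hd.mono_right inf_le_left, hd'.mono_right inf_le_right⟩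
    · apply le_antisymm
      · exact sup_le (sup_le (le_sup_left.trans hs.le) (le_sup_left.trans hs'.le))
          ((inf_le_left.trans le_sup_right).trans hs.le)
      · rw [sup_inf_left]
        exact le_inf (hs.ge.trans (sup_le_sup_right le_sup_left _))
          (hs'.ge.trans (sup_le_sup_right le_sup_right _))
  exact Disjoint.left_le_of_le_sup_right ((le_sup_left.trans hs'.le).trans hs.ge)
    (hd'.mono_right h1)

theorem Fr.exists_isQfPart (c : Fr X n m U) : ∃ d, c.IsQfPart d := by
  induction c using Quotient.inductionOn with
  | h e =>
    obtain ⟨Z₁, Z₂, h⟩ := e.exists_isQfDecomp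
    exact ⟨_, e, Z₁, Z₂, h, rfl, rfl⟩

theorem Fr.IsQfPart.isQf {c d : Fr X n m U} (h : c.IsQfPart d) : d.IsQf := by
  obtain ⟨e, Z₁, Z₂, h, rfl, rfl⟩ := h
  rw [Explicit.isQf_mk_iff, (e.restrict_below _ _ _ _).qfOver_iff le_rfl]
  exact h.qfOver

theorem Fr.IsQf.isQfPart {c : Fr X n m U} (h : c.IsQf) : c.IsQfPart c := by
  induction c using Quotient.inductionOn with
  | h e =>
    refine ⟨e, e.Z, ⊥, ⟨disjoint_bot_right, sup_bot_eq _, e.isQf_mk_iff.mp h,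
      fun _ _ _ hs _ => le_sup_left.trans hs.le⟩, rfl, Quotient.sound ?_⟩
    exact (Explicit.Below.refl e).rel (e.restrict_below _ _ _ _) rfl

/-- The largest quasi-finite part of a restriction to `Y₁` is `Z₁ ⊓ Y₁`, so a decomposition of the
support induces one of its quasi-finite part. -/
theorem Fr.IsSum.isQfPart {c c₁ c₂ d d₁ d₂ : Fr X n m U} (hc : Fr.IsSum c c₁ c₂)
    (h : c.IsQfPart d) (h₁ : c₁.IsQfPart d₁) (h₂ : c₂.IsQfPart d₂) : Fr.IsSum d d₁ d₂ := by
  obtain ⟨e, Y₁, Y₂, hd, hs, rfl, rfl, rfl⟩ := hc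
  obtain ⟨Z₁, Z₂, H⟩ := e.exists_isQfDecomp
  have h' : Fr.IsQfPart (Quotient.mk _ e) _ := ⟨e, Z₁, Z₂, H, rfl, rfl⟩
  have h₁' : Fr.IsQfPart (Quotient.mk _ (e.restrict Y₁ Y₂ hd hs)) _ :=
    ⟨_, _, _, H.restrict hd hs, rfl, rfl⟩
  have h₂' : Fr.IsQfPart (Quotient.mk _ (e.restrict Y₂ Y₁ hd.symm ((sup_comm _ _).trans hs))) _ :=
    ⟨_, _, _, H.restrict hd.symm ((sup_comm _ _).trans hs), rfl, rfl⟩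
  rw [h.unique h', h₁.unique h₁', h₂.unique h₂']
  refine ⟨e.restrict Z₁ Z₂ H.disjoint H.sup, Z₁ ⊓ Y₁, Z₁ ⊓ Y₂, hd.mono inf_le_right inf_le_right,
    ?_, rfl, Quotient.sound ?_, Quotient.sound ?_⟩
  · change _ = Z₁
    rw [← inf_sup_left, hs, ← H.sup]
    exact inf_eq_left.mpr le_sup_left
  · exact ((Explicit.restrict_below _ _ _ _ _).trans (Explicit.restrict_below _ _ _ _ _)).rel
      ((Explicit.restrict_below _ _ _ _ _).trans (Explicit.restrict_below _ _ _ _ _)) rfl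
  · exact ((Explicit.restrict_below _ _ _ _ _).trans (Explicit.restrict_below _ _ _ _ _)).rel
      ((Explicit.restrict_below _ _ _ _ _).trans (Explicit.restrict_below _ _ _ _ _)) rfl

end Fr

/-! ### Linear framed correspondences -/

section ZF

variable {S : Scheme.{u}} {X : Over S} {n m : ℕ} {U V : Over S}

theorem AddQuot.induction {T : Type w} {R : T → T → T → Prop} {P : AddQuot T R → Prop}
    (of : ∀ a, P (AddQuot.of R a)) (zero : P 0) (neg : ∀ x, P x → P (-x))
    (add : ∀ x y, P x → P y → P (x + y)) (x : AddQuot T R) : P x := by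
  obtain ⟨y, rfl⟩ := QuotientAddGroup.mk_surjective x
  induction y using FreeAbelianGroup.induction_on with
  | zero => exact zero
  | of a => exact of a
  | neg a h => exact neg _ h
  | add a b ha hb => exact add _ _ ha hb

/-- The inclusion of `ℤF^qfₘ(U, X₊ ∧ Tⁿ⁺¹)` as a homomorphism. -/
def inclHom (X : Over S) (n m : ℕ) (U : Over S) :
    AddQuot (FrQf X n m U) (fun c c₁ c₂ => Fr.IsSum c.1 c₁.1 c₂.1) →+
      AddQuot (Fr X n m U) Fr.IsSum :=
  AddQuot.map Subtype.val fun _ _ _ hc => hc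

theorem inclHom_of (a : FrQf X n m U) :
    inclHom X n m U (AddQuot.of _ a) = AddQuot.of Fr.IsSum a.1 :=
  AddQuot.map_of _ _ _

/-- The twist of linear framed correspondences. -/
def twistHom (X : Over S) (n m : ℕ) (N : ℕ) (s : Γ(U.left, ⊤)) :
    AddQuot (Fr X n m U) Fr.IsSum →+ AddQuot (Fr X n m U) Fr.IsSum :=
  AddQuot.map (Fr.twist N s) fun _ _ _ hc => hc.twist N s

theorem twistHom_of (N : ℕ) (s : Γ(U.left, ⊤)) (c : Fr X n m U) :
    twistHom X n m N s (AddQuot.of Fr.IsSum c) = AddQuot.of Fr.IsSum (Fr.twist N s c) :=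
  AddQuot.map_of _ _ _

theorem of_mem_range_inclHom {c : Fr X n m U} (hc : c.IsQf) :
    AddQuot.of Fr.IsSum c ∈ (inclHom X n m U).range :=
  ⟨AddQuot.of _ (⟨c, hc⟩ : FrQf X n m U), inclHom_of _⟩

section Noetherian

variable [CompactSpace U.left] [IsLocallyNoetherian U.left]

/-- Taking the quasi-finite part is compatible with the additivity relations and fixes quasi-finite
classes, hence induces a left inverse. Naturality of this left inverse in `U` is not needed. -/
theorem inclHom_injective : Function.Injective (inclHom X n m U) := by
  choose part hpart using fun c : Fr X n m U => c.exists_isQfPart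
  let r : AddQuot (Fr X n m U) Fr.IsSum →+
      AddQuot (FrQf X n m U) (fun c c₁ c₂ => Fr.IsSum c.1 c₁.1 c₂.1) :=
    AddQuot.map (fun c => (⟨part c, (hpart c).isQf⟩ : FrQf X n m U)) fun a b c h =>
      h.isQfPart (hpart a) (hpart b) (hpart c)
  have h : r.comp (inclHom X n m U) = AddMonoidHom.id _ := AddQuot.hom_ext fun a => by
    rw [AddMonoidHom.comp_apply, inclHom_of]
    exact (AddQuot.map_of _ _ _).trans
      (congrArg (AddQuot.of _) (Subtype.ext ((hpart a.1).unique a.2.isQfPart)))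
  exact Function.LeftInverse.injective (g := r) fun x => DFunLike.congr_fun h x

/-- An element involves finitely many classes, so the largest of their bounds serves. Requiring all
`N ≥ N₀` rather than a single `N` is what makes the bounds combine. -/
theorem exists_twistHom_one_mem (x : AddQuot (Fr X n m U) Fr.IsSum) :
    ∃ N₀ : ℕ, ∀ N ≥ N₀, twistHom X n m N (1 : Γ(U.left, ⊤)) x ∈ (inclHom X n m U).range := by
  induction x using AddQuot.induction with
  | of a =>
    obtain ⟨N₀, h⟩ := a.exists_isQf_twist_one
    exact ⟨N₀, fun N hN => by rw [twistHom_of]; exact of_mem_range_inclHom (h N hN)⟩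
  | zero => exact ⟨0, fun N _ => by rw [map_zero]; exact zero_mem _⟩
  | neg x h =>
    obtain ⟨N₀, h⟩ := h
    exact ⟨N₀, fun N hN => by rw [map_neg]; exact neg_mem (h N hN)⟩
  | add x y hx hy =>
    obtain ⟨N₀, hx⟩ := hx
    obtain ⟨N₁, hy⟩ := hy
    exact ⟨max N₀ N₁, fun N hN => by
      rw [map_add]; exact add_mem (hx N (le_of_max_le_left hN)) (hy N (le_of_max_le_right hN))⟩

theorem exists_twistHom_mem (s : Γ(U.left, ⊤)) {x : AddQuot (Fr X n m U) Fr.IsSum}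
    (hx : x ∈ (inclHom X n m U).range) :
    ∃ N₀ : ℕ, ∀ N ≥ N₀, twistHom X n m N s x ∈ (inclHom X n m U).range := by
  obtain ⟨y, rfl⟩ := hx
  induction y using AddQuot.induction with
  | of a =>
    obtain ⟨N₀, h⟩ := a.2.exists_isQf_twist s
    exact ⟨N₀, fun N hN => by
      rw [inclHom_of, twistHom_of]; exact of_mem_range_inclHom (h N hN)⟩
  | zero => exact ⟨0, fun N _ => by rw [map_zero, map_zero]; exact zero_mem _⟩
  | neg x h =>
    obtain ⟨N₀, h⟩ := h
    exact ⟨N₀, fun N hN => by rw [map_neg, map_neg]; exact neg_mem (h N hN)⟩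
  | add x y hx hy =>
    obtain ⟨N₀, hx⟩ := hx
    obtain ⟨N₁, hy⟩ := hy
    exact ⟨max N₀ N₁, fun N hN => by
      rw [map_add, map_add]
      exact add_mem (hx N (le_of_max_le_left hN)) (hy N (le_of_max_le_right hN))⟩

end Noetherian

/-- The twist of linear framed correspondences, as a morphism. -/
def ZFm.twist (X : Over S) (n m : ℕ) (N : ℕ) (s : Γ(U.left, ⊤)) :
    (ZFm X n m).obj (op U) ⟶ (ZFm X n m).obj (op U) :=
  AddCommGrpCat.ofHom (twistHom X n m N s)

theorem ZFm.twist_zero (N : ℕ) : ZFm.twist X n m N (0 : Γ(U.left, ⊤)) = 𝟙 _ :=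
  AddCommGrpCat.hom_ext
    (AddQuot.map_eq_id (hf := fun _ _ _ hc => hc.twist N 0) _ fun a => Fr.twist_zero N a)

theorem ZFm.twist_map (h : V ⟶ U) (N : ℕ) (s : Γ(U.left, ⊤)) :
    ZFm.twist X n m N s ≫ (ZFm X n m).map h.op =
      (ZFm X n m).map h.op ≫ ZFm.twist X n m N (h.left.appTop s) :=
  AddCommGrpCat.hom_ext (AddQuot.map_comm (hf := fun _ _ _ hc => hc.twist N _)
    (hg := fun _ _ _ hc => hc.pull h) (hf' := fun _ _ _ hc => hc.pull h)
    (hg' := fun _ _ _ hc => hc.twist N _) _ _ _ _ fun a => Fr.pull_twist h N s a)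

section Noetherian

variable [CompactSpace U.left] [IsLocallyNoetherian U.left]

theorem ZFm.incl_injective : Function.Injective ((ZFm.incl X n m).app (op U)) :=
  inclHom_injective (X := X) (n := n) (m := m) (U := U)

theorem ZFm.exists_twist_one_mem (x : (ZFm X n m).obj (op U)) :
    ∃ N₀ : ℕ, ∀ N ≥ N₀, ZFm.twist X n m N (1 : Γ(U.left, ⊤)) x ∈
      Set.range ((ZFm.incl X n m).app (op U)) :=
  exists_twistHom_one_mem (X := X) (n := n) (m := m) (U := U) x

theorem ZFm.exists_twist_mem (s : Γ(U.left, ⊤)) {x : (ZFm X n m).obj (op U)}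
    (hx : x ∈ Set.range ((ZFm.incl X n m).app (op U))) :
    ∃ N₀ : ℕ, ∀ N ≥ N₀, ZFm.twist X n m N s x ∈ Set.range ((ZFm.incl X n m).app (op U)) :=
  exists_twistHom_mem (X := X) (n := n) (m := m) (U := U) s hx

end Noetherian

end ZF

/-! ### The simplicial homotopy from the identity to the twist -/

section Prism

open MonoidalCategory CartesianMonoidalCategory Simplicial

variable (k : Type u) [Field k]

/-- Partial sums of barycentric coordinates pull back by pulling back the index condition. The
homotopy identities thereby become statements about inequalities between indices. -/
theorem SimplexRing.map_sum_t {a b : ℕ} (θ : Fin (a + 1) → Fin (b + 1)) (P : Fin (b + 1) → Prop)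
    [DecidablePred P] : SimplexRing.map k θ (∑ j with P j, SimplexRing.t k b j) =
      ∑ i with P (θ i), SimplexRing.t k a i := by
  rw [map_sum]
  simp only [SimplexRing.map_t]
  rw [← Finset.sum_fiberwise_of_maps_to (s := {i | P (θ i)}) (t := {j | P j}) (g := θ) (by simp)]
  refine Finset.sum_congr rfl fun j hj => Finset.sum_congr ?_ fun _ _ => rfl
  ext i
  simp only [Finset.mem_filter, Finset.mem_univ, true_and] at hj ⊢
  exact ⟨fun h => ⟨h ▸ hj, h⟩, fun h => h.2⟩

variable {k}

/-- The function on `U × Δˡ` defined by an element of the coordinate ring of `Δˡ`. -/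
def simplexFun (U : Over (pt k)) (l : ℕ) : SimplexRing k l →+* Γ((U ⊗ simplex k l).left, ⊤) :=
  (snd U (simplex k l)).left.appTop.hom.comp
    (Scheme.ΓSpecIso (.of (SimplexRing k l))).inv.hom

theorem simplexFun_map (U : Over (pt k)) {a b : ℕ} (θ : Fin (a + 1) → Fin (b + 1))
    (x : SimplexRing k b) :
    (U ◁ simplexMap k θ).left.appTop (simplexFun U b x) =
      simplexFun U a (SimplexRing.map k θ x) := by
  change (U ◁ simplexMap k θ).left.appTop ((snd U (simplex k b)).left.appTop _) =
    (snd U (simplex k a)).left.appTop _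
  have h1 : (U ◁ simplexMap k θ).left ≫ (snd U (simplex k b)).left =
      (snd U (simplex k a)).left ≫ (simplexMap k θ).left := by
    rw [← Over.comp_left, ← Over.comp_left, whiskerLeft_snd]
  rw [← comp_appTop_apply, h1, comp_appTop_apply]
  congr 1
  exact (DFunLike.congr_fun (congrArg CommRingCat.Hom.hom
    (Scheme.ΓSpecIso_inv_naturality (CommRingCat.ofHom (SimplexRing.map k θ).toRingHom))) x).symm

instance (l : ℕ) : IsAffineHom (simplex k l).hom := by
  change IsAffineHom (Spec.map _)
  infer_instance

instance (l : ℕ) : LocallyOfFiniteType (simplex k l).hom := by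
  change LocallyOfFiniteType (Spec.map _)
  rw [HasRingHomProperty.Spec_iff (P := @LocallyOfFiniteType)]
  exact RingHom.finiteType_algebraMap.mpr inferInstance

theorem compactSpace_tensor_simplex (U : Over (pt k)) (l : ℕ) [QuasiCompact U.hom] :
    CompactSpace (U ⊗ simplex k l).left := by
  have : QuasiCompact (U ⊗ simplex k l).hom := by
    rw [Over.tensorObj_hom]
    infer_instance
  exact QuasiCompact.compactSpace_of_compactSpace (U ⊗ simplex k l).hom

theorem isLocallyNoetherian_tensor_simplex (U : Over (pt k)) (l : ℕ) [LocallyOfFiniteType U.hom] :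
    IsLocallyNoetherian (U ⊗ simplex k l).left := by
  have : LocallyOfFiniteType (U ⊗ simplex k l).hom := by
    rw [Over.tensorObj_hom]
    infer_instance
  exact LocallyOfFiniteType.isLocallyNoetherian (U ⊗ simplex k l).hom

variable (X : Over (pt k)) (n m : ℕ) (U : Over (pt k)) (N : ℕ)

/-- The simplicial group `ℤFₘ(U × Δ^•, X₊ ∧ Tⁿ⁺¹)`. -/
abbrev simplicialZFm : SimplicialObject AddCommGrpCat.{u + 1} :=
  ((simplicialPresheaf k).obj (ZFm X n m)).obj (op U)

/-- The twist of `ℤFₘ(U × Δˡ, X₊ ∧ Tⁿ⁺¹)` by a function on `Δˡ`. -/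
def simplexTwist {l : ℕ} (s : SimplexRing k l) :
    (simplicialZFm X n m U) _⦋l⦌ ⟶ (simplicialZFm X n m U) _⦋l⦌ :=
  ZFm.twist X n m N (simplexFun U l s)

theorem simplexTwist_zero (l : ℕ) : simplexTwist X n m U N (0 : SimplexRing k l) = 𝟙 _ := by
  rw [simplexTwist, map_zero]
  exact ZFm.twist_zero N

theorem simplexTwist_map {a b : ℕ} (θ : ⦋a⦌ ⟶ ⦋b⦌) (s : SimplexRing k b) :
    simplexTwist X n m U N s ≫ (simplicialZFm X n m U).map θ.op =
      (simplicialZFm X n m U).map θ.op ≫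
        simplexTwist X n m U N (SimplexRing.map k θ.toOrderHom s) := by
  rw [simplexTwist, simplexTwist, ← simplexFun_map]
  exact ZFm.twist_map (U ◁ simplexMap k θ.toOrderHom) N _

/-- The twist by `1`, as an endomorphism of the simplicial group `ℤFₘ(U × Δ^•, X₊ ∧ Tⁿ⁺¹)`. -/
def simplicialTwist : simplicialZFm X n m U ⟶ simplicialZFm X n m U where
  app a := simplexTwist X n m U N (l := a.unop.len) 1
  naturality a b θ := by
    have h := simplexTwist_map X n m U N (a := b.unop.len) (b := a.unop.len) θ.unop 1
    rw [map_one] at h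
    exact h.symm

theorem simplicialTwist_app (l : ℕ) :
    (simplicialTwist X n m U N).app (op ⦋l⦌) =
      ZFm.twist X n m N (1 : Γ((U ⊗ simplex k l).left, ⊤)) := by
  rw [← map_one (simplexFun U l)]
  rfl

/-- The function `tᵢ₊₁ + ⋯ + tₗ₊₁` on `Δˡ⁺¹`. -/
def SimplexRing.tail (l : ℕ) (i : Fin (l + 1)) : SimplexRing k (l + 1) :=
  ∑ j with i.castSucc < j, SimplexRing.t k (l + 1) j

/-- The components of the simplicial homotopy from the identity to the twist. -/
def prism {l : ℕ} (i : Fin (l + 1)) :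
    (simplicialZFm X n m U) _⦋l⦌ ⟶ (simplicialZFm X n m U) _⦋l + 1⦌ :=
  (simplicialZFm X n m U).σ i ≫ simplexTwist X n m U N (SimplexRing.tail l i)

/-- Normal form: a simplicial operator followed by a twist by a partial sum. With `map_prism`, each
homotopy identity splits into a simplicial identity for the operators and an equivalence of index
conditions. -/
theorem prism_map {l b : ℕ} (i : Fin (l + 1)) (θ : ⦋b⦌ ⟶ ⦋l + 1⦌) :
    prism X n m U N i ≫ (simplicialZFm X n m U).map θ.op =
      ((simplicialZFm X n m U).σ i ≫ (simplicialZFm X n m U).map θ.op) ≫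
        simplexTwist X n m U N (∑ j with i.castSucc < θ.toOrderHom j, SimplexRing.t k b j) := by
  rw [prism, Category.assoc, simplexTwist_map, SimplexRing.tail, SimplexRing.map_sum_t,
    Category.assoc]

theorem map_prism {l b : ℕ} (i : Fin (l + 1)) (θ : ⦋l⦌ ⟶ ⦋b⦌) :
    (simplicialZFm X n m U).map θ.op ≫ prism X n m U N i =
      ((simplicialZFm X n m U).map θ.op ≫ (simplicialZFm X n m U).σ i) ≫
        simplexTwist X n m U N (∑ j with i.castSucc < j, SimplexRing.t k (l + 1) j) :=
  (Category.assoc _ _ _).symm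

theorem comp_simplexTwist_congr {A : AddCommGrpCat.{u + 1}} {l : ℕ}
    {f g : A ⟶ (simplicialZFm X n m U) _⦋l⦌} (h : f = g) {P Q : Fin (l + 1) → Prop}
    [DecidablePred P] [DecidablePred Q] (hPQ : ∀ j, P j ↔ Q j) :
    f ≫ simplexTwist X n m U N (∑ j with P j, SimplexRing.t k l j) =
      g ≫ simplexTwist X n m U N (∑ j with Q j, SimplexRing.t k l j) := by
  rw [h, Finset.filter_congr fun j _ => hPQ j]

theorem toOrderHom_δ {l : ℕ} (i : Fin (l + 2)) (j : Fin (l + 1)) :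
    (SimplexCategory.δ i).toOrderHom j = i.succAbove j := rfl

theorem toOrderHom_σ {l : ℕ} (i : Fin (l + 1)) (j : Fin (l + 2)) :
    (SimplexCategory.σ i).toOrderHom j = i.predAbove j := rfl

/-- The simplicial homotopy from the identity to the twist by `1`. -/
def prismHomotopy : SimplicialObject.Homotopy (𝟙 (simplicialZFm X n m U))
    (simplicialTwist X n m U N) where
  h i := prism X n m U N i
  h_zero_comp_δ_zero l := by
    have h := (simplicialZFm X n m U).δ_comp_σ_self (i := (0 : Fin (l + 1)))
    refine (prism_map X n m U N _ _).trans ?_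
    -- `δ 0` takes only positive values, so all coordinates are summed and the function is `1`: this
    -- end is the twist.
    have h' : (∑ j with (0 : Fin (l + 1)).castSucc < (SimplexCategory.δ 0).toOrderHom j,
        SimplexRing.t k l j) = 1 := by
      rw [← SimplexRing.sum_t k l, Finset.filter_true_of_mem]
      intro j _
      rw [toOrderHom_δ]
      simp
    rw [h']
    exact (congrArg (· ≫ simplexTwist X n m U N 1) h).trans (Category.id_comp _)
  h_last_comp_δ_last l := by
    have h := (simplicialZFm X n m U).δ_comp_σ_succ (i := Fin.last l)
    refine (prism_map X n m U N _ _).trans ?_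
    -- The last face map takes no value above `l`, so the sum is empty and the function is `0`: this
    -- end is the identity.
    rw [Finset.filter_false_of_mem, Finset.sum_empty, simplexTwist_zero, Category.comp_id]
    · exact h
    · intro j _
      rw [toOrderHom_δ, Fin.succAbove_last]
      simp [Fin.le_last]
  h_succ_comp_δ_castSucc_of_lt i j hij := by
    refine (prism_map X n m U N _ _).trans (Eq.trans ?_ (map_prism X n m U N _ _).symm)
    refine comp_simplexTwist_congr X n m U N ((simplicialZFm X n m U).δ_comp_σ_of_le hij) fun a => ?_
    rw [toOrderHom_δ]
    simp only [Fin.succAbove, Fin.lt_def, Fin.le_def, Fin.val_castSucc, Fin.val_succ] at *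
    split_ifs <;> simp only [Fin.val_castSucc, Fin.val_succ] <;> omega
  h_succ_comp_δ_castSucc_succ j := by
    refine (prism_map X n m U N _ _).trans (Eq.trans ?_ (prism_map X n m U N _ _).symm)
    refine comp_simplexTwist_congr X n m U N
      (((simplicialZFm X n m U).δ_comp_σ_self (i := j.succ)).trans
        ((simplicialZFm X n m U).δ_comp_σ_succ (i := j.castSucc)).symm) fun a => ?_
    rw [toOrderHom_δ]
    simp only [Fin.succAbove, Fin.lt_def, Fin.val_castSucc, Fin.val_succ] at *
    split_ifs <;> simp only [Fin.val_castSucc, Fin.val_succ] <;> omega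
  h_castSucc_comp_δ_succ_of_lt i j hji := by
    refine (prism_map X n m U N _ _).trans (Eq.trans ?_ (map_prism X n m U N _ _).symm)
    refine comp_simplexTwist_congr X n m U N ((simplicialZFm X n m U).δ_comp_σ_of_gt hji) fun a => ?_
    rw [toOrderHom_δ]
    simp only [Fin.succAbove, Fin.lt_def, Fin.val_castSucc, Fin.val_succ] at *
    split_ifs <;> simp only [Fin.val_castSucc, Fin.val_succ] <;> omega
  h_comp_σ_castSucc_of_le i j hij := by
    refine (prism_map X n m U N _ _).trans (Eq.trans ?_ (map_prism X n m U N _ _).symm)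
    refine comp_simplexTwist_congr X n m U N ((simplicialZFm X n m U).σ_comp_σ hij) fun a => ?_
    rw [toOrderHom_σ]
    simp only [Fin.predAbove, Fin.lt_def, Fin.le_def, Fin.val_castSucc, Fin.val_succ] at *
    split_ifs <;> simp only [Fin.val_pred, Fin.coe_castPred] <;> omega
  h_comp_σ_succ_of_lt i j hji := by
    refine (prism_map X n m U N _ _).trans (Eq.trans ?_ (map_prism X n m U N _ _).symm)
    refine comp_simplexTwist_congr X n m U N ((simplicialZFm X n m U).σ_comp_σ hji).symm fun a => ?_
    rw [toOrderHom_σ]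
    simp only [Fin.predAbove, Fin.lt_def, Fin.le_def, Fin.val_castSucc, Fin.val_succ] at *
    split_ifs <;> simp only [Fin.val_pred, Fin.coe_castPred] <;> omega

end Prism

/-! ### A criterion for quasi-isomorphisms -/

section Criterion

variable {ι : Type*} {c : ComplexShape ι} {A B : HomologicalComplex AddCommGrpCat.{v} c}

theorem exists_iCycles_eq (K : HomologicalComplex AddCommGrpCat.{v} c) {i : ι} (x : K.X i)
    (hx : K.d i (c.next i) x = 0) : ∃ z : K.cycles i, K.iCycles i z = x :=
  (ShortComplex.ab_exact_iff _).mp (ShortComplex.exact_of_f_is_kernel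
    (ShortComplex.mk _ _ (K.iCycles_d i (c.next i))) (K.cyclesIsKernel i _ rfl)) x hx

theorem exists_toCycles_eq (K : HomologicalComplex AddCommGrpCat.{v} c) {i : ι} (z : K.cycles i)
    (hz : K.homologyπ i z = 0) : ∃ y : K.X (c.prev i), K.toCycles (c.prev i) i y = z :=
  (ShortComplex.ab_exact_iff _).mp (ShortComplex.exact_of_g_is_cokernel
    (ShortComplex.mk _ _ (K.toCycles_comp_homologyπ (c.prev i) i))
    (K.homologyIsCokernel _ i rfl)) z hz

theorem homologyπ_surjective (K : HomologicalComplex AddCommGrpCat.{v} c) (i : ι) :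
    Function.Surjective (K.homologyπ i) :=
  (AddCommGrpCat.epi_iff_surjective _).mp inferInstance

theorem iCycles_injective (K : HomologicalComplex AddCommGrpCat.{v} c) (i : ι) :
    Function.Injective (K.iCycles i) :=
  (AddCommGrpCat.mono_iff_injective _).mp inferInstance

/-- Every chain of `B` whose boundary comes from `A` comes from `A` up to a boundary. -/
def CompressesRelativeCycles (α : A ⟶ B) : Prop :=
  ∀ (i : ι) (x : B.X i), (∀ j, ∃ a : A.X j, α.f j a = B.d i j x) →
    ∃ (j : ι) (y : B.X j) (a : A.X i), B.d j i y + α.f i a = x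

/-- The condition expresses the vanishing of the homology of `B` relative to `A`. For injectivity on
homology it is applied to a chain bounding a cycle of `A`, for surjectivity to a cycle of `B`. -/
theorem quasiIso_of_compressesRelativeCycles {α : A ⟶ B}
    (hinj : ∀ i, Function.Injective (α.f i)) (h : CompressesRelativeCycles α) : QuasiIso α := by
  have comm (i j : ι) (a : A.X i) : α.f j (A.d i j a) = B.d i j (α.f i a) := by
    rw [← ConcreteCategory.comp_apply, ← ConcreteCategory.comp_apply, α.comm]
  have dd (K : HomologicalComplex AddCommGrpCat.{v} c) (i j l : ι) (x : K.X i) :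
      K.d j l (K.d i j x) = 0 := by
    rw [← ConcreteCategory.comp_apply, K.d_comp_d]; rfl
  have icyc (i : ι) (z : A.cycles i) :
      B.iCycles i (HomologicalComplex.cyclesMap α i z) = α.f i (A.iCycles i z) := by
    rw [← ConcreteCategory.comp_apply, HomologicalComplex.cyclesMap_i, ConcreteCategory.comp_apply]
  have tocyc (K : HomologicalComplex AddCommGrpCat.{v} c) (i j : ι) (x : K.X i) :
      K.iCycles j (K.toCycles i j x) = K.d i j x := by
    rw [← ConcreteCategory.comp_apply, HomologicalComplex.toCycles_i]
  have hπ (i : ι) (z : A.cycles i) : HomologicalComplex.homologyMap α i (A.homologyπ i z) =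
      B.homologyπ i (HomologicalComplex.cyclesMap α i z) := by
    rw [← ConcreteCategory.comp_apply, HomologicalComplex.homologyπ_naturality,
      ConcreteCategory.comp_apply]
  rw [quasiIso_iff]
  intro i
  rw [quasiIsoAt_iff_isIso_homologyMap]
  have h1 : Mono (HomologicalComplex.homologyMap α i) := by
    rw [AddCommGrpCat.mono_iff_injective, injective_iff_map_eq_zero]
    intro z' hz'
    obtain ⟨z, rfl⟩ := homologyπ_surjective A i z'
    rw [hπ] at hz'
    obtain ⟨y, hy⟩ := exists_toCycles_eq B _ hz'
    have hy' : B.d _ i y = α.f i (A.iCycles i z) := by rw [← icyc, ← hy, tocyc]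
    rw [← map_zero (A.homologyπ i).hom]
    -- If `i` has no predecessor, `c.prev i` is a default value with zero differential, and the
    -- cycle itself is zero.
    by_cases hr : c.Rel (c.prev i) i
    · obtain ⟨j, w, a, hw⟩ := h _ y fun j => by
        by_cases hj : c.Rel (c.prev i) j
        · obtain rfl := c.next_eq hr hj
          exact ⟨_, hy'.symm⟩
        · exact ⟨0, by rw [B.shape _ _ hj, map_zero]; rfl⟩
      have ha : A.toCycles _ i a = z := iCycles_injective A i (hinj i (by
        rw [tocyc, comm, ← hy', ← hw, map_add, dd, zero_add]))
      rw [← ha, ← ConcreteCategory.comp_apply, HomologicalComplex.toCycles_comp_homologyπ, map_zero]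
      rfl
    · have hz : z = 0 := iCycles_injective A i (hinj i (by
        rw [← hy', B.shape _ _ hr, map_zero, map_zero]; rfl))
      rw [hz]
  have h2 : Epi (HomologicalComplex.homologyMap α i) := by
    rw [AddCommGrpCat.epi_iff_surjective]
    intro z'
    obtain ⟨z, rfl⟩ := homologyπ_surjective B i z'
    have hz (j : ι) : B.d i j (B.iCycles i z) = 0 := by
      rw [← ConcreteCategory.comp_apply, HomologicalComplex.iCycles_d]; rfl
    obtain ⟨l, y, a, hya⟩ := h i _ fun j => ⟨0, (map_zero (α.f j).hom).trans (hz j).symm⟩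
    have ha : A.d i (c.next i) a = 0 := hinj _ (by
      have := hz (c.next i)
      rw [← hya, map_add, dd, zero_add] at this
      rw [comm, this, map_zero])
    obtain ⟨z₀, hz₀⟩ := exists_iCycles_eq A a ha
    refine ⟨A.homologyπ i z₀, ?_⟩
    have : B.toCycles l i y + HomologicalComplex.cyclesMap α i z₀ = z :=
      iCycles_injective B i (by rw [map_add, icyc, tocyc, hz₀, hya])
    rw [hπ, ← this, map_add, ← ConcreteCategory.comp_apply (B.toCycles _ _),
      HomologicalComplex.toCycles_comp_homologyπ]
    exact (zero_add _).symm
  exact isIso_of_mono_of_epi _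

/-- By the homotopy formula `x = H(dx) + d(Hx) + T x`, where the outer terms come from `A`. The
homotopy may depend on `x`. `T₀` is tied to the identity by an equation because it will arise as the
image of an identity under a functor. -/
theorem compressesRelativeCycles_of_homotopy {α : A ⟶ B}
    (h : ∀ (i : ι) (x : B.X i) (a : A.X (c.next i)), α.f _ a = B.d i _ x →
      ∃ (T₀ T : B ⟶ B) (H : Homotopy T₀ T), T₀ = 𝟙 B ∧ (∃ a', α.f i a' = T.f i x) ∧
        ∃ a', α.f i a' = H.hom (c.next i) i (α.f _ a)) : CompressesRelativeCycles α := by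
  intro i x hx
  obtain ⟨a₀, ha₀⟩ := hx (c.next i)
  obtain ⟨T₀, T, H, rfl, ⟨a, ha⟩, a', ha'⟩ := h i x a₀ ha₀
  refine ⟨c.prev i, H.hom i (c.prev i) x, a' + a, ?_⟩
  have hc : x = H.hom (c.next i) i (B.d i _ x) + B.d _ i (H.hom i (c.prev i) x) + T.f i x :=
    DFunLike.congr_fun (congrArg AddCommGrpCat.Hom.hom (H.comm i)) x
  rw [map_add, ha, ha', ha₀, ← add_assoc, add_comm (B.d _ _ _), ← hc]

/-- The morphisms which send a given element into a given subgroup. -/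
def homsInto {G G' : AddCommGrpCat.{v}} (x : G) (K : AddSubgroup G') : AddSubgroup (G ⟶ G') where
  carrier := {f | f x ∈ K}
  zero_mem' := K.zero_mem
  add_mem' := K.add_mem
  neg_mem' := K.neg_mem

end Criterion

/-! ### The comparison at a finite level -/

section Level

open MonoidalCategory AlgebraicTopology Filter

variable {k : Type u} [Field k] (X : Over (pt k)) (n m : ℕ) (U : Over (pt k))
  [LocallyOfFiniteType U.hom] [QuasiCompact U.hom]

/-- A degeneracy is a base change and preserves the quasi-finite part; the subsequent twist
preserves it for large `N`. -/
theorem eventually_prism_mem {l : ℕ} (i : Fin (l + 1))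
    {x : (ZFm X n m).obj (op (U ⊗ simplex k l))}
    (hx : x ∈ ((ZFm.incl X n m).app (op (U ⊗ simplex k l))).hom.range) :
    ∀ᶠ N in atTop, prism X n m U N i x ∈
      ((ZFm.incl X n m).app (op (U ⊗ simplex k (l + 1)))).hom.range := by
  have := compactSpace_tensor_simplex U (l + 1)
  have := isLocallyNoetherian_tensor_simplex U (l + 1)
  obtain ⟨y, rfl⟩ := hx
  let θ : op (U ⊗ simplex k l) ⟶ op (U ⊗ simplex k (l + 1)) :=
    (U ◁ simplexMap k (Fin.predAbove i)).op
  refine eventually_atTop.mpr (ZFm.exists_twist_mem (simplexFun U (l + 1) (SimplexRing.tail l i))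
    (x := (ZFm X n m).map θ ((ZFm.incl X n m).app _ y)) ⟨(ZFqfm X n m).map θ y, ?_⟩)
  rw [← ConcreteCategory.comp_apply, ← ConcreteCategory.comp_apply, NatTrans.naturality]

theorem eventually_chainHomotopy_mem (p q : ℕ) {x : (ZFm X n m).obj (op (U ⊗ simplex k p))}
    (hx : x ∈ ((ZFm.incl X n m).app (op (U ⊗ simplex k p))).hom.range) :
    ∀ᶠ N in atTop, (prismHomotopy X n m U N).toChainHomotopy.hom p q x ∈
      ((ZFm.incl X n m).app (op (U ⊗ simplex k q))).hom.range := by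
  by_cases h : p + 1 = q
  · subst h
    filter_upwards [eventually_all.mpr fun i => eventually_prism_mem X n m U i hx] with N hN
    have : (prismHomotopy X n m U N).toChainHomotopy.hom p (p + 1) =
        -∑ i : Fin (p + 1), ((-1 : ℤ) ^ (i : ℕ)) • prism X n m U N i :=
      SimplicialObject.Homotopy.ToChainHomotopy.hom_eq _ p
    rw [this]
    -- The chain homotopy is a signed sum of prisms, and the homomorphisms sending `x` into the
    -- quasi-finite part form a subgroup.
    let K := homsInto x ((ZFm.incl X n m).app (op (U ⊗ simplex k (p + 1)))).hom.range
    have hK (i : Fin (p + 1)) : prism X n m U N i ∈ K := hN i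
    exact K.neg_mem (sum_mem fun i _ => zsmul_mem (hK i) _)
  · refine Eventually.of_forall fun N => ?_
    have : (prismHomotopy X n m U N).toChainHomotopy.hom p q = 0 :=
      SimplicialObject.Homotopy.ToChainHomotopy.hom_eq_zero _ p q h
    rw [this]
    exact zero_mem _

/-- The inclusion of `C_*ℤF^qfₘ(U, X₊ ∧ Tⁿ⁺¹)` into `C_*ℤFₘ(U, X₊ ∧ Tⁿ⁺¹)`. -/
abbrev suslinIncl : ((suslin k).obj (ZFqfm X n m)).obj (op U) ⟶
    ((suslin k).obj (ZFm X n m)).obj (op U) :=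
  ((suslin k).map (ZFm.incl X n m)).app (op U)

theorem suslinIncl_injective (l : ℕ) : Function.Injective ((suslinIncl X n m U).f l) := by
  have := compactSpace_tensor_simplex U l
  have := isLocallyNoetherian_tensor_simplex U l
  exact ZFm.incl_injective (U := U ⊗ simplex k l)

/-- `N` is chosen after `x` and its boundary. Both conditions hold for all large `N`, hence
simultaneously for some `N`; no single `N` is asked to work for the whole complex. -/
theorem compressesRelativeCycles_suslinIncl : CompressesRelativeCycles (suslinIncl X n m U) := by
  refine compressesRelativeCycles_of_homotopy fun l x a ha => ?_
  have := compactSpace_tensor_simplex U l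
  have := isLocallyNoetherian_tensor_simplex U l
  obtain ⟨N, h1, h2⟩ := ((eventually_chainHomotopy_mem X n m U _ l
    ⟨a, rfl⟩).and (eventually_atTop.mpr (ZFm.exists_twist_one_mem (U := U ⊗ simplex k l) x))).exists
  refine ⟨_, _, (prismHomotopy X n m U N).toChainHomotopy, CategoryTheory.Functor.map_id _ _, ?_, h1⟩
  rw [← simplicialTwist_app] at h2
  exact h2

end Level

/-! ### Passage to the colimit -/

section Colimit

/-- A cocone of complexes of abelian groups over a sequence exhibits its point as the union of the
images of the terms, and elements which vanish in it vanish at a finite stage. -/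
structure IsElementwiseColimit {ι : Type*} {c : ComplexShape ι}
    {F : ℕ ⥤ HomologicalComplex AddCommGrpCat.{v} c} (s : Cocone F) : Prop where
  exists_rep : ∀ {i : ι} (x : s.pt.X i), ∃ (m : ℕ) (y : (F.obj m).X i), (s.ι.app m).f i y = x
  exists_map_eq_zero : ∀ {i : ι} {m : ℕ} (y : (F.obj m).X i), (s.ι.app m).f i y = 0 →
    ∃ (m' : ℕ) (h : m ≤ m'), (F.map (homOfLE h)).f i y = 0

variable {ι : Type*} {c : ComplexShape ι} {F G : ℕ ⥤ HomologicalComplex AddCommGrpCat.{v} c}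
  {s : Cocone F} {t : Cocone G} {τ : G ⟶ F} {α : t.pt ⟶ s.pt}

theorem cocone_map_apply (s : Cocone F) {m m' : ℕ} (f : m ⟶ m') (i : ι) (y : (F.obj m).X i) :
    (s.ι.app m').f i ((F.map f).f i y) = (s.ι.app m).f i y := by
  rw [← s.w f]
  rfl

theorem complexHom_d_apply {A B : HomologicalComplex AddCommGrpCat.{v} c} (f : A ⟶ B) (i j : ι)
    (x : A.X i) : f.f j (A.d i j x) = B.d i j (f.f i x) := by
  rw [← ConcreteCategory.comp_apply, ← ConcreteCategory.comp_apply, f.comm]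

theorem IsElementwiseColimit.exists_rep_ge (hs : IsElementwiseColimit s) {i : ι} (x : s.pt.X i)
    {m : ℕ} : ∃ (m' : ℕ) (_ : m ≤ m') (y : (F.obj m').X i), (s.ι.app m').f i y = x := by
  obtain ⟨m₁, y, rfl⟩ := hs.exists_rep x
  exact ⟨max m m₁, le_max_left _ _, (F.map (homOfLE (le_max_right _ _))).f i y,
    cocone_map_apply s _ i y⟩

theorem injective_of_isElementwiseColimit (hs : IsElementwiseColimit s)
    (ht : IsElementwiseColimit t) (hα : ∀ m, t.ι.app m ≫ α = τ.app m ≫ s.ι.app m) (i : ι)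
    (h : ∀ m, Function.Injective ((τ.app m).f i)) : Function.Injective (α.f i) := by
  rw [injective_iff_map_eq_zero]
  intro a ha
  obtain ⟨m, a, rfl⟩ := ht.exists_rep a
  have hα' : α.f i ((t.ι.app m).f i a) = (s.ι.app m).f i ((τ.app m).f i a) :=
    congrArg (fun f => f.f i a) (hα m)
  rw [hα'] at ha
  obtain ⟨m', hm, h0⟩ := hs.exists_map_eq_zero _ ha
  have hτ : (τ.app m').f i ((G.map (homOfLE hm)).f i a) =
      (F.map (homOfLE hm)).f i ((τ.app m).f i a) :=
    congrArg (fun f => f.f i a) (τ.naturality (homOfLE hm))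
  rw [h0] at hτ
  rw [← cocone_map_apply t (homOfLE hm), h m' (hτ.trans (map_zero ((τ.app m').f i).hom).symm)]
  exact map_zero _

/-- A chain and a preimage of its boundary are represented at a common stage, and their equality
holds at a later one; there the condition at a finite level applies. No compatibility between the
homotopies at different stages is needed. -/
theorem compressesRelativeCycles_of_isElementwiseColimit (hs : IsElementwiseColimit s)
    (ht : IsElementwiseColimit t) (hα : ∀ m, t.ι.app m ≫ α = τ.app m ≫ s.ι.app m)
    (h : ∀ m, CompressesRelativeCycles (τ.app m)) : CompressesRelativeCycles α := by
  have hα' (m : ℕ) (i : ι) (a : (G.obj m).X i) :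
      α.f i ((t.ι.app m).f i a) = (s.ι.app m).f i ((τ.app m).f i a) :=
    congrArg (fun f => f.f i a) (hα m)
  have hτ {m m' : ℕ} (f : m ⟶ m') (i : ι) (a : (G.obj m).X i) :
      (τ.app m').f i ((G.map f).f i a) = (F.map f).f i ((τ.app m).f i a) :=
    congrArg (fun f => f.f i a) (τ.naturality f)
  intro i x hx
  obtain ⟨a, ha⟩ := hx (c.next i)
  obtain ⟨m₀, a, rfl⟩ := ht.exists_rep a
  obtain ⟨m, hm, x, rfl⟩ := hs.exists_rep_ge x (m := m₀)
  rw [hα', ← complexHom_d_apply, ← cocone_map_apply s (homOfLE hm), ← sub_eq_zero, ← map_sub] at ha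
  obtain ⟨m', hm', h0⟩ := hs.exists_map_eq_zero _ ha
  rw [map_sub, sub_eq_zero, ← hτ, ← hτ, complexHom_d_apply] at h0
  obtain ⟨j, y, b, hb⟩ := h m' i ((F.map (homOfLE hm')).f i x) fun j => by
    by_cases hj : c.Rel i j
    · obtain rfl := c.next_eq' hj
      exact ⟨_, h0⟩
    · exact ⟨0, by rw [(F.obj m').shape _ _ hj, map_zero]; rfl⟩
  refine ⟨j, (s.ι.app m').f j y, (t.ι.app m').f i b, ?_⟩
  rw [hα', ← complexHom_d_apply, ← map_add, hb, cocone_map_apply]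

end Colimit

/-! ### The Suslin complexes of the colimit over suspensions -/

section Suslin

variable {k : Type u} [Field k]

instance : PreservesColimitsOfShape ℕ (forget AddCommGrpCat.{v}) :=
  have := preservesFilteredColimitsOfSize_shrink.{0, v, 0, v} (forget AddCommGrpCat.{v})
  PreservesFilteredColimitsOfSize.preserves_filtered_colimits ℕ

theorem exists_colimit_rep (F : ℕ ⥤ (Over (pt k))ᵒᵖ ⥤ AddCommGrpCat.{u + 1}) (V : (Over (pt k))ᵒᵖ)
    (x : (colimit F).obj V) : ∃ (m : ℕ) (y : (F.obj m).obj V), (colimit.ι F m).app V y = x :=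
  Concrete.isColimit_exists_rep _
    (isColimitOfPreserves ((evaluation _ _).obj V) (colimit.isColimit F)) x

theorem exists_map_eq_zero (F : ℕ ⥤ (Over (pt k))ᵒᵖ ⥤ AddCommGrpCat.{u + 1})
    (V : (Over (pt k))ᵒᵖ) {m : ℕ} (y : (F.obj m).obj V) (hy : (colimit.ι F m).app V y = 0) :
    ∃ (m' : ℕ) (h : m ≤ m'), (F.map (homOfLE h)).app V y = 0 := by
  obtain ⟨m', f, g, h⟩ := Concrete.isColimit_exists_of_rep_eq _
    (isColimitOfPreserves ((evaluation _ _).obj V) (colimit.isColimit F)) y 0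
    (hy.trans (map_zero ((colimit.ι F m).app V).hom).symm)
  exact ⟨m', leOfHom f, h.trans (map_zero _)⟩

/-- The complex `C_*F(U)`, as a functor of `F`. -/
abbrev suslinAt (U : Over (pt k)) :
    ((Over (pt k))ᵒᵖ ⥤ AddCommGrpCat.{u + 1}) ⥤ ChainComplex AddCommGrpCat.{u + 1} ℕ :=
  suslin k ⋙ (evaluation _ _).obj (op U)

open MonoidalCategory in
-- In degree `l` the complex is the evaluation at `U × Δˡ`; colimits of presheaves are computed
-- sectionwise, and sequential colimits of abelian groups on underlying sets.
theorem isElementwiseColimit_suslinAt (F : ℕ ⥤ (Over (pt k))ᵒᵖ ⥤ AddCommGrpCat.{u + 1})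
    (U : Over (pt k)) :
    IsElementwiseColimit ((suslinAt U).mapCocone (colimit.cocone F)) where
  exists_rep {l} x := exists_colimit_rep F (op (U ⊗ simplex k l)) x
  exists_map_eq_zero {l _} y hy := exists_map_eq_zero F (op (U ⊗ simplex k l)) y hy

variable (X : Over (pt k)) (n : ℕ) (U : Over (pt k))

/-- The inclusions `ℤF^qfₘ(-, X₊ ∧ Tⁿ⁺¹) ⟶ ℤFₘ(-, X₊ ∧ Tⁿ⁺¹)` for all `m`. -/
def inclSequence : (Functor.ofSequence fun m => ZFqfm.susp X n m) ⟶
    Functor.ofSequence fun m => ZFm.susp X n m :=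
  NatTrans.ofSequence (F := Functor.ofSequence fun m => ZFqfm.susp X n m)
    (G := Functor.ofSequence fun m => ZFm.susp X n m) (fun m => ZFm.incl X n m) (by
      intro m
      rw [Functor.ofSequence_map_homOfLE_succ, Functor.ofSequence_map_homOfLE_succ]
      exact ZFm.susp_incl X n m)

theorem suslinAt_incl_comm (m : ℕ) :
    (suslinAt U).map (colimit.ι (Functor.ofSequence fun m => ZFqfm.susp X n m) m) ≫
      (suslinAt U).map (ZF.incl X n) =
    (suslinAt U).map ((inclSequence X n).app m) ≫
      (suslinAt U).map (colimit.ι (Functor.ofSequence fun m => ZFm.susp X n m) m) :=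
  ((CategoryTheory.Functor.map_comp _ _ _).symm.trans
    (congrArg (suslinAt U).map (ι_colimMap (inclSequence X n) m))).trans
      (CategoryTheory.Functor.map_comp _ _ _)

variable [LocallyOfFiniteType U.hom] [QuasiCompact U.hom]

theorem suslinAt_incl_injective (l : ℕ) :
    Function.Injective (((suslinAt U).map (ZF.incl X n)).f l) :=
  injective_of_isElementwiseColimit (isElementwiseColimit_suslinAt _ U)
    (isElementwiseColimit_suslinAt _ U) (τ := Functor.whiskerRight (inclSequence X n) (suslinAt U))
    (suslinAt_incl_comm X n U) l fun m => suslinIncl_injective X n m U l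

theorem quasiIso_suslinAt_incl : QuasiIso ((suslinAt U).map (ZF.incl X n)) :=
  quasiIso_of_compressesRelativeCycles (suslinAt_incl_injective X n U)
    (compressesRelativeCycles_of_isElementwiseColimit (isElementwiseColimit_suslinAt _ U)
      (isElementwiseColimit_suslinAt _ U)
      (τ := Functor.whiskerRight (inclSequence X n) (suslinAt U))
      (suslinAt_incl_comm X n U) fun m => compressesRelativeCycles_suslinIncl X n m U)

end Suslin

/-! ### Restriction to smooth schemes and the Zariski topology -/

section Smooth

variable {k : Type u} [Field k] (X : Sm k) (n : ℕ)

theorem CZF.incl_injective (U : Sm k) (l : ℕ) :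
    Function.Injective (((CZF.incl X n).app (op U)).f l) :=
  have : LocallyOfFiniteType U.toComma.hom := U.prop.1.2
  have : QuasiCompact U.toComma.hom := U.prop.2
  suslinAt_incl_injective X.toComma n U.toComma l

theorem CZF.quasiIso_incl (U : Sm k) : QuasiIso ((CZF.incl X n).app (op U)) :=
  have : LocallyOfFiniteType U.toComma.hom := U.prop.1.2
  have : QuasiCompact U.toComma.hom := U.prop.2
  quasiIso_suslinAt_incl X.toComma n U.toComma

/-- The map of homology presheaves is already bijective on sections, so no covering has to be
chosen. -/
theorem isZariskiLocalQuasiIso_of_quasiIso {F G : (Sm k)ᵒᵖ ⥤ ChainComplex AddCommGrpCat.{v} ℕ}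
    (α : F ⟶ G) (h : ∀ U, QuasiIso (α.app U)) : IsZariskiLocalQuasiIso α := by
  have hb (i : ℕ) (U : (Sm k)ᵒᵖ) : Function.Bijective ((Functor.whiskerRight α
      (HomologicalComplex.homologyFunctor AddCommGrpCat.{v} _ i)).app U) := by
    have := (quasiIsoAt_iff_isIso_homologyMap (α.app U) i).mp inferInstance
    exact ConcreteCategory.bijective_of_isIso (HomologicalComplex.homologyMap (α.app U) i)
  exact fun i => ⟨Presheaf.isLocallyInjective_of_injective _ _ fun U => (hb i U).1,
    Presheaf.isLocallySurjective_of_surjective _ _ fun U => (hb i U).2⟩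

end Smooth

end FramedSphere

end

/-- For every smooth `k`-scheme `X` and every `n ≥ 0`, the map
`C_*ℤF^qf(X₊ ∧ Tⁿ⁺¹) ⟶ C_*ℤF(X₊ ∧ Tⁿ⁺¹)` is injective, it is a Zariski-local quasi-isomorphism,
and it is a quasi-isomorphism on sections over every affine smooth `k`-scheme. -/
theorem theorem1p5 {k : Type u} [Field k] (X : FramedSphere.Sm k) (n : ℕ) :
    Mono (FramedSphere.CZF.incl X n) ∧
      FramedSphere.IsZariskiLocalQuasiIso (FramedSphere.CZF.incl X n) ∧
      ∀ U : FramedSphere.Sm k, IsAffine U.left →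
        QuasiIso ((FramedSphere.CZF.incl X n).app (op U)) := by
  refine ⟨?_, FramedSphere.isZariskiLocalQuasiIso_of_quasiIso _ fun U =>
    FramedSphere.CZF.quasiIso_incl X n U.unop, fun U _ => FramedSphere.CZF.quasiIso_incl X n U⟩
  have (U : (FramedSphere.Sm k)ᵒᵖ) : Mono ((FramedSphere.CZF.incl X n).app U) :=
    HomologicalComplex.mono_of_mono_f _ fun l => (AddCommGrpCat.mono_iff_injective _).mpr
      (FramedSphere.CZF.incl_injective X n U.unop l)
  exact NatTrans.mono_of_mono_app _
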